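/- Let $n_1,n_2\ge 2$ and $n_3,n_4\ge 1$, and let $R\ge 0$ be an integer with $$R\le\min\left\{\tfrac12(n_1-1)(n_2-2),\ n_3n_4\right\}.$$ A property of real variables holds generically if it holds wherever some fixed polynomial in these variables that is not identically zero does not vanish. The claim is that the JLV algorithm decomposes a generic tensor of rank $R$ in $\mathbb R^{n_1\times n_2\times n_3\times n_4}$ in polynomial time, in the following sense. The JLV algorithm, applied to $T\in\mathbb R^{n_1\times n_2\times n_3\times n_4}$: let $\mathcal U\subseteq\mathbb R^{n_1\times n_2}$ be the span of the $n_3n_4$ matrices $(T_{ijkl})_{i,j}$. For matrices $u,u'$ put $u\vee u'=\frac12(u\otimes u'+u'\otimes u)$, let $S^2(\mathcal U)$ be the span of all $u\vee u'$ with $u,u'\in\mathcal U$, and let $E_{abcd}=e_{ab}\vee e_{cd}-e_{ad}\vee e_{cb}$ for $a<c$, $b<d$, where $e_{ab}$ are the matrix units. (1) Take a basis $P_1,\dots,P_s$ of $S^2(\mathcal U)\cap\mathrm{span}\{E_{abcd}\}^\perp$. (2) Apply simultaneous diagonalization to $\sum_k P_k\otimes e_k$ with functionals $x,y\in\mathbb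 R^s$: put $A=\sum_k x_kP_k$, $B=\sum_k y_kP_k$ and let $A^+,B^+$ be the Moore–Penrose pseudo-inverses; find the nonzero real eigenvalues $\lambda_i$ of $AB^+$, which must have one-dimensional eigenspaces, with eigenvectors $u_i$; match these with eigenvectors $v_i$ of $(A^+B)^\top$ for the eigenvalues $\lambda_i^{-1}$; solve $\sum_k P_k\otimes e_k=\sum_i u_i\otimes v_i\otimes z_i$ for the vectors $z_i$. (3) Factor $u_i=\hat a^i(\hat b^i)^\top$, solve $T=\sum_i u_i\otimes M_i$ for the matrices $M_i\in\mathbb R^{n_3\times n_4}$, factor $M_i=\hat c^i(\hat d^i)^\top$, and output the quadruples $(\hat a^i,\hat b^i,\hat c^i,\hat d^i)$. A run is successful if all of these steps can be carried out. Let $T=\sum_{\ell=1}^R a^\ell\otimes b^\ell\otimes c^\ell\otimes d^\ell$ with $a^\ell\in\mathbb R^{n_1}$, $b^\ell\in\mathbb R^{n_2}$, $c^\ell\in\mathbb R^{n_3}$, $d^\ell\in\mathbb R^{n_4}$. Then for generic components $(a^\ell,b^\ell,c^\ell,d^\ell)_{\ell=1}^R$: (i) $T$ has tensor rank exactly $R$;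 (ii) for every choice of the basis $P_1,\dots,P_s$ and for generic functionals $x,y$, a successful run exists; (iii) every successful run outputs exactly $R$ quadruples, and they are the given ones up to a permutation and, within each quadruple, rescaling of the four vectors by scalars with product $1$. Moreover, there are a single deterministic program and a polynomial $q$, independent of $n_1,\dots,n_4$ and $R$, such that on every input tensor $T\in\mathbb R^{n_1\times n_2\times n_3\times n_4}$ the program halts within $q(n_1n_2n_3n_4)$ steps, and for generic components as above its result is the output of a successful run of the JLV algorithm. Programs run on a real-number machine whose data are binary trees with real leaves, with unit-cost exact arithmetic, comparison, access to and formation of subtrees, branching and loops, and with one further instruction that returns the distinct real roots of a univariate polynomial given by its list of coefficients, at a cost of one plus the length of that list. -/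

import Mathlib

noncomputable section

/-! ### Genericity -/

/-- A property of a point `w` of real affine space (with finitely many coordinates, indexed by `σ`)
holds generically if it holds off the zero set of some nonzero real polynomial. -/
def Generically {σ : Type} (Q : (σ → ℝ) → Prop) : Prop :=
  ∃ p : MvPolynomial σ ℝ, p ≠ 0 ∧ ∀ w : σ → ℝ, MvPolynomial.eval w p ≠ 0 → Q w

/-! ### Order-4 tensors and lists of components -/

/-- Real tensors of format `n₁ × n₂ × n₃ × n₄`. -/
abbrev Tensor4 (n₁ n₂ n₃ n₄ : ℕ) : Type := Fin n₁ → Fin n₂ → Fin n₃ → Fin n₄ → ℝ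

/-- Index set of the entries of `R` quadruples of vectors
`(a^ℓ, b^ℓ, c^ℓ, d^ℓ) ∈ ℝ^{n₁} × ℝ^{n₂} × ℝ^{n₃} × ℝ^{n₄}`. -/
abbrev CompIdx (n₁ n₂ n₃ n₄ R : ℕ) : Type := Fin R × (Fin n₁ ⊕ Fin n₂ ⊕ Fin n₃ ⊕ Fin n₄)

/-- A list of `R` quadruples of component vectors, as one point of affine space. -/
abbrev Components (n₁ n₂ n₃ n₄ R : ℕ) : Type := CompIdx n₁ n₂ n₃ n₄ R → ℝ

namespace Components

variable {n₁ n₂ n₃ n₄ R : ℕ}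

/-- The first component vector of the `ℓ`-th term. -/
def a (w : Components n₁ n₂ n₃ n₄ R) (ℓ : Fin R) : Fin n₁ → ℝ := fun i => w (ℓ, Sum.inl i)

/-- The second component vector of the `ℓ`-th term. -/
def b (w : Components n₁ n₂ n₃ n₄ R) (ℓ : Fin R) : Fin n₂ → ℝ :=
  fun j => w (ℓ, Sum.inr (Sum.inl j))

/-- The third component vector of the `ℓ`-th term. -/
def c (w : Components n₁ n₂ n₃ n₄ R) (ℓ : Fin R) : Fin n₃ → ℝ :=
  fun k => w (ℓ, Sum.inr (Sum.inr (Sum.inl k)))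

/-- The fourth component vector of the `ℓ`-th term. -/
def d (w : Components n₁ n₂ n₃ n₄ R) (ℓ : Fin R) : Fin n₄ → ℝ :=
  fun l => w (ℓ, Sum.inr (Sum.inr (Sum.inr l)))

/-- The tensor `∑ ℓ, a^ℓ ⊗ b^ℓ ⊗ c^ℓ ⊗ d^ℓ`. -/
def tensor (w : Components n₁ n₂ n₃ n₄ R) : Tensor4 n₁ n₂ n₃ n₄ :=
  fun i j k l => ∑ ℓ, w.a ℓ i * w.b ℓ j * w.c ℓ k * w.d ℓ l

/-- `out` is the list of components `w` up to the inherent ambiguities: a reordering of the terms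
and, inside each term, a rescaling of the four vectors by factors whose product is `1`
(so that the rank-one terms themselves agree). -/
def SameUpToPermScale {t : ℕ} (out : Components n₁ n₂ n₃ n₄ t)
    (w : Components n₁ n₂ n₃ n₄ R) : Prop :=
  ∃ e : Fin t ≃ Fin R, ∀ ℓ : Fin t, ∃ α β γ δ : ℝ, α * β * γ * δ = 1 ∧
    out.a ℓ = α • w.a (e ℓ) ∧ out.b ℓ = β • w.b (e ℓ) ∧
    out.c ℓ = γ • w.c (e ℓ) ∧ out.d ℓ = δ • w.d (e ℓ)

end Components

/-! ### The JLV algorithm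

`m × n` matrices are vectors indexed by `Fin m × Fin n`; elements of the tensor square of that space
are matrices with rows and columns indexed by `Fin m × Fin n`. -/

namespace JLV

/-- The space `ℝ^{m × n}`. -/
abbrev V (m n : ℕ) : Type := Fin m × Fin n → ℝ

/-- The tensor square of `ℝ^{m × n}`. -/
abbrev VV (m n : ℕ) : Type := Matrix (Fin m × Fin n) (Fin m × Fin n) ℝ

/-- The rank-one matrix `x yᵀ`. -/
def outer {m n : ℕ} (x : Fin m → ℝ) (y : Fin n → ℝ) : V m n := fun p => x p.1 * y p.2

/-- The symmetric 2-tensor `u ∨ u' = ½ u ⊗ u' + ½ u' ⊗ u`. -/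
def symProd {m n : ℕ} (u u' : V m n) : VV m n :=
  (1 / 2 : ℝ) • Matrix.vecMulVec u u' + (1 / 2 : ℝ) • Matrix.vecMulVec u' u

/-- `S²(U)`, the span of all `u ∨ u'` with `u, u' ∈ U`. -/
def symSquare {m n : ℕ} (U : Submodule ℝ (V m n)) : Submodule ℝ (VV m n) :=
  Submodule.span ℝ {M | ∃ u ∈ U, ∃ u' ∈ U, M = symProd u u'}

/-- The matrix with `1` in the entry `(i, j)` and `0` elsewhere. -/
def unitMat {m n : ℕ} (i : Fin m) (j : Fin n) : V m n := Pi.single (i, j) 1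

/-- The symmetric 2-tensor of the `2 × 2` minor `v_{ab} v_{cd} - v_{ad} v_{cb}`. -/
def minorTensor {m n : ℕ} (a : Fin m) (b : Fin n) (c : Fin m) (d : Fin n) : VV m n :=
  symProd (unitMat a b) (unitMat c d) - symProd (unitMat a d) (unitMat c b)

/-- The span of the tensors of all `2 × 2` minors. -/
def minorSpan (m n : ℕ) : Submodule ℝ (VV m n) :=
  Submodule.span ℝ {M | ∃ (a : Fin m) (b : Fin n) (c : Fin m) (d : Fin n),
    a < c ∧ b < d ∧ M = minorTensor a b c d}

/-- The inner product `⟨M, N⟩ = ∑ M_{pq} N_{pq}`. -/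
def pairing {m n : ℕ} (M N : VV m n) : ℝ := ∑ p, ∑ q, M p q * N p q

/-- Orthogonal complement with respect to `pairing`. -/
def perp {m n : ℕ} (W : Submodule ℝ (VV m n)) : Submodule ℝ (VV m n) where
  carrier := {M | ∀ N ∈ W, pairing M N = 0}
  zero_mem' := by
    intro N _
    simp [pairing]
  add_mem' := by
    intro M M' hM hM' N hN
    have h := hM N hN
    have h' := hM' N hN
    simp only [pairing] at h h' ⊢
    simp only [Matrix.add_apply, add_mul, Finset.sum_add_distrib, h, h', add_zero]
  smul_mem' := by
    intro r M hM N hN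
    have h := hM N hN
    simp only [pairing] at h ⊢
    simp only [Matrix.smul_apply, smul_eq_mul, mul_assoc, ← Finset.mul_sum, h, mul_zero]

/-- Moore–Penrose pseudo-inverse of a real square matrix. -/
structure IsPseudoInverse {ι : Type} [Fintype ι] (A X : Matrix ι ι ℝ) : Prop where
  left : A * X * A = A
  right : X * A * X = X
  symm_left : (A * X).transpose = A * X
  symm_right : (X * A).transpose = X * A

/-- A successful (non-failing) run of simultaneous diagonalization on the order-3 tensor
`∑ k, P k ⊗ e_k`, with the two functionals `x` and `y` on the third factor.
Form the contractions `A = ∑ x_k P_k` and `B = ∑ y_k P_k`; compute the nonzero real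
eigenvalues `lam i` of `A B⁺`, whose eigenspaces must be lines, with eigenvectors `u i`; match them
with eigenvectors `v i` of `(A⁺ B)ᵀ` for the reciprocal eigenvalues; finally solve the linear
system `∑ k, P k ⊗ e_k = ∑ i, u i ⊗ v i ⊗ z i` for the vectors `z i`. -/
structure SimDiagRun {ι : Type} [Fintype ι] {s t : ℕ} (P : Fin s → Matrix ι ι ℝ)
    (x y : Fin s → ℝ) (A' B' : Matrix ι ι ℝ) (lam : Fin t → ℝ) (u v : Fin t → ι → ℝ)
    (z : Fin t → Fin s → ℝ) : Prop where
  pinv_A : IsPseudoInverse (∑ k, x k • P k) A'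
  pinv_B : IsPseudoInverse (∑ k, y k • P k) B'
  lam_inj : Function.Injective lam
  lam_ne : ∀ i, lam i ≠ 0
  u_ne : ∀ i, u i ≠ 0
  v_ne : ∀ i, v i ≠ 0
  eig_u : ∀ i, ((∑ k, x k • P k) * B').mulVec (u i) = lam i • u i
  eig_all : ∀ (μ : ℝ) (r : ι → ℝ), μ ≠ 0 → r ≠ 0 →
    ((∑ k, x k • P k) * B').mulVec r = μ • r → ∃ i, μ = lam i ∧ ∃ κ : ℝ, r = κ • u i
  eig_v : ∀ i, ((A' * (∑ k, y k • P k)).transpose).mulVec (v i) = (lam i)⁻¹ • v i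
  solve : ∀ k, P k = ∑ i, z i k • Matrix.vecMulVec (u i) (v i)

variable {n₁ n₂ n₃ n₄ : ℕ}

/-- The span, in `ℝ^{n₁ × n₂}`, of the columns of the flattening of `T` along its first two modes
(rows indexed by `(i, j)`, columns by `(k, l)`). -/
def colSpace (T : Tensor4 n₁ n₂ n₃ n₄) : Submodule ℝ (V n₁ n₂) :=
  Submodule.span ℝ (Set.range fun q : Fin n₃ × Fin n₄ => fun p : Fin n₁ × Fin n₂ =>
    T p.1 p.2 q.1 q.2)

/-- `P` is a basis of `S²(U) ∩ span{minor tensors}^⊥` for the column space `U` of `T`. -/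
def IsLiftBasis (T : Tensor4 n₁ n₂ n₃ n₄) {s : ℕ} (P : Fin s → VV n₁ n₂) : Prop :=
  LinearIndependent ℝ P ∧
    Submodule.span ℝ (Set.range P) = symSquare (colSpace T) ⊓ perp (minorSpan n₁ n₂)

/-- A successful run, with output `out`, of the decomposition procedure on `T`, once the basis `P`
of `S²(U) ∩ span{minor tensors}^⊥` and the functionals `x, y` have been chosen: the simultaneous
diagonalization of `P` yields matrices `u i`; these are factored as `a^i (b^i)ᵀ`, and the linear
system `T = ∑ i, u i ⊗ M i` is solved by matrices `M i = c^i (d^i)ᵀ`. -/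
def IsRun (T : Tensor4 n₁ n₂ n₃ n₄) {s t : ℕ} (P : Fin s → VV n₁ n₂) (x y : Fin s → ℝ)
    (out : Components n₁ n₂ n₃ n₄ t) : Prop :=
  ∃ (A' B' : VV n₁ n₂) (lam : Fin t → ℝ) (u v : Fin t → V n₁ n₂) (z : Fin t → Fin s → ℝ),
    SimDiagRun P x y A' B' lam u v z ∧
    (∀ ℓ, u ℓ = outer (out.a ℓ) (out.b ℓ)) ∧
    ∀ i j k l, T i j k l = ∑ ℓ, u ℓ (i, j) * (out.c ℓ k * out.d ℓ l)

/-- `out` is the output of some successful run of the procedure on `T`. -/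
def IsOutput (T : Tensor4 n₁ n₂ n₃ n₄) {t : ℕ} (out : Components n₁ n₂ n₃ n₄ t) : Prop :=
  ∃ (s : ℕ) (P : Fin s → VV n₁ n₂) (x y : Fin s → ℝ), IsLiftBasis T P ∧ IsRun T P x y out

end JLV

/-! ### A machine model with step count

A Lisp-like (pointer machine) version of the real RAM: data are binary trees with real numbers at
the leaves, programs are built from unit-cost exact real arithmetic, comparison, access to subtrees,
composition, pairing, branching and while loops. Since exact eigenvalues are not computable by
arithmetic and comparisons alone, there is also an instruction that returns the real roots of
a univariate polynomial. -/

namespace RealMachine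

/-- Data: binary trees with real leaves. -/
inductive Val : Type
  | nil : Val
  | num : ℝ → Val
  | pair : Val → Val → Val

/-- The list with the given entries, as a right-nested tree. -/
def Val.ofList : List Val → Val
  | [] => Val.nil
  | h :: t => Val.pair h (Val.ofList t)

/-- The value of a leaf (`0` for anything that is not a number). -/
def Val.toReal : Val → ℝ
  | Val.num r => r
  | _ => 0

/-- The list of reals read off the right spine of a tree. -/
def Val.toReals : Val → List ℝ
  | Val.pair h t => h.toReal :: t.toReals
  | _ => []

/-- Branching and loop tests succeed on positive numbers. -/
def Val.IsTrue : Val → Prop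
  | Val.num r => 0 < r
  | _ => False

/-- The polynomial `c₀ + c₁ X + c₂ X² + ⋯` with the given list of coefficients. -/
def polyOfList : List ℝ → Polynomial ℝ
  | [] => 0
  | c :: l => Polynomial.C c + Polynomial.X * polyOfList l

/-- The distinct real roots in increasing order (the empty list for the zero polynomial). -/
def realRoots (p : Polynomial ℝ) : List ℝ := p.roots.toFinset.sort (· ≤ ·)

/-- Primitive instructions. -/
inductive Prim : Type
  | id | nil | zero | one | fst | snd | isPair | add | sub | mul | div | lt | roots

open Classical in
/-- The effect of a primitive instruction; binary operations act on a pair of numbers. -/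
def Prim.apply : Prim → Val → Val
  | Prim.id, v => v
  | Prim.nil, _ => Val.nil
  | Prim.zero, _ => Val.num 0
  | Prim.one, _ => Val.num 1
  | Prim.fst, Val.pair a _ => a
  | Prim.snd, Val.pair _ b => b
  | Prim.isPair, Val.pair _ _ => Val.num 1
  | Prim.isPair, _ => Val.num 0
  | Prim.add, Val.pair a b => Val.num (a.toReal + b.toReal)
  | Prim.sub, Val.pair a b => Val.num (a.toReal - b.toReal)
  | Prim.mul, Val.pair a b => Val.num (a.toReal * b.toReal)
  | Prim.div, Val.pair a b => Val.num (a.toReal / b.toReal)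
  | Prim.lt, Val.pair a b => Val.num (if a.toReal < b.toReal then 1 else 0)
  | Prim.roots, v => Val.ofList ((realRoots (polyOfList v.toReals)).map Val.num)
  | _, _ => Val.nil

/-- Unit cost, except that root extraction also pays for reading its list of coefficients. -/
def Prim.cost : Prim → Val → ℕ
  | Prim.roots, v => 1 + v.toReals.length
  | _, _ => 1

/-- Programs. -/
inductive Prog : Type
  | prim : Prim → Prog
  /-- first run the first program, then the second one on its result -/
  | seq : Prog → Prog → Prog
  /-- run both programs on the input and pair the results -/
  | both : Prog → Prog → Prog
  /-- `branch c f g`: if the test `c` succeeds run `f`, otherwise run `g` -/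
  | branch : Prog → Prog → Prog → Prog
  /-- `loop c f`: while the test `c` succeeds, replace the current value by the result of `f` -/
  | loop : Prog → Prog → Prog

/-- `Runs p v r t`: on input `v`, the program `p` halts with result `r` after `t` steps. -/
inductive Runs : Prog → Val → Val → ℕ → Prop
  | prim (o : Prim) (v : Val) : Runs (Prog.prim o) v (o.apply v) (o.cost v)
  | seq {f g : Prog} {v r r' : Val} {t t' : ℕ} :
      Runs f v r t → Runs g r r' t' → Runs (Prog.seq f g) v r' (t + t' + 1)
  | both {f g : Prog} {v r r' : Val} {t t' : ℕ} :
      Runs f v r t → Runs g v r' t' → Runs (Prog.both f g) v (Val.pair r r') (t + t' + 1)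
  | branch_true {c f g : Prog} {v b r : Val} {t t' : ℕ} :
      Runs c v b t → b.IsTrue → Runs f v r t' → Runs (Prog.branch c f g) v r (t + t' + 1)
  | branch_false {c f g : Prog} {v b r : Val} {t t' : ℕ} :
      Runs c v b t → ¬ b.IsTrue → Runs g v r t' → Runs (Prog.branch c f g) v r (t + t' + 1)
  | loop_done {c f : Prog} {v b : Val} {t : ℕ} :
      Runs c v b t → ¬ b.IsTrue → Runs (Prog.loop c f) v v (t + 1)
  | loop_step {c f : Prog} {v b v' r : Val} {t t' t'' : ℕ} :
      Runs c v b t → b.IsTrue → Runs f v v' t' → Runs (Prog.loop c f) v' r t'' →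
      Runs (Prog.loop c f) v r (t + t' + t'' + 1)

/-- The machine is deterministic. -/
theorem Runs.deterministic {p : Prog} {v r r' : Val} {t t' : ℕ}
    (h : Runs p v r t) (h' : Runs p v r' t') : r = r' ∧ t = t' := by
  induction h generalizing r' t' with
  | prim o v => cases h'; exact ⟨rfl, rfl⟩
  | seq _ _ ih1 ih2 =>
    cases h' with
    | seq a b =>
      obtain ⟨rfl, rfl⟩ := ih1 a
      obtain ⟨rfl, rfl⟩ := ih2 b
      exact ⟨rfl, rfl⟩
  | both _ _ ih1 ih2 =>
    cases h' with
    | both a b =>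
      obtain ⟨rfl, rfl⟩ := ih1 a
      obtain ⟨rfl, rfl⟩ := ih2 b
      exact ⟨rfl, rfl⟩
  | branch_true _ hb _ ih1 ih2 =>
    cases h' with
    | branch_true a _ b =>
      obtain ⟨rfl, rfl⟩ := ih1 a
      obtain ⟨rfl, rfl⟩ := ih2 b
      exact ⟨rfl, rfl⟩
    | branch_false a hn b =>
      obtain ⟨rfl, rfl⟩ := ih1 a
      exact absurd hb hn
  | branch_false _ hb _ ih1 ih2 =>
    cases h' with
    | branch_true a hn b =>
      obtain ⟨rfl, rfl⟩ := ih1 a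
      exact absurd hn hb
    | branch_false a _ b =>
      obtain ⟨rfl, rfl⟩ := ih1 a
      obtain ⟨rfl, rfl⟩ := ih2 b
      exact ⟨rfl, rfl⟩
  | loop_done _ hb ih1 =>
    cases h' with
    | loop_done a _ =>
      obtain ⟨rfl, rfl⟩ := ih1 a
      exact ⟨rfl, rfl⟩
    | loop_step a hn _ _ =>
      obtain ⟨rfl, rfl⟩ := ih1 a
      exact absurd hn hb
  | loop_step _ hb _ _ ih1 ih2 ih3 =>
    cases h' with
    | loop_done a hn =>
      obtain ⟨rfl, rfl⟩ := ih1 a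
      exact absurd hb hn
    | loop_step a _ b d =>
      obtain ⟨rfl, rfl⟩ := ih1 a
      obtain ⟨rfl, rfl⟩ := ih2 b
      obtain ⟨rfl, rfl⟩ := ih3 d
      exact ⟨rfl, rfl⟩

/-- A finite sequence of data as a list. -/
def encSeq {n : ℕ} (f : Fin n → Val) : Val := Val.ofList (List.ofFn f)

/-- A vector as the list of its entries. -/
def encVec {n : ℕ} (x : Fin n → ℝ) : Val := encSeq fun i => Val.num (x i)

/-- A tensor as a nested list of its entries. -/
def encTensor {n₁ n₂ n₃ n₄ : ℕ} (T : Tensor4 n₁ n₂ n₃ n₄) : Val :=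
  encSeq fun i => encSeq fun j => encSeq fun k => encVec (T i j k)

/-- A list of components as the list of the quadruples of vectors. -/
def encComponents {n₁ n₂ n₃ n₄ t : ℕ} (w : Components n₁ n₂ n₃ n₄ t) : Val :=
  encSeq fun ℓ => Val.pair (encVec (w.a ℓ))
    (Val.pair (encVec (w.b ℓ)) (Val.pair (encVec (w.c ℓ)) (encVec (w.d ℓ))))

end RealMachine

end

/-!
Write `u_ℓ = a^ℓ (b^ℓ)ᵀ` and `M_ℓ = c^ℓ (d^ℓ)ᵀ`, so that `T = ∑ u_ℓ ⊗ M_ℓ`. Everything rests on the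
conditions `Components.General`: the `u_ℓ` are independent, the `M_ℓ` are independent, no coordinate
vanishes, and a symmetric combination of the products `u_k ∨ u_l`, `k ≠ l`, that is annihilated by
all `2 × 2` minors is zero. Each of them holds wherever a suitable polynomial in the components does
not vanish, so `generically_general` only has to exhibit one point where they hold. The point is a grid of
`(n₁ - 1) ⌊n₂ / 2⌋` pairs of vectors (`ex_minors`), which is where the bound on `R` comes from.

In general position the column space of `T` is the span of the `u_ℓ` (`General.colSpace_tensor`);
hence `R` is the rank of a flattening and so the tensor rank (`General.rank`). Moreover the space
`S²(U) ∩ span{minors}^⊥` is spanned by the squares `u_ℓ u_ℓᵀ` (`General.liftSpace`). With vectors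
`g_ℓ` in the span of the `u_ℓ` dual to them, two elements `A = ∑ α_ℓ u_ℓ u_ℓᵀ`,
`B = ∑ β_ℓ u_ℓ u_ℓᵀ` with nonzero coefficients satisfy `A B⁺ = ∑ (α_ℓ / β_ℓ) u_ℓ g_ℓᵀ`, and if the
ratios are distinct the eigenvectors are the `u_ℓ` (`JLV.simDiagRun_of_diag`). Conversely, if a run
is successful, the solvability of its last linear system forces all `α_ℓ`, `β_ℓ` to be nonzero, and
so the run finds exactly the `u_ℓ` (`JLV.simDiagRun_unique`).

The program (`RealMachine.decompose`) avoids generic choices. It computes the space `L` spanned by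
the `u_ℓ u_ℓᵀ` by elimination, and then the algebra of all matrices `X` that vanish on the orthogonal
complement of the column space and satisfy `X L ⊆ L`: these are exactly the matrices
`∑ ξ_ℓ u_ℓ g_ℓᵀ` (`RealMachine.isConstraints_algCons`). Along the moment curve
`θ ↦ ∑ θ^(s-1-k) X_k`, for a spanning list `X_k` of this algebra, only polynomially many values of
`θ` give coefficients `ξ_ℓ` that are zero or coincide, so trying `θ = 0, 1, 2, …` and keeping the
longest list of eigenvectors succeeds (`RealMachine.search_spec`). The eigenvalues are roots of an
annihilating polynomial, found by solving a linear system for a dependency between the powers of the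
matrix. Left eigenvectors are multiples of the `g_ℓ` and extract the `M_ℓ` from `T`. What is found is
`w` up to order and scaling, hence the output of a successful run (`General.isOutput`).

Running times are bounded by closure properties of the class of functions that some program computes
in polynomial time with polynomially bounded output (`RealMachine.PolyTime`), of which
`PolyTime.foldl` carries the weight: folding over a list stays in the class when each step enlarges
the accumulator by an amount independent of the accumulator.
-/

noncomputable section

/-! ### Polynomial-time functions on encoded data -/

namespace RealMachine

/-- Number of nodes of a tree. -/
def Val.size : Val → ℕ
  | Val.nil => 1
  | Val.num _ => 1
  | Val.pair a b => a.size + b.size + 1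

/-- Types whose elements are represented by trees. The representation is not required to be
injective: only the value computed by a program matters. -/
class Enc (α : Type) where
  /-- The tree representing an element. -/
  enc : α → Val

open Enc (enc)

instance : Enc ℝ := ⟨Val.num⟩

instance {α β : Type} [Enc α] [Enc β] : Enc (α × β) := ⟨fun p => Val.pair (enc p.1) (enc p.2)⟩

instance {α : Type} [Enc α] : Enc (List α) := ⟨fun l => Val.ofList (l.map enc)⟩

/-- Size of the representation of `a`. -/
def sz {α : Type} [Enc α] (a : α) : ℕ := (enc a).size

section Sizes

variable {α β : Type} [Enc α] [Enc β]

theorem enc_pair (a : α) (b : β) : enc (a, b) = Val.pair (enc a) (enc b) := rfl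

theorem enc_nil : enc ([] : List α) = Val.nil := rfl

theorem enc_cons (a : α) (l : List α) : enc (a :: l) = Val.pair (enc a) (enc l) := rfl

@[simp] theorem sz_real (r : ℝ) : sz r = 1 := rfl

@[simp] theorem sz_pair (p : α × β) : sz p = sz p.1 + sz p.2 + 1 := rfl

@[simp] theorem sz_nil : sz ([] : List α) = 1 := rfl

@[simp] theorem sz_cons (a : α) (l : List α) : sz (a :: l) = sz a + sz l + 1 := rfl

theorem sz_pos (a : α) : 1 ≤ sz a := by
  unfold sz
  cases enc a <;> simp [Val.size]

theorem length_le_sz (l : List α) : l.length + 1 ≤ sz l := by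
  induction l with
  | nil => simp
  | cons a l ih => simp; omega

theorem sz_le_of_mem {a : α} {l : List α} (h : a ∈ l) : sz a ≤ sz l := by
  induction l with
  | nil => simp at h
  | cons b l ih =>
    rcases List.mem_cons.1 h with rfl | h
    · simp; omega
    · have := ih h
      simp; omega

theorem sz_tail_le (l : List α) : sz l.tail ≤ sz l := by
  cases l with
  | nil => simp
  | cons a l => simp; omega

theorem sz_append (l l' : List α) : sz (l ++ l') + 1 = sz l + sz l' := by
  induction l with
  | nil => simp; omega
  | cons a l ih => simp; omega

theorem sz_reals (l : List ℝ) : sz l = 2 * l.length + 1 := by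
  induction l with
  | nil => rfl
  | cons a l ih => simp; omega

end Sizes

theorem eval_mono (q : Polynomial ℕ) {a b : ℕ} (h : a ≤ b) : q.eval a ≤ q.eval b := by
  rw [Polynomial.eval_eq_sum, Polynomial.eval_eq_sum]
  exact Finset.sum_le_sum fun i _ => Nat.mul_le_mul_left _ (Nat.pow_le_pow_left h i)

/-- `f` is computed by a program whose running time, and whose output size, are bounded by
a polynomial in the size of the input. The output size has to be bounded separately, because a
program can duplicate pointers and so build exponentially large trees in linear time. -/
def PolyTime {α β : Type} [Enc α] [Enc β] (f : α → β) : Prop :=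
  ∃ (p : Prog) (q : Polynomial ℕ), ∀ a,
    (∃ t, t ≤ q.eval (sz a) ∧ Runs p (enc a) (enc (f a)) t) ∧ sz (f a) ≤ q.eval (sz a)

namespace PolyTime

variable {α β γ δ : Type} [Enc α] [Enc β] [Enc γ] [Enc δ]

theorem of_prim (o : Prim) {f : α → β} (h : ∀ a : α, enc (f a) = o.apply (enc a))
    (q : Polynomial ℕ) (hc : ∀ a : α, o.cost (enc a) ≤ q.eval (sz a))
    (hs : ∀ a, sz (f a) ≤ q.eval (sz a)) : PolyTime f :=
  ⟨Prog.prim o, q, fun a => ⟨⟨_, hc a, by rw [h a]; exact Runs.prim o _⟩, hs a⟩⟩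

theorem comp {f : β → γ} {g : α → β} (hf : PolyTime f) (hg : PolyTime g) :
    PolyTime fun a => f (g a) := by
  obtain ⟨pf, qf, hf⟩ := hf
  obtain ⟨pg, qg, hg⟩ := hg
  refine ⟨Prog.seq pg pf, qg + qf.comp qg + 1, fun a => ?_⟩
  obtain ⟨⟨t, ht, rt⟩, hs⟩ := hg a
  obtain ⟨⟨t', ht', rt'⟩, hs'⟩ := hf (g a)
  have h1 := eval_mono qf hs
  simp only [Polynomial.eval_add, Polynomial.eval_comp, Polynomial.eval_one]
  exact ⟨⟨_, by omega, Runs.seq rt rt'⟩, by omega⟩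

theorem pair {f : α → β} {g : α → γ} (hf : PolyTime f) (hg : PolyTime g) :
    PolyTime fun a => (f a, g a) := by
  obtain ⟨pf, qf, hf⟩ := hf
  obtain ⟨pg, qg, hg⟩ := hg
  refine ⟨Prog.both pf pg, qf + qg + 1, fun a => ?_⟩
  obtain ⟨⟨t, ht, rt⟩, hs⟩ := hf a
  obtain ⟨⟨t', ht', rt'⟩, hs'⟩ := hg a
  simp only [Polynomial.eval_add, Polynomial.eval_one]
  exact ⟨⟨_, by omega, Runs.both rt rt'⟩, by simp; omega⟩

theorem id : PolyTime fun a : α => a :=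
  of_prim Prim.id (fun _ => rfl) Polynomial.X (fun a => by simpa [Prim.cost] using sz_pos a)
    (fun a => by simp)

theorem fst {f : α → β × γ} (hf : PolyTime f) : PolyTime fun a => (f a).1 :=
  comp (f := Prod.fst) (of_prim Prim.fst (fun _ => rfl) Polynomial.X
    (fun a => by simp [Prim.cost]) (fun a => by simp; omega)) hf

theorem snd {f : α → β × γ} (hf : PolyTime f) : PolyTime fun a => (f a).2 :=
  comp (f := Prod.snd) (of_prim Prim.snd (fun _ => rfl) Polynomial.X
    (fun a => by simp [Prim.cost]) (fun a => by simp; omega)) hf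

theorem nil : PolyTime fun _ : α => ([] : List β) :=
  of_prim Prim.nil (fun _ => rfl) 1 (fun a => by simp [Prim.cost]) (fun a => by simp)

theorem zero : PolyTime fun _ : α => (0 : ℝ) :=
  of_prim Prim.zero (fun _ => rfl) 1 (fun a => by simp [Prim.cost]) (fun a => by simp)

theorem one : PolyTime fun _ : α => (1 : ℝ) :=
  of_prim Prim.one (fun _ => rfl) 1 (fun a => by simp [Prim.cost]) (fun a => by simp)

theorem cons {f : α → β} {g : α → List β} (hf : PolyTime f) (hg : PolyTime g) :
    PolyTime fun a => f a :: g a := pair hf hg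

theorem add {f g : α → ℝ} (hf : PolyTime f) (hg : PolyTime g) : PolyTime fun a => f a + g a :=
  comp (f := fun p : ℝ × ℝ => p.1 + p.2) (of_prim Prim.add (fun _ => rfl) 1
    (fun a => by simp [Prim.cost]) (fun a => by simp)) (pair hf hg)

theorem sub {f g : α → ℝ} (hf : PolyTime f) (hg : PolyTime g) : PolyTime fun a => f a - g a :=
  comp (f := fun p : ℝ × ℝ => p.1 - p.2) (of_prim Prim.sub (fun _ => rfl) 1
    (fun a => by simp [Prim.cost]) (fun a => by simp)) (pair hf hg)

theorem mul {f g : α → ℝ} (hf : PolyTime f) (hg : PolyTime g) : PolyTime fun a => f a * g a :=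
  comp (f := fun p : ℝ × ℝ => p.1 * p.2) (of_prim Prim.mul (fun _ => rfl) 1
    (fun a => by simp [Prim.cost]) (fun a => by simp)) (pair hf hg)

theorem div {f g : α → ℝ} (hf : PolyTime f) (hg : PolyTime g) : PolyTime fun a => f a / g a :=
  comp (f := fun p : ℝ × ℝ => p.1 / p.2) (of_prim Prim.div (fun _ => rfl) 1
    (fun a => by simp [Prim.cost]) (fun a => by simp)) (pair hf hg)

theorem tail {f : α → List β} (hf : PolyTime f) : PolyTime fun a => (f a).tail :=
  comp (f := List.tail) (of_prim Prim.snd (fun l => by cases l <;> rfl) Polynomial.X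
    (fun a => by simpa [Prim.cost] using sz_pos a) (fun a => by simpa using sz_tail_le a)) hf

theorem headList {f : α → List (List β)} (hf : PolyTime f) : PolyTime fun a => (f a).headD [] :=
  comp (f := fun l : List (List β) => l.headD []) (of_prim Prim.fst (fun l => by cases l <;> rfl)
    Polynomial.X (fun a => by simpa [Prim.cost] using sz_pos a)
    (fun a => by cases a <;> simp; omega)) hf

/-- Branching on the sign of a real number. -/
theorem ite {c : α → ℝ} {f g : α → β} (hc : PolyTime c) (hf : PolyTime f) (hg : PolyTime g) :
    PolyTime fun a => if 0 < c a then f a else g a := by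
  obtain ⟨pc, qc, hc⟩ := hc
  obtain ⟨pf, qf, hf⟩ := hf
  obtain ⟨pg, qg, hg⟩ := hg
  refine ⟨Prog.branch pc pf pg, qc + qf + qg + 1, fun a => ?_⟩
  obtain ⟨⟨t, ht, rt⟩, hs⟩ := hc a
  obtain ⟨⟨t', ht', rt'⟩, hs'⟩ := hf a
  obtain ⟨⟨t'', ht'', rt''⟩, hs''⟩ := hg a
  simp only [Polynomial.eval_add, Polynomial.eval_one]
  by_cases h : 0 < c a
  · simp only [h, if_true]
    exact ⟨⟨_, by omega, Runs.branch_true rt h rt'⟩, by omega⟩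
  · simp only [h, if_false]
    exact ⟨⟨_, by omega, Runs.branch_false rt h rt''⟩, by omega⟩

/-- Branching on whether a list is empty. -/
theorem iteNil {l : α → List γ} {f g : α → β} (hl : PolyTime l) (hf : PolyTime f)
    (hg : PolyTime g) : PolyTime fun a => if (l a).isEmpty then g a else f a := by
  have h1 : PolyTime fun m : List γ => if m.isEmpty then (0 : ℝ) else 1 :=
    of_prim Prim.isPair (fun m => by cases m <;> rfl) 1 (fun a => by simp [Prim.cost])
      (fun a => by simp)
  have h2 := ite (comp h1 hl) hf hg
  have h3 : (fun a => if (l a).isEmpty then g a else f a) =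
      fun a => if 0 < (if (l a).isEmpty then (0 : ℝ) else 1) then f a else g a := by
    funext a
    cases (l a).isEmpty <;> simp
  rw [h3]
  exact h2

theorem headReal {f : α → List ℝ} (hf : PolyTime f) : PolyTime fun a => (f a).headD 0 := by
  have h1 : PolyTime fun p : ℝ × List ℝ => p.1 := fst id
  obtain ⟨p, q, h⟩ : PolyTime fun m : List ℝ => m.headD 0 := by
    refine ⟨Prog.branch (Prog.prim Prim.isPair) (Prog.prim Prim.fst) (Prog.prim Prim.zero), 3,
      fun m => ⟨?_, ?_⟩⟩
    · cases m with
      | nil =>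
        exact ⟨_, by simp [Prim.cost], Runs.branch_false (Runs.prim _ _)
          (by simp [enc_nil, Prim.apply, Val.IsTrue]) (Runs.prim _ _)⟩
      | cons r m =>
        exact ⟨_, by simp [Prim.cost], Runs.branch_true (Runs.prim _ _)
          (by simp [enc_cons, Prim.apply, Val.IsTrue]) (Runs.prim _ _)⟩
    · simp
  exact comp ⟨p, q, h⟩ hf

end PolyTime

/-! ### Folds and list operations in polynomial time -/

/-- The body of the loop that folds over a list; the state is `(environment, (list, accumulator))`
and `G` computes the step on `(environment, (accumulator, head))`. -/
def foldBody (G : Prog) : Prog :=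
  Prog.both (Prog.prim Prim.fst)
    (Prog.both (Prog.seq (Prog.prim Prim.snd) (Prog.seq (Prog.prim Prim.fst) (Prog.prim Prim.snd)))
      (Prog.seq (Prog.both (Prog.prim Prim.fst)
        (Prog.both (Prog.seq (Prog.prim Prim.snd) (Prog.prim Prim.snd))
          (Prog.seq (Prog.prim Prim.snd) (Prog.seq (Prog.prim Prim.fst) (Prog.prim Prim.fst))))) G))

/-- The test of the loop that folds over a list: some entries are left. -/
def foldTest : Prog :=
  Prog.seq (Prog.prim Prim.snd) (Prog.seq (Prog.prim Prim.fst) (Prog.prim Prim.isPair))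

theorem runs_foldBody {G : Prog} {e h l c c' : Val} {t : ℕ}
    (hG : Runs G (Val.pair e (Val.pair c h)) c' t) :
    Runs (foldBody G) (Val.pair e (Val.pair (Val.pair h l) c)) (Val.pair e (Val.pair l c'))
      (t + 20) := by
  have h1 : Runs (foldBody G) (Val.pair e (Val.pair (Val.pair h l) c))
      (Val.pair e (Val.pair l c')) _ :=
    Runs.both (Runs.prim Prim.fst _) (Runs.both (Runs.seq (Runs.prim Prim.snd _)
      (Runs.seq (Runs.prim Prim.fst _) (Runs.prim Prim.snd _)))
      (Runs.seq (Runs.both (Runs.prim Prim.fst _)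
        (Runs.both (Runs.seq (Runs.prim Prim.snd _) (Runs.prim Prim.snd _))
          (Runs.seq (Runs.prim Prim.snd _) (Runs.seq (Runs.prim Prim.fst _)
            (Runs.prim Prim.fst _))))) hG))
  convert h1 using 1
  simp [Prim.cost]
  omega

theorem runs_foldTest_cons (e h l c : Val) :
    Runs foldTest (Val.pair e (Val.pair (Val.pair h l) c)) (Val.num 1) 5 :=
  Runs.seq (Runs.prim Prim.snd _) (Runs.seq (Runs.prim Prim.fst _) (Runs.prim Prim.isPair _))

theorem runs_foldTest_nil (e c : Val) :
    Runs foldTest (Val.pair e (Val.pair Val.nil c)) (Val.num 0) 5 :=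
  Runs.seq (Runs.prim Prim.snd _) (Runs.seq (Runs.prim Prim.fst _) (Runs.prim Prim.isPair _))

section Fold

variable {α β γ δ : Type} [Enc α] [Enc β] [Enc γ] [Enc δ]

/-- The folding loop, for a step program `G` of cost at most `K` on accumulators of size at most
`M`, when every step enlarges the accumulator by at most `D`. -/
theorem runs_fold_loop {G : Prog} {a : α} {g : γ → β → γ} {M D K : ℕ} (L : List β)
    (hG : ∀ c, ∀ x ∈ L, sz c ≤ M → ∃ t ≤ K, Runs G (enc (a, (c, x))) (enc (g c x)) t)
    (hD : ∀ c, ∀ x ∈ L, sz (g c x) ≤ sz c + D) (c : γ) (hc : sz c + L.length * D ≤ M) :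
    (∃ t ≤ L.length * (K + 28) + 6, Runs (Prog.loop foldTest (foldBody G))
      (Val.pair (enc a) (Val.pair (enc L) (enc c)))
      (Val.pair (enc a) (Val.pair Val.nil (enc (L.foldl g c)))) t) ∧
    sz (L.foldl g c) ≤ sz c + L.length * D := by
  induction L generalizing c with
  | nil =>
    refine ⟨⟨_, ?_, Runs.loop_done (runs_foldTest_nil _ _) (by simp [Val.IsTrue])⟩, ?_⟩ <;> simp
  | cons x L ih =>
    have h1 : sz (g c x) ≤ sz c + D := hD c x (by simp)
    rw [List.length_cons, Nat.succ_mul] at hc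
    obtain ⟨t, ht, rt⟩ := hG c x (by simp) (by omega)
    obtain ⟨⟨t', ht', rt'⟩, hs⟩ := ih (fun c y hy => hG c y (by simp [hy]))
      (fun c y hy => hD c y (by simp [hy])) (g c x) (by omega)
    rw [List.length_cons, Nat.succ_mul, Nat.succ_mul]
    exact ⟨⟨_, by omega, Runs.loop_step (runs_foldTest_cons _ _ _ _) (by simp [Val.IsTrue])
      (runs_foldBody rt) rt'⟩, by simp only [List.foldl_cons]; omega⟩

namespace PolyTime

open Polynomial in
/-- Folding a polynomial-time step over a list takes polynomial time, provided that one step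
enlarges the accumulator by an amount which does not depend on the accumulator. -/
theorem foldl {l : α → List β} {i : α → γ} {g : α → γ → β → γ} (hl : PolyTime l)
    (hi : PolyTime i) (hg : PolyTime fun p : α × γ × β => g p.1 p.2.1 p.2.2)
    (B : Polynomial ℕ) (hB : ∀ a c x, sz (g a c x) ≤ sz c + B.eval (sz a + sz x)) :
    PolyTime fun a => (l a).foldl (g a) (i a) := by
  obtain ⟨p, q, hp⟩ := pair id (pair hl hi)
  obtain ⟨G, qg, hG⟩ := hg
  let D : Polynomial ℕ := B.comp (X + q)
  let M : Polynomial ℕ := q + q * D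
  let K : Polynomial ℕ := qg.comp (X + M + q + 2)
  refine ⟨Prog.seq p (Prog.seq (Prog.loop foldTest (foldBody G))
    (Prog.seq (Prog.prim Prim.snd) (Prog.prim Prim.snd))), q + q * (K + 28) + 12 + M,
    fun a => ?_⟩
  obtain ⟨⟨t, ht, rt⟩, hs⟩ := hp a
  simp only [sz_pair] at hs
  have hlen := length_le_sz (l a)
  have hlen' : (l a).length ≤ q.eval (sz a) := by omega
  have hx : ∀ x ∈ l a, sz x ≤ q.eval (sz a) := fun x hx => by
    have := sz_le_of_mem hx; omega
  have hM : sz (i a) + (l a).length * D.eval (sz a) ≤ M.eval (sz a) := by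
    simp only [M, eval_add, eval_mul]
    have := Nat.mul_le_mul_right (D.eval (sz a)) hlen'
    omega
  obtain ⟨⟨t', ht', rt'⟩, hs'⟩ := runs_fold_loop (G := G) (a := a) (g := g a)
    (M := M.eval (sz a)) (D := D.eval (sz a)) (K := K.eval (sz a)) (l a)
    (fun c x hxl hc => by
      obtain ⟨⟨t, ht, rt⟩, -⟩ := hG (a, (c, x))
      refine ⟨t, ht.trans ?_, rt⟩
      simp only [K, eval_comp]
      apply eval_mono
      have := hx x hxl
      simp; omega)
    (fun c x hxl => by
      refine (hB a c x).trans ?_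
      have := hx x hxl
      simp only [D, eval_comp]
      gcongr
      apply eval_mono
      simp; omega) (i a) hM
  have hK := Nat.mul_le_mul_right (K.eval (sz a) + 28) hlen'
  refine ⟨⟨_, ?_, Runs.seq rt (Runs.seq rt' (Runs.seq (Runs.prim Prim.snd _)
    (Runs.prim Prim.snd _)))⟩, ?_⟩
  · simp only [Prim.cost, eval_add, eval_mul, eval_ofNat]
    omega
  · simp only [eval_add, eval_mul, eval_ofNat]
    omega

theorem reverse {l : α → List β} (hl : PolyTime l) : PolyTime fun a => (l a).reverse := by
  have h := foldl (α := List β) (l := fun m => m) (i := fun _ => ([] : List β))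
    (g := fun _ c x => x :: c) id nil (cons (snd (snd id)) (fst (snd id))) (Polynomial.X + 1)
    (fun a c x => by simp; omega)
  have h' : (fun a => (l a).reverse) = fun a => (l a).foldl (fun c x => x :: c) [] := by
    funext a; rw [List.foldl_eq_foldr_reverse]; simp
  rw [h']
  exact comp h hl

theorem append {l l' : α → List β} (hl : PolyTime l) (hl' : PolyTime l') :
    PolyTime fun a => l a ++ l' a := by
  have h := foldl (α := α) (l := fun a => (l a).reverse) (i := l')
    (g := fun _ c x => x :: c) (reverse hl) hl' (cons (snd (snd id)) (fst (snd id)))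
    (Polynomial.X + 1) (fun a c x => by simp; omega)
  have h' : (fun a => l a ++ l' a) = fun a => (l a).reverse.foldl (fun c x => x :: c) (l' a) := by
    funext a; rw [List.foldl_reverse]; simp
  rw [h']
  exact h

theorem map {l : α → List β} {f : α → β → γ} (hl : PolyTime l)
    (hf : PolyTime fun p : α × β => f p.1 p.2) : PolyTime fun a => (l a).map fun x => f a x := by
  have hf' := hf
  obtain ⟨p, q, hq⟩ := hf'
  have h := foldl (α := α) (l := l) (i := fun _ => ([] : List γ))
    (g := fun a c x => f a x :: c) hl nil
    (cons (comp hf (pair (fst id) (snd (snd id)))) (fst (snd id)))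
    (q.comp (Polynomial.X + 1) + 1) (fun a c x => by
      have := (hq (a, x)).2
      simp at this ⊢; omega)
  have h' : ∀ (a : α) (m : List β) (c : List γ),
      m.foldl (fun c x => f a x :: c) c = (m.map fun x => f a x).reverse ++ c := by
    intro a m
    induction m with
    | nil => intro c; rfl
    | cons x m ih => intro c; rw [List.foldl_cons, ih]; simp
  convert reverse h using 2 with a
  rw [h']
  simp

theorem flatten {l : α → List (List β)} (hl : PolyTime l) : PolyTime fun a => (l a).flatten := by
  have h := foldl (α := α) (l := l) (i := fun _ => ([] : List β))
    (g := fun _ c x => c ++ x) hl nil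
    (append (fst (snd id)) (snd (snd id))) Polynomial.X (fun a c x => by
      have := sz_append c x
      simp; omega)
  have h' : (fun a => (l a).flatten) = fun a => (l a).foldl (fun c x => c ++ x) [] := by
    funext a
    induction (l a) using List.reverseRecOn with
    | nil => rfl
    | append_singleton l x ih => simp [ih]
  rw [h']
  exact h

theorem flatMap {l : α → List β} {f : α → β → List γ} (hl : PolyTime l)
    (hf : PolyTime fun p : α × β => f p.1 p.2) :
    PolyTime fun a => (l a).flatMap fun x => f a x := by
  simp only [List.flatMap_def]
  exact flatten (map hl hf)

theorem filterMul {l : α → List β} {c : α → β → ℝ} (hl : PolyTime l)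
    (hc : PolyTime fun p : α × β => c p.1 p.2) :
    PolyTime fun a => (l a).filter fun x => 0 < c a x := by
  have h := flatMap (l := l) (f := fun a x => if 0 < c a x then [x] else []) hl
    (ite hc (cons (snd id) nil) nil)
  convert h using 2 with a
  induction l a with
  | nil => rfl
  | cons x m ih => by_cases h : 0 < c a x <;> simp [h, ih]

theorem length {l : α → List β} (hl : PolyTime l) : PolyTime fun a => ((l a).length : ℝ) := by
  have h := foldl (α := α) (l := l) (i := fun _ => (0 : ℝ)) (g := fun _ c _ => c + 1) hl zero
    (add (fst (snd id)) one) 0 (fun a c x => by simp)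
  convert h using 2 with a
  have : ∀ (m : List β) (r : ℝ), m.foldl (fun c _ => c + 1) r = r + m.length := by
    intro m
    induction m with
    | nil => simp
    | cons x m ih => intro r; simp [ih]; ring
  rw [this, zero_add]

theorem sum {l : α → List ℝ} (hl : PolyTime l) : PolyTime fun a => (l a).sum := by
  have h := foldl (α := α) (l := l) (i := fun _ => (0 : ℝ)) (g := fun _ c x => c + x) hl zero
    (add (fst (snd id)) (snd (snd id))) 0 (fun a c x => by simp)
  convert h using 2 with a
  rw [List.sum_eq_foldl]

theorem zipWith {l m : α → List ℝ} {f : α → ℝ → ℝ → ℝ} (hl : PolyTime l) (hm : PolyTime m)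
    (hf : PolyTime fun p : α × ℝ × ℝ => f p.1 p.2.1 p.2.2) :
    PolyTime fun a => List.zipWith (fun x y => f a x y) (l a) (m a) := by
  have h := foldl (α := α) (l := l) (i := fun a => (m a, ([] : List ℝ)))
    (g := fun a c x => if c.1.isEmpty then c else (c.1.tail, f a x (c.1.headD 0) :: c.2))
    hl (pair hm nil)
    (iteNil (fst (fst (snd id)))
      (pair (tail (fst (fst (snd id)))) (cons (comp hf (pair (fst id) (pair (snd (snd id))
        (headReal (fst (fst (snd id))))))) (snd (fst (snd id)))))
      (fst (snd id))) 2 (fun a c x => by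
      obtain ⟨c1, c2⟩ := c
      cases c1 <;> simp
      omega)
  have h2 := reverse (snd h)
  convert h2 using 2 with a
  have : ∀ (l m : List ℝ) (out : List ℝ),
      (l.foldl (fun (c : List ℝ × List ℝ) x =>
        if c.1.isEmpty then c else (c.1.tail, f a x (c.1.headD 0) :: c.2)) (m, out)).2 =
      (List.zipWith (fun x y => f a x y) l m).reverse ++ out := by
    intro l
    induction l with
    | nil => simp
    | cons x l ih =>
      intro m out
      cases m with
      | nil => simpa using ih [] out
      | cons y m => simpa using ih m (f a x y :: out)
  rw [this]
  simp

/-- The instruction extracting real roots. -/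
theorem roots {l : α → List ℝ} (hl : PolyTime l) :
    PolyTime fun a => realRoots (polyOfList (l a)) := by
  have toReals : ∀ m : List ℝ, (enc m).toReals = m := by
    intro m
    induction m with
    | nil => rfl
    | cons x m ih =>
      rw [enc_cons, Val.toReals, ih]
      rfl
  have deg : ∀ m : List ℝ, (polyOfList m).natDegree ≤ m.length := by
    intro m
    induction m with
    | nil => simp [polyOfList]
    | cons x m ih =>
      rw [polyOfList, List.length_cons]
      refine Polynomial.natDegree_add_le_of_degree_le (by simp) ?_
      refine (Polynomial.natDegree_mul_le).trans ?_
      have := Polynomial.natDegree_X_le (R := ℝ)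
      omega
  refine comp (f := fun m => realRoots (polyOfList m)) (of_prim Prim.roots (fun m => ?_)
    (2 * Polynomial.X + 1) (fun m => ?_) (fun m => ?_)) hl
  · show Val.ofList _ = Val.ofList _
    rw [toReals]
    rfl
  · simp only [Prim.cost, toReals]
    have := length_le_sz m
    simp; omega
  · rw [sz_reals]
    have h1 : (realRoots (polyOfList m)).length ≤ m.length := by
      rw [realRoots, Finset.length_sort]
      exact (Multiset.toFinset_card_le _).trans ((Polynomial.card_roots' _).trans (deg m))
    have := length_le_sz m
    simp; omega

end PolyTime

end Fold

end RealMachine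

/-! ### The decomposition program -/

namespace RealMachine

/-- Inner product of two lists. -/
def dot (x y : List ℝ) : ℝ := (List.zipWith (fun a b => a * b) x y).sum

/-- Kronecker product of two lists. -/
def kron (x y : List ℝ) : List ℝ := x.flatMap fun a => y.map fun b => a * b

/-- The vector `x - c y`. -/
def subMul (c : ℝ) (x y : List ℝ) : List ℝ := List.zipWith (fun a b => a - c * b) x y

/-- The list `[0, 1, …, length l - 1]`. -/
def idx {α : Type} (l : List α) : List ℝ := (List.range l.length).map fun i : ℕ => (i : ℝ)

/-- The standard basis of the space of vectors with as many entries as `l`. -/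
def stdBasis {α : Type} (l : List α) : List (List ℝ) :=
  (idx l).map fun i => (idx l).map fun j => if 0 < (i - j) * (i - j) then 0 else 1

/-- One elimination step: from vectors spanning `S`, vectors spanning `S ∩ r^⊥`. The first vector
not orthogonal to `r` serves as pivot and is dropped; the empty list stands for a missing pivot. -/
def cut (B : List (List ℝ)) (r : List ℝ) : List (List ℝ) :=
  (B.foldl (fun c v =>
    if 0 < dot r v * dot r v then
      if c.1.isEmpty then (v, c.2)
      else (c.1, subMul (dot r v / dot r c.1) v c.1 :: c.2)
    else (c.1, v :: c.2)) (([] : List ℝ), ([] : List (List ℝ)))).2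

/-- Vectors spanning the part of the span of `B` orthogonal to all of `cons`. -/
def ker (B cons : List (List ℝ)) : List (List ℝ) := cons.foldl cut B

/-- The first nonzero vector of a list (if there is one). -/
def pick (B : List (List ℝ)) : List ℝ := B.foldl (fun c v => if 0 < dot c c then c else v) []

/-- Product of two square matrices, given as the lists of their entries; `E` is the standard
basis. -/
def mulM (E : List (List ℝ)) (X Y : List ℝ) : List ℝ :=
  E.flatMap fun e => E.map fun f => dot X (kron e (E.map fun g => dot Y (kron g f)))

/-- Transpose of a square matrix. -/
def transp (E : List (List ℝ)) (X : List ℝ) : List ℝ :=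
  E.flatMap fun e => E.map fun f => dot X (kron f e)

/-- All Kronecker products of two vectors of `E`. -/
def tensorBasis (E : List (List ℝ)) : List (List ℝ) := E.flatMap fun e => E.map fun f => kron e f

/-- Constraints `X η = 0` for `η` in `nulls`. -/
def nullCons (E nulls : List (List ℝ)) : List (List ℝ) :=
  E.flatMap fun e => nulls.map fun η => kron e η

/-- Constraints saying that `X` is symmetric. -/
def symCons (E : List (List ℝ)) : List (List ℝ) :=
  E.flatMap fun e => E.map fun f => subMul 1 (kron e f) (kron f e)

/-- Constraints saying that `X`, indexed by pairs of pairs of indices, is unchanged when the first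
indices of the two pairs are exchanged. -/
def minorCons (E₁ E₂ : List (List ℝ)) : List (List ℝ) :=
  E₁.flatMap fun i => E₁.flatMap fun i' => E₂.flatMap fun j => E₂.map fun j' =>
    subMul 1 (kron (kron i j) (kron i' j')) (kron (kron i' j) (kron i j'))

/-- Constraints defining the space `S²(U) ∩ span{minors}^⊥`. -/
def liftCons (E E₁ E₂ nulls : List (List ℝ)) : List (List ℝ) :=
  nullCons E nulls ++ symCons E ++ minorCons E₁ E₂

/-- Constraints defining the algebra of the matrices `X` that vanish on `nulls` and satisfy
`X P ∈ L` for all `P` in the list `Ps`, where `L` is the space of symmetric matrices defined by the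
constraints `cons`. -/
def algCons (E nulls cons Ps : List (List ℝ)) : List (List ℝ) :=
  nullCons E nulls ++ Ps.flatMap fun P => cons.map fun c => mulM E c P

/-- The combination `∑ θ^(s-1-k) X_k` of a list of `s` matrices. -/
def horner (E : List (List ℝ)) (θ : ℝ) (Xs : List (List ℝ)) : List ℝ :=
  Xs.foldl (fun c X => List.zipWith (fun a b => θ * a + b) c X) (E.flatMap fun _ => E.map fun _ => 0)

/-- The powers `X^N, …, X, 1` of a square matrix. -/
def powers (E : List (List ℝ)) (X : List ℝ) : List (List ℝ) :=
  E.foldl (fun c _ => mulM E X (c.headD []) :: c) [E.flatten]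

/-- The coefficients of a nonzero polynomial that annihilates `X`. -/
def annih (E : List (List ℝ)) (X : List ℝ) : List ℝ :=
  pick (ker (stdBasis (powers E X))
    ((tensorBasis E).map fun z => (powers E X).reverse.map fun y => dot y z))

/-- A nonzero solution of `X u = μ u`, if there is one. -/
def eigvec (E : List (List ℝ)) (X : List ℝ) (μ : ℝ) : List ℝ :=
  pick (ker E (E.map fun e => E.map fun f => dot X (kron e f) - μ * dot e f))

/-- For each nonzero real eigenvalue of `X`, a right and a left eigenvector. -/
def eigenpairs (E : List (List ℝ)) (X : List ℝ) : List (List ℝ × List ℝ) :=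
  ((realRoots (polyOfList (annih E X))).filter fun μ =>
    0 < μ * μ * dot (eigvec E X μ) (eigvec E X μ)).map fun μ =>
      (eigvec E X μ, eigvec E (transp E X) μ)

/-- The longest list of eigenvectors found among the combinations of the matrices `Xs` with
`θ = 0, 1, 2, …` -/
def search (E Xs : List (List ℝ)) : List (List ℝ × List ℝ) :=
  (idx (0 :: (tensorBasis E).flatten)).foldl (fun c θ =>
    if 0 < ((eigenpairs E (horner E θ Xs)).length : ℝ) - (c.length : ℝ)
      then eigenpairs E (horner E θ Xs) else c) []

/-- The two vectors whose product is the rank-one matrix `u`. -/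
def factor (E₁ E₂ : List (List ℝ)) (u : List ℝ) : List ℝ × List ℝ :=
  (E₁.map fun x => dot u (kron x (E₂.headD [])),
    E₂.map fun y => dot u (kron (E₁.headD []) y) / dot u (kron (E₁.headD []) (E₂.headD [])))

/-- The quadruple determined by a right and a left eigenvector. -/
def quad (E₁ E₂ E₃ E₄ cols : List (List ℝ)) (p : List ℝ × List ℝ) :
    List ℝ × List ℝ × List ℝ × List ℝ :=
  ((factor E₁ E₂ p.1).1, (factor E₁ E₂ p.1).2,
    factor E₃ E₄ (cols.map fun col => dot p.2 col / dot p.2 p.1))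

/-- The rows of the flattening of a tensor along its first two modes. -/
def flatRows (T : List (List (List (List ℝ)))) : List (List ℝ) :=
  T.flatMap fun S => S.map fun M => M.flatten

/-- The columns of the matrix with the given rows. -/
def columns (F : List (List ℝ)) : List (List ℝ) :=
  (stdBasis (F.headD [])).map fun e => F.map fun r => dot r e

/-- The algebra of matrices having all components as eigenvectors, given by spanning vectors. -/
def algebraOf (E E₁ E₂ nulls : List (List ℝ)) : List (List ℝ) :=
  ker (tensorBasis E) (algCons E nulls (liftCons E E₁ E₂ nulls)
    (ker (tensorBasis E) (liftCons E E₁ E₂ nulls)))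

/-- The decomposition algorithm: the search runs in the algebra determined by the column space of
the tensor, which enters through vectors spanning its orthogonal complement. -/
def decompose (T : List (List (List (List ℝ)))) : List (List ℝ × List ℝ × List ℝ × List ℝ) :=
  (search (stdBasis (flatRows T)) (algebraOf (stdBasis (flatRows T)) (stdBasis T)
    (stdBasis (T.headD [])) (ker (stdBasis (flatRows T)) (columns (flatRows T))))).map fun p =>
      quad (stdBasis T) (stdBasis (T.headD [])) (stdBasis ((T.headD []).headD []))
        (stdBasis (((T.headD []).headD []).headD [])) (columns (flatRows T)) p

/-! ### The decomposition program runs in polynomial time -/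

section Sizes

theorem sz_subMul_le (c : ℝ) (x y : List ℝ) : sz (subMul c x y) ≤ sz x := by
  simp only [sz_reals, subMul, List.length_zipWith]
  omega

theorem sz_cut_le (B : List (List ℝ)) (r : List ℝ) : sz (cut B r) ≤ sz B := by
  have : ∀ (B : List (List ℝ)) (c : List ℝ × List (List ℝ)),
      sz (B.foldl (fun c v =>
        if 0 < dot r v * dot r v then
          if c.1.isEmpty then (v, c.2)
          else (c.1, subMul (dot r v / dot r c.1) v c.1 :: c.2)
        else (c.1, v :: c.2)) c).2 + 1 ≤ sz c.2 + sz B := by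
    intro B
    induction B with
    | nil => intro c; simp
    | cons v B ih =>
      intro c
      refine (ih _).trans ?_
      have := sz_subMul_le (dot r v / dot r c.1) v c.1
      dsimp only
      split_ifs <;> simp <;> omega
  have := this B ([], [])
  simp only [sz_nil] at this
  exact Nat.le_of_succ_le_succ (by rw [cut]; omega)

theorem sz_mulM (E : List (List ℝ)) (X Y : List ℝ) : sz (mulM E X Y) = 2 * E.length ^ 2 + 1 := by
  rw [sz_reals, mulM]
  simp [List.length_flatMap, sq]

end Sizes

namespace PolyTime

variable {α β : Type} [Enc α] [Enc β]

/-- Weakening of the environment. -/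
theorem lift {f : α → β} {γ : Type} [Enc γ] (hf : PolyTime f) :
    PolyTime fun p : α × γ => f p.1 := comp hf (fst id)

theorem dot {f g : α → List ℝ} (hf : PolyTime f) (hg : PolyTime g) :
    PolyTime fun a => dot (f a) (g a) :=
  sum (zipWith hf hg (mul (fst (snd id)) (snd (snd id))))

theorem kron {f g : α → List ℝ} (hf : PolyTime f) (hg : PolyTime g) :
    PolyTime fun a => kron (f a) (g a) :=
  flatMap hf (map hg.lift (mul (snd (fst id)) (snd id)))

theorem subMul {c : α → ℝ} {f g : α → List ℝ} (hc : PolyTime c) (hf : PolyTime f)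
    (hg : PolyTime g) : PolyTime fun a => subMul (c a) (f a) (g a) :=
  zipWith hf hg (sub (fst (snd id)) (mul hc.lift (snd (snd id))))

theorem idx {l : α → List β} (hl : PolyTime l) : PolyTime fun a => idx (l a) := by
  have h := foldl (l := l) (i := fun _ => ((0 : ℝ), ([] : List ℝ)))
    (g := fun _ c _ => (c.1 + 1, c.1 :: c.2)) hl (pair zero nil)
    (pair (add (fst (fst (snd id))) one) (cons (fst (fst (snd id))) (snd (fst (snd id)))))
    2 (fun a c x => by simp; omega)
  convert reverse (snd h) using 2 with a
  have : ∀ (m : List β), m.foldl (fun (c : ℝ × List ℝ) _ => (c.1 + 1, c.1 :: c.2)) (0, []) =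
      ((m.length : ℝ), (RealMachine.idx m).reverse) := by
    intro m
    induction m using List.reverseRecOn with
    | nil => simp [RealMachine.idx]
    | append_singleton m x ih => simp [ih, RealMachine.idx, List.range_succ]
  simp [this]

theorem stdBasis {l : α → List β} (hl : PolyTime l) : PolyTime fun a => stdBasis (l a) :=
  have h := sub (snd (fst id)) (snd id)
  map (idx hl) (map (idx hl).lift (ite (mul h h) zero one))

theorem cut {B : α → List (List ℝ)} {r : α → List ℝ} (hB : PolyTime B) (hr : PolyTime r) :
    PolyTime fun a => cut (B a) (r a) := by
  have hd := dot (lift hr (γ := (List ℝ × List (List ℝ)) × List ℝ)) (snd (snd id))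
  refine snd (foldl (i := fun _ => ([], [])) (g := fun a c v =>
      if 0 < RealMachine.dot (r a) v * RealMachine.dot (r a) v then
        if c.1.isEmpty then (v, c.2)
        else (c.1, RealMachine.subMul
          (RealMachine.dot (r a) v / RealMachine.dot (r a) c.1) v c.1 :: c.2)
      else (c.1, v :: c.2)) hB (pair nil nil)
    (ite (mul hd hd) (iteNil (fst (fst (snd id)))
      (pair (fst (fst (snd id))) (cons (subMul (div hd (dot hr.lift (fst (fst (snd id)))))
        (snd (snd id)) (fst (fst (snd id)))) (snd (fst (snd id)))))
      (pair (snd (snd id)) (snd (fst (snd id)))))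
      (pair (fst (fst (snd id))) (cons (snd (snd id)) (snd (fst (snd id)))))) (Polynomial.X + 1)
    fun a c v => ?_)
  have := sz_subMul_le (RealMachine.dot (r a) v / RealMachine.dot (r a) c.1) v c.1
  simp only [Polynomial.eval_add, Polynomial.eval_X, Polynomial.eval_one]
  split_ifs <;> simp <;> omega

theorem ker {B C : α → List (List ℝ)} (hB : PolyTime B) (hC : PolyTime C) :
    PolyTime fun a => ker (B a) (C a) :=
  foldl (g := fun _ c r => RealMachine.cut c r) hC hB (cut (fst (snd id)) (snd (snd id))) 0
    fun a c x => by simpa using sz_cut_le c x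

theorem pick {B : α → List (List ℝ)} (hB : PolyTime B) : PolyTime fun a => pick (B a) :=
  foldl (g := fun _ c v => if 0 < RealMachine.dot c c then c else v) hB nil
    (ite (dot (fst (snd id)) (fst (snd id))) (fst (snd id)) (snd (snd id))) Polynomial.X
    fun a c x => by split_ifs <;> simp; omega

theorem mulM {E : α → List (List ℝ)} {X Y : α → List ℝ} (hE : PolyTime E) (hX : PolyTime X)
    (hY : PolyTime Y) : PolyTime fun a => mulM (E a) (X a) (Y a) :=
  flatMap hE (map hE.lift (dot hX.lift.lift (kron (snd (fst id))
    (map hE.lift.lift (dot hY.lift.lift.lift (kron (snd id) (snd (fst id))))))))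

theorem transp {E : α → List (List ℝ)} {X : α → List ℝ} (hE : PolyTime E) (hX : PolyTime X) :
    PolyTime fun a => transp (E a) (X a) :=
  flatMap hE (map hE.lift (dot hX.lift.lift (kron (snd id) (snd (fst id)))))

theorem tensorBasis {E : α → List (List ℝ)} (hE : PolyTime E) :
    PolyTime fun a => tensorBasis (E a) :=
  flatMap hE (map hE.lift (kron (snd (fst id)) (snd id)))

theorem nullCons {E H : α → List (List ℝ)} (hE : PolyTime E) (hH : PolyTime H) :
    PolyTime fun a => nullCons (E a) (H a) :=
  flatMap hE (map hH.lift (kron (snd (fst id)) (snd id)))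

theorem symCons {E : α → List (List ℝ)} (hE : PolyTime E) : PolyTime fun a => symCons (E a) :=
  flatMap hE (map hE.lift (subMul one (kron (snd (fst id)) (snd id))
    (kron (snd id) (snd (fst id)))))

theorem minorCons {E₁ E₂ : α → List (List ℝ)} (h₁ : PolyTime E₁) (h₂ : PolyTime E₂) :
    PolyTime fun a => minorCons (E₁ a) (E₂ a) :=
  have i := snd (fst (fst (fst id)))
  have i' := snd (fst (fst id))
  have j := snd (fst id)
  have j' := snd id
  flatMap h₁ (flatMap h₁.lift (flatMap h₂.lift.lift (map h₂.lift.lift.lift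
    (subMul one (kron (kron i j) (kron i' j')) (kron (kron i' j) (kron i j'))))))

theorem liftCons {E E₁ E₂ H : α → List (List ℝ)} (hE : PolyTime E) (h₁ : PolyTime E₁)
    (h₂ : PolyTime E₂) (hH : PolyTime H) :
    PolyTime fun a => liftCons (E a) (E₁ a) (E₂ a) (H a) :=
  append (append (nullCons hE hH) (symCons hE)) (minorCons h₁ h₂)

theorem algCons {E H C P : α → List (List ℝ)} (hE : PolyTime E) (hH : PolyTime H)
    (hC : PolyTime C) (hP : PolyTime P) : PolyTime fun a => algCons (E a) (H a) (C a) (P a) :=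
  append (nullCons hE hH) (flatMap hP (map hC.lift (mulM hE.lift.lift (snd id) (snd (fst id)))))

theorem horner {E Xs : α → List (List ℝ)} {θ : α → ℝ} (hE : PolyTime E) (hθ : PolyTime θ)
    (hX : PolyTime Xs) : PolyTime fun a => horner (E a) (θ a) (Xs a) :=
  foldl (g := fun a c X => List.zipWith (fun x y => θ a * x + y) c X) hX
    (flatMap hE (map hE.lift zero))
    (zipWith (fst (snd id)) (snd (snd id)) (add (mul hθ.lift.lift (fst (snd id))) (snd (snd id)))) 0
    fun a c x => by simp only [sz_reals, List.length_zipWith]; omega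

theorem powers {E : α → List (List ℝ)} {X : α → List ℝ} (hE : PolyTime E) (hX : PolyTime X) :
    PolyTime fun a => powers (E a) (X a) := by
  have hE' := hE
  obtain ⟨_, q, hq⟩ := hE'
  refine foldl (g := fun a c _ => RealMachine.mulM (E a) (X a) (c.headD []) :: c) hE
    (cons (flatten hE) nil) (cons (mulM hE.lift hX.lift (headList (fst (snd id)))) (fst (snd id)))
    (2 * q ^ 2 + 2) fun a c x => ?_
  have h1 := length_le_sz (E a)
  have h2 := (hq a).2.trans (eval_mono q (Nat.le_add_right (sz a) (sz x)))
  have h3 : (E a).length ^ 2 ≤ q.eval (sz a + sz x) ^ 2 := Nat.pow_le_pow_left (by omega) 2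
  rw [sz_cons, sz_mulM]
  simp
  omega

theorem annih {E : α → List (List ℝ)} {X : α → List ℝ} (hE : PolyTime E) (hX : PolyTime X) :
    PolyTime fun a => annih (E a) (X a) :=
  pick (ker (stdBasis (powers hE hX)) (map (tensorBasis hE)
    (map (reverse (powers hE hX)).lift (dot (snd id) (snd (fst id))))))

theorem eigvec {E : α → List (List ℝ)} {X : α → List ℝ} {μ : α → ℝ} (hE : PolyTime E)
    (hX : PolyTime X) (hμ : PolyTime μ) : PolyTime fun a => eigvec (E a) (X a) (μ a) :=
  pick (ker hE (map hE (map hE.lift (sub (dot hX.lift.lift (kron (snd (fst id)) (snd id)))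
    (mul hμ.lift.lift (dot (snd (fst id)) (snd id)))))))

theorem eigenpairs {E : α → List (List ℝ)} {X : α → List ℝ} (hE : PolyTime E)
    (hX : PolyTime X) : PolyTime fun a => eigenpairs (E a) (X a) :=
  have hu := eigvec hE.lift hX.lift (snd id)
  map (filterMul (roots (annih hE hX)) (mul (mul (snd id) (snd id)) (dot hu hu)))
    (pair hu (eigvec hE.lift (transp hE hX).lift (snd id)))

theorem search {E Xs : α → List (List ℝ)} (hE : PolyTime E) (hX : PolyTime Xs) :
    PolyTime fun a => search (E a) (Xs a) := by
  have h : PolyTime fun p : α × ℝ => RealMachine.eigenpairs (E p.1)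
      (RealMachine.horner (E p.1) p.2 (Xs p.1)) :=
    eigenpairs hE.lift (horner hE.lift (snd id) hX.lift)
  have hbound := h
  obtain ⟨_, q, hq⟩ := hbound
  have h' : PolyTime fun p : α × List (List ℝ × List ℝ) × ℝ => RealMachine.eigenpairs (E p.1)
      (RealMachine.horner (E p.1) p.2.2 (Xs p.1)) := comp h (pair (fst id) (snd (snd id)))
  refine foldl (g := fun a c θ =>
      if 0 < ((RealMachine.eigenpairs (E a) (RealMachine.horner (E a) θ (Xs a))).length : ℝ) -
        (c.length : ℝ) then RealMachine.eigenpairs (E a) (RealMachine.horner (E a) θ (Xs a)) else c)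
    (idx (cons zero (flatten (tensorBasis hE)))) nil
    (ite (sub (length h') (length (fst (snd id)))) h' (fst (snd id)))
    (q.comp (Polynomial.X + 1)) fun a c θ => ?_
  have := (hq (a, θ)).2
  simp only [sz_pair, Polynomial.eval_comp, Polynomial.eval_add, Polynomial.eval_X,
    Polynomial.eval_one] at this ⊢
  split_ifs <;> omega

theorem factor {E₁ E₂ : α → List (List ℝ)} {u : α → List ℝ} (h₁ : PolyTime E₁)
    (h₂ : PolyTime E₂) (hu : PolyTime u) : PolyTime fun a => factor (E₁ a) (E₂ a) (u a) :=
  pair (map h₁ (dot hu.lift (kron (snd id) (headList h₂).lift)))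
    (map h₂ (div (dot hu.lift (kron (headList h₁).lift (snd id)))
      (dot hu (kron (headList h₁) (headList h₂))).lift))

theorem quad {E₁ E₂ E₃ E₄ C : α → List (List ℝ)} {p : α → List ℝ × List ℝ} (h₁ : PolyTime E₁)
    (h₂ : PolyTime E₂) (h₃ : PolyTime E₃) (h₄ : PolyTime E₄) (hC : PolyTime C)
    (hp : PolyTime p) : PolyTime fun a => quad (E₁ a) (E₂ a) (E₃ a) (E₄ a) (C a) (p a) :=
  have h := factor h₁ h₂ (fst hp)
  pair (fst h) (pair (snd h) (factor h₃ h₄ (map hC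
    (div (dot (snd hp).lift (snd id)) (dot (snd hp) (fst hp)).lift))))

theorem flatRows {T : α → List (List (List (List ℝ)))} (hT : PolyTime T) :
    PolyTime fun a => flatRows (T a) :=
  flatMap hT (map (snd id) (flatten (snd id)))

theorem columns {F : α → List (List ℝ)} (hF : PolyTime F) : PolyTime fun a => columns (F a) :=
  map (stdBasis (headList hF)) (map hF.lift (dot (snd id) (snd (fst id))))

theorem algebraOf {E E₁ E₂ H : α → List (List ℝ)} (hE : PolyTime E) (h₁ : PolyTime E₁)
    (h₂ : PolyTime E₂) (hH : PolyTime H) :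
    PolyTime fun a => algebraOf (E a) (E₁ a) (E₂ a) (H a) :=
  have h := liftCons hE h₁ h₂ hH
  ker (tensorBasis hE) (algCons hE hH h (ker (tensorBasis hE) h))

end PolyTime

theorem polyTime_decompose : PolyTime decompose :=
  have hT : PolyTime fun T : List (List (List (List ℝ))) => T := PolyTime.id
  have hE := PolyTime.stdBasis hT.flatRows
  have hC := hT.flatRows.columns
  have h₁ := PolyTime.stdBasis hT
  have h₂ := PolyTime.stdBasis hT.headList
  have h₃ := PolyTime.stdBasis hT.headList.headList
  have h₄ := PolyTime.stdBasis hT.headList.headList.headList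
  .map (.search hE (.algebraOf hE h₁ h₂ (.ker hE hC)))
    (.quad h₁.lift h₂.lift h₃.lift h₄.lift hC.lift (.snd .id))

end RealMachine

/-! ### Genericity -/

section Genericity

variable {σ : Type}

theorem Generically.mono {P Q : (σ → ℝ) → Prop} (h : Generically P) (hPQ : ∀ w, P w → Q w) :
    Generically Q := by
  obtain ⟨p, hp, h⟩ := h
  exact ⟨p, hp, fun w hw => hPQ w (h w hw)⟩

theorem Generically.and {P Q : (σ → ℝ) → Prop} (hP : Generically P) (hQ : Generically Q) :
    Generically fun w => P w ∧ Q w := by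
  obtain ⟨p, hp, h⟩ := hP
  obtain ⟨q, hq, h'⟩ := hQ
  refine ⟨p * q, mul_ne_zero hp hq, fun w hw => ?_⟩
  rw [map_mul] at hw
  exact ⟨h w (left_ne_zero_of_mul hw), h' w (right_ne_zero_of_mul hw)⟩

theorem Generically.forall {ι : Type} [Finite ι] {P : ι → (σ → ℝ) → Prop}
    (h : ∀ i, Generically (P i)) : Generically fun w => ∀ i, P i w := by
  cases nonempty_fintype ι
  choose p hp h using h
  refine ⟨∏ i, p i, Finset.prod_ne_zero_iff.2 fun i _ => hp i, fun w hw i => h i w ?_⟩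
  rw [map_prod] at hw
  exact Finset.prod_ne_zero_iff.1 hw i (Finset.mem_univ i)

theorem generically_eval_ne_zero {p : MvPolynomial σ ℝ} (hp : p ≠ 0) :
    Generically fun w => MvPolynomial.eval w p ≠ 0 := ⟨p, hp, fun _ h => h⟩

theorem Generically.exists {P : (σ → ℝ) → Prop} (h : Generically P) : ∃ w, P w := by
  obtain ⟨p, hp, h⟩ := h
  by_contra hn
  refine hp (MvPolynomial.funext fun w => ?_)
  by_contra hw
  rw [map_zero] at hw
  exact hn ⟨w, h w hw⟩

/-- Vectors are linearly independent if and only if their Gram determinant does not vanish. -/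
theorem linearIndependent_iff_gram {κ ι : Type} [Fintype κ] [DecidableEq κ] [Fintype ι]
    (w : κ → ι → ℝ) :
    LinearIndependent ℝ w ↔ (Matrix.of w * (Matrix.of w).transpose).det ≠ 0 := by
  rw [Fintype.linearIndependent_iff, Ne, ← Matrix.exists_vecMul_eq_zero_iff, not_exists]
  have key : ∀ c : κ → ℝ, (∑ k, c k • w k) = Matrix.vecMul c (Matrix.of w) := by
    intro c
    ext i
    simp [Matrix.vecMul, dotProduct]
  constructor
  · rintro h c ⟨hc, h0⟩
    refine hc (funext (h c ?_))
    rw [key]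
    have h1 : Matrix.vecMul c (Matrix.of w * (Matrix.of w).transpose) ⬝ᵥ c = 0 := by
      rw [h0, zero_dotProduct]
    rw [← Matrix.vecMul_vecMul, Matrix.vecMul_transpose, dotProduct_comm,
      Matrix.dotProduct_mulVec] at h1
    exact dotProduct_self_eq_zero.1 h1
  · intro h c hc k
    by_contra hk
    refine h c ⟨fun h0 => hk (congrFun h0 k), ?_⟩
    rw [← Matrix.vecMul_vecMul, ← key, hc, Matrix.zero_vecMul]

/-- Vectors with polynomial entries that are linearly independent at one point are so
generically. -/
theorem generically_linearIndependent {κ ι : Type} [Fintype κ] [Fintype ι]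
    (V : κ → ι → MvPolynomial σ ℝ) (w₀ : σ → ℝ)
    (h : LinearIndependent ℝ fun k i => MvPolynomial.eval w₀ (V k i)) :
    Generically fun w => LinearIndependent ℝ fun k i => MvPolynomial.eval w (V k i) := by
  classical
  have key : ∀ w : σ → ℝ, MvPolynomial.eval w (Matrix.of V * (Matrix.of V).transpose).det =
      (Matrix.of (fun k i => MvPolynomial.eval w (V k i)) *
        (Matrix.of fun k i => MvPolynomial.eval w (V k i)).transpose).det := by
    intro w
    rw [RingHom.map_det]
    congr 1
    ext k l
    simp [Matrix.mul_apply]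
  refine (generically_eval_ne_zero
    (p := (Matrix.of V * (Matrix.of V).transpose).det) ?_).mono fun w hw => ?_
  · intro h0
    rw [linearIndependent_iff_gram, ← key, h0, map_zero] at h
    exact h rfl
  · rw [linearIndependent_iff_gram, ← key]
    exact hw

theorem linearIndependent_of_entries {κ ι : Type} [Fintype κ] [DecidableEq κ] {w : κ → ι → ℝ}
    (q : κ → ι) (h : ∀ k l, w k (q l) = if k = l then 1 else 0) : LinearIndependent ℝ w := by
  rw [Fintype.linearIndependent_iff]
  intro c hc l
  simpa [h] using congrFun hc (q l)

end Genericity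

/-! ### Components in general position -/

namespace Components

variable {n₁ n₂ n₃ n₄ R : ℕ}

/-- The matrix `a^ℓ (b^ℓ)ᵀ`. -/
def ab (w : Components n₁ n₂ n₃ n₄ R) (ℓ : Fin R) : JLV.V n₁ n₂ := JLV.outer (w.a ℓ) (w.b ℓ)

/-- The matrix `c^ℓ (d^ℓ)ᵀ`. -/
def cd (w : Components n₁ n₂ n₃ n₄ R) (ℓ : Fin R) : JLV.V n₃ n₄ := JLV.outer (w.c ℓ) (w.d ℓ)

/-- The nondegeneracy conditions on which the algorithm relies. The field `minors` says that the
tensors `(a^k ∧ a^l) ⊗ (b^k ∧ b^l)`, `k < l`, are linearly independent, that is, that a combination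
of the products `ab k ∨ ab l` with `k ≠ l` is annihilated by all `2 × 2` minors only if it is
trivial. -/
structure General (w : Components n₁ n₂ n₃ n₄ R) : Prop where
  indep_ab : LinearIndependent ℝ w.ab
  indep_cd : LinearIndependent ℝ w.cd
  minors : ∀ C : Fin R → Fin R → ℝ, (∀ k l, C k l = C l k) → (∀ k, C k k = 0) →
    (∀ P Q r s, ∑ k, ∑ l, C k l *
      (w.a k P * w.a l Q * (w.b k r * w.b l s - w.b k s * w.b l r)) = 0) → ∀ k l, C k l = 0
  ne_zero : ∀ q, w q ≠ 0

/-- Components with prescribed vectors. -/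
def mk (a : Fin R → Fin n₁ → ℝ) (b : Fin R → Fin n₂ → ℝ) (c : Fin R → Fin n₃ → ℝ)
    (d : Fin R → Fin n₄ → ℝ) : Components n₁ n₂ n₃ n₄ R :=
  fun q => Sum.elim (a q.1) (Sum.elim (b q.1) (Sum.elim (c q.1) (d q.1))) q.2

/-! ### A configuration in general position -/

section Example

variable {m k : ℕ}

/-- The vector `e_{p+1} + i e_0`. -/
def exA (x : Fin m × Fin k) : Fin (m + 1) → ℝ :=
  Fin.cons (x.2 : ℝ) fun p => if x.1 = p then 1 else 0

/-- The vector `e_i + p e_{k+i}`. -/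
def exB (n : ℕ) (x : Fin m × Fin k) : Fin n → ℝ := fun j =>
  (if (j : ℕ) = x.2 then 1 else 0) + (if (j : ℕ) = k + x.2 then (x.1 : ℝ) else 0)

theorem exA_succ (x : Fin m × Fin k) (p : Fin m) : exA x p.succ = if x.1 = p then 1 else 0 := rfl

theorem exA_zero (x : Fin m × Fin k) : exA x 0 = (x.2 : ℝ) := rfl

theorem exB_lo {n : ℕ} (h : 2 * k ≤ n) (x : Fin m × Fin k) (i : Fin k) :
    exB n x ⟨i, by omega⟩ = if x.2 = i then 1 else 0 := by
  have h1 : ¬ ((i : ℕ) = k + x.2) := by omega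
  simp [exB, h1, Fin.ext_iff, eq_comm]

theorem exB_hi {n : ℕ} (h : 2 * k ≤ n) (x : Fin m × Fin k) (i : Fin k) :
    exB n x ⟨k + i, by omega⟩ = if x.2 = i then (x.1 : ℝ) else 0 := by
  have h1 : ¬ (k + (i : ℕ) = x.2) := by omega
  simp [exB, h1, Fin.ext_iff, eq_comm]

/-- The vectors `a = e_{p+1} + i e_0`, `b = e_i + p e_{k+i}`, indexed by pairs `(p, i)` in a grid of
size `m × k`, satisfy the minor condition of general position. They give as many terms as the
bound on the rank allows. -/
theorem ex_minors {n : ℕ} (h : 2 * k ≤ n) {κ : Type} [Fintype κ] [DecidableEq κ]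
    {e : κ → Fin m × Fin k} (he : Function.Injective e) (C : κ → κ → ℝ)
    (hC : ∀ x y, C x y = C y x) (hC0 : ∀ x, C x x = 0)
    (hF : ∀ P Q r s, ∑ x, ∑ y, C x y * (exA (e x) P * exA (e y) Q *
      (exB n (e x) r * exB n (e y) s - exB n (e x) s * exB n (e y) r)) = 0) (x₀ y₀ : κ) :
    C x₀ y₀ = 0 := by
  -- Points in different rows: on the row of `x₀` and the row of `y₀`, the two functionals
  -- `q b(i) - b(k+i)` and `p b(j) - b(k+j)` single out one point each.
  have key : ∀ x₀ y₀, (e x₀).1 ≠ (e y₀).1 → C x₀ y₀ = 0 := by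
    intro x₀ y₀ hne
    let lo : Fin k → Fin n := fun i => ⟨i, by omega⟩
    let hi : Fin k → Fin n := fun i => ⟨k + i, by omega⟩
    rcases hx : e x₀ with ⟨p, i⟩
    rcases hy : e y₀ with ⟨q, j⟩
    rw [hx, hy] at hne
    have hsum : ∑ x, ∑ y, C x y * (exA (e x) p.succ * exA (e y) q.succ *
        (((q : ℝ) * exB n (e x) (lo i) - exB n (e x) (hi i)) *
            ((p : ℝ) * exB n (e y) (lo j) - exB n (e y) (hi j)) -
          ((p : ℝ) * exB n (e x) (lo j) - exB n (e x) (hi j)) *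
            ((q : ℝ) * exB n (e y) (lo i) - exB n (e y) (hi i)))) = 0 := by
      have h1 := hF p.succ q.succ (lo i) (lo j)
      have h2 := hF p.succ q.succ (lo i) (hi j)
      have h3 := hF p.succ q.succ (hi i) (lo j)
      have h4 := hF p.succ q.succ (hi i) (hi j)
      have : (0 : ℝ) = (q : ℝ) * p * 0 - q * 0 - p * 0 + 0 := by ring
      rw [this]
      nth_rewrite 1 [← h1]
      nth_rewrite 1 [← h2]
      nth_rewrite 1 [← h3]
      nth_rewrite 1 [← h4]
      simp only [Finset.mul_sum, ← Finset.sum_sub_distrib, ← Finset.sum_add_distrib]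
      exact Finset.sum_congr rfl fun x _ => Finset.sum_congr rfl fun y _ => by ring
    have hterm : ∀ x y, C x y * (exA (e x) p.succ * exA (e y) q.succ *
        (((q : ℝ) * exB n (e x) (lo i) - exB n (e x) (hi i)) *
            ((p : ℝ) * exB n (e y) (lo j) - exB n (e y) (hi j)) -
          ((p : ℝ) * exB n (e x) (lo j) - exB n (e x) (hi j)) *
            ((q : ℝ) * exB n (e y) (lo i) - exB n (e y) (hi i)))) =
        if y = y₀ then if x = x₀ then C x₀ y₀ * (((q : ℝ) - p) * (p - q)) else 0 else 0 := by
      intro x y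
      simp only [lo, hi, exB_lo h, exB_hi h, exA_succ]
      by_cases hxp : (e x).1 = p
      swap
      · have : x ≠ x₀ := fun h0 => hxp (by rw [h0, hx])
        simp [hxp, this]
      by_cases hyq : (e y).1 = q
      swap
      · have : y ≠ y₀ := fun h0 => hyq (by rw [h0, hy])
        simp [hyq, this]
      have hxi : (e x).2 = i ↔ x = x₀ :=
        ⟨fun h0 => he (by rw [hx]; exact Prod.ext hxp h0), fun h0 => by rw [h0, hx]⟩
      have hyj : (e y).2 = j ↔ y = y₀ :=
        ⟨fun h0 => he (by rw [hy]; exact Prod.ext hyq h0), fun h0 => by rw [h0, hy]⟩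
      simp only [hxp, hyq, hxi, hyj]
      by_cases h1 : x = x₀
      · by_cases h2 : y = y₀
        · simp [h1, h2]
        · simp [h2]
      · simp [h1]
    simp only [hterm, Finset.sum_ite_eq', Finset.mem_univ, if_true] at hsum
    have hpq : (q : ℝ) - p ≠ 0 := by
      rw [sub_ne_zero]
      exact fun h0 => hne (Fin.ext (by exact_mod_cast h0.symm))
    have hqp : (p : ℝ) - q ≠ 0 := by
      rw [← neg_sub]; exact neg_ne_zero.2 hpq
    exact (mul_eq_zero.1 hsum).resolve_right (mul_ne_zero hpq hqp)
  by_cases hrow : (e x₀).1 = (e y₀).1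
  swap
  · exact key x₀ y₀ hrow
  by_cases hxy : x₀ = y₀
  · rw [hxy]; exact hC0 y₀
  -- Points in the same row: only the pairs `(x₀, y₀)` and `(y₀, x₀)` contribute.
  rcases hx : e x₀ with ⟨p, i⟩
  rcases hy : e y₀ with ⟨p', j⟩
  rw [hx, hy] at hrow
  obtain rfl : p = p' := hrow
  have hij : i ≠ j := fun h0 => hxy (he (by rw [hx, hy, h0]))
  have hsum := hF p.succ 0 ⟨i, by omega⟩ ⟨j, by omega⟩
  have hterm : ∀ x y, C x y * (exA (e x) p.succ * exA (e y) 0 *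
      (exB n (e x) ⟨i, by omega⟩ * exB n (e y) ⟨j, by omega⟩ -
        exB n (e x) ⟨j, by omega⟩ * exB n (e y) ⟨i, by omega⟩)) =
      (if y = y₀ then if x = x₀ then C x₀ y₀ * (j : ℝ) else 0 else 0) -
        (if y = x₀ then if x = y₀ then C x₀ y₀ * (i : ℝ) else 0 else 0) := by
    intro x y
    simp only [exB_lo h, exA_succ, exA_zero]
    by_cases hxp : (e x).1 = p
    swap
    · have h1 : x ≠ x₀ := fun h0 => hxp (by rw [h0, hx])
      have h2 : x ≠ y₀ := fun h0 => hxp (by rw [h0, hy])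
      simp [hxp, h1, h2]
    by_cases hyp : (e y).1 = p
    swap
    · have h1 : y ≠ x₀ := fun h0 => hyp (by rw [h0, hx])
      have h2 : y ≠ y₀ := fun h0 => hyp (by rw [h0, hy])
      rw [key x y (by rw [hxp]; exact fun h0 => hyp h0.symm)]
      simp [h1, h2]
    have hz : ∀ z, (e z).1 = p → ((e z).2 = i ↔ z = x₀) ∧ ((e z).2 = j ↔ z = y₀) := fun z hz =>
      ⟨⟨fun h0 => he (by rw [hx]; exact Prod.ext hz h0), fun h0 => by rw [h0, hx]⟩,
        ⟨fun h0 => he (by rw [hy]; exact Prod.ext hz h0), fun h0 => by rw [h0, hy]⟩⟩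
    simp only [hxp, (hz x hxp).1, (hz x hxp).2, (hz y hyp).1, (hz y hyp).2]
    by_cases h1 : x = x₀
    · have h2 : x ≠ y₀ := fun h0 => hxy (h1.symm.trans h0)
      by_cases h3 : y = y₀
      · subst h1 h3; simp [h2, hy]
      · simp [h2, h3]
    · by_cases h2 : x = y₀
      · by_cases h3 : y = x₀
        · subst h2 h3; simp [h1, hx, hC x y]
        · simp [h1, h3]
      · simp [h1, h2]
  simp only [hterm, Finset.sum_sub_distrib, Finset.sum_ite_eq', Finset.mem_univ, if_true] at hsum
  rw [← mul_sub] at hsum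
  refine (mul_eq_zero.1 hsum).resolve_right (sub_ne_zero.2 fun h0 => hij (Fin.ext ?_))
  exact_mod_cast h0.symm

end Example

/-- Components are generically in general position. The bound on `R` enters only through the
existence of sufficiently many index pairs for the configuration `exA`, `exB`. -/
theorem generically_general {m k : ℕ} (hk : 2 * k ≤ n₂) (hR : R ≤ m * k) (hR' : R ≤ n₃ * n₄) :
    Generically fun w : Components (m + 1) n₂ n₃ n₄ R => w.General := by
  classical
  obtain ⟨e, he⟩ : ∃ e : Fin R → Fin m × Fin k, Function.Injective e :=
    ⟨fun x => finProdFinEquiv.symm (Fin.castLE hR x),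
      fun x y h => Fin.castLE_injective hR (finProdFinEquiv.symm.injective h)⟩
  obtain ⟨f, hf⟩ : ∃ f : Fin R → Fin n₃ × Fin n₄, Function.Injective f :=
    ⟨fun x => finProdFinEquiv.symm (Fin.castLE hR' x),
      fun x y h => Fin.castLE_injective hR' (finProdFinEquiv.symm.injective h)⟩
  let w₀ : Components (m + 1) n₂ n₃ n₄ R := mk (fun x => exA (e x)) (fun x => exB n₂ (e x))
    (fun x => Pi.single (f x).1 1) (fun x => Pi.single (f x).2 1)
  have h1 : Generically fun w : Components (m + 1) n₂ n₃ n₄ R => LinearIndependent ℝ w.ab := by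
    have := generically_linearIndependent (σ := CompIdx (m + 1) n₂ n₃ n₄ R)
      (fun (x : Fin R) (p : Fin (m + 1) × Fin n₂) => MvPolynomial.X (x, Sum.inl p.1) *
        MvPolynomial.X (x, Sum.inr (Sum.inl p.2))) w₀ (by
        refine linearIndependent_of_entries
          (fun y => ((e y).1.succ, ⟨(e y).2, by omega⟩)) fun x y => ?_
        simp only [map_mul, MvPolynomial.eval_X, w₀, mk, Sum.elim_inl, Sum.elim_inr, exA_succ,
          exB_lo hk]
        by_cases hxy : x = y
        · simp [hxy]
        · have : ¬ ((e x).1 = (e y).1 ∧ (e x).2 = (e y).2) := fun h0 =>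
            hxy (he (Prod.ext h0.1 h0.2))
          by_cases h1 : (e x).1 = (e y).1
          · have h2 : ¬ (e x).2 = (e y).2 := fun h2 => this ⟨h1, h2⟩
            simp [hxy, h2]
          · simp [hxy, h1])
    simp only [map_mul, MvPolynomial.eval_X] at this
    exact this
  have h2 : Generically fun w : Components (m + 1) n₂ n₃ n₄ R => LinearIndependent ℝ w.cd := by
    have := generically_linearIndependent (σ := CompIdx (m + 1) n₂ n₃ n₄ R)
      (fun (x : Fin R) (p : Fin n₃ × Fin n₄) => MvPolynomial.X (x, Sum.inr (Sum.inr (Sum.inl p.1)))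
        * MvPolynomial.X (x, Sum.inr (Sum.inr (Sum.inr p.2)))) w₀ (by
        refine linearIndependent_of_entries f fun x y => ?_
        simp only [map_mul, MvPolynomial.eval_X, w₀, mk, Sum.elim_inl, Sum.elim_inr,
          Pi.single_apply]
        by_cases hxy : x = y
        · simp [hxy]
        · have : ¬ ((f y).1 = (f x).1 ∧ (f y).2 = (f x).2) := fun h0 =>
            hxy (hf (Prod.ext h0.1 h0.2)).symm
          by_cases h1 : (f y).1 = (f x).1
          · have h2 : ¬ (f y).2 = (f x).2 := fun h2 => this ⟨h1, h2⟩
            simp [hxy, h2]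
          · simp [hxy, h1])
    simp only [map_mul, MvPolynomial.eval_X] at this
    exact this
  have h3 : Generically fun w : Components (m + 1) n₂ n₃ n₄ R => ∀ q, w q ≠ 0 :=
    .forall fun q => by
      simpa using generically_eval_ne_zero (MvPolynomial.X_ne_zero (R := ℝ) q)
  -- Symmetry and vanishing of the diagonal of `C` are encoded by extra coordinates, so that the
  -- condition `minors` becomes linear independence of a family with polynomial entries.
  let V : Fin R × Fin R →
      ((Fin (m + 1) × Fin (m + 1)) × (Fin n₂ × Fin n₂)) ⊕ (Fin R × Fin R) →
      MvPolynomial (CompIdx (m + 1) n₂ n₃ n₄ R) ℝ := fun x => Sum.elim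
    (fun p => MvPolynomial.X (x.1, Sum.inl p.1.1) * MvPolynomial.X (x.2, Sum.inl p.1.2) *
      (MvPolynomial.X (x.1, Sum.inr (Sum.inl p.2.1)) * MvPolynomial.X (x.2, Sum.inr (Sum.inl p.2.2))
      - MvPolynomial.X (x.1, Sum.inr (Sum.inl p.2.2)) *
        MvPolynomial.X (x.2, Sum.inr (Sum.inl p.2.1))))
    (fun y => MvPolynomial.C ((if x = y then 1 else 0) -
      if x = y.swap then (if y.1 = y.2 then 0 else 1) else 0))
  have hV : ∀ (w : Components (m + 1) n₂ n₃ n₄ R),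
      LinearIndependent ℝ (fun x i => MvPolynomial.eval w (V x i)) ↔
      ∀ C : Fin R → Fin R → ℝ, (∀ k l, C k l = C l k) → (∀ k, C k k = 0) →
        (∀ P Q r s, ∑ k, ∑ l, C k l *
          (w.a k P * w.a l Q * (w.b k r * w.b l s - w.b k s * w.b l r)) = 0) →
          ∀ k l, C k l = 0 := by
    intro w
    have hinr : ∀ (c : Fin R × Fin R → ℝ) (y : Fin R × Fin R),
        (∑ x, c x • fun i => MvPolynomial.eval w (V x i)) (Sum.inr y) =
          c y - c y.swap * (if y.1 = y.2 then 0 else 1) := by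
      intro c y
      simp [V, Finset.sum_apply, mul_sub, Finset.sum_sub_distrib]
    have hinl : ∀ (c : Fin R × Fin R → ℝ) P Q r s,
        (∑ x, c x • fun i => MvPolynomial.eval w (V x i)) (Sum.inl ((P, Q), (r, s))) =
          ∑ k, ∑ l, c (k, l) *
            (w.a k P * w.a l Q * (w.b k r * w.b l s - w.b k s * w.b l r)) := by
      intro c P Q r s
      rw [← Fintype.sum_prod_type', Finset.sum_apply]
      refine Finset.sum_congr rfl fun x _ => ?_
      simp [V, a, b]
    rw [Fintype.linearIndependent_iff]
    constructor
    · intro h C hC hC0 hF k l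
      refine h (fun x => C x.1 x.2) (funext fun i => ?_) (k, l)
      rcases i with ⟨⟨P, Q⟩, ⟨r, s⟩⟩ | y
      · rw [hinl]; exact hF P Q r s
      · rw [hinr]
        by_cases hy : y.1 = y.2
        · simp [hy, hC0]
        · simp [hy, hC y.1 y.2]
    · intro h c hc x
      have hc' : ∀ y : Fin R × Fin R, c y - c y.swap * (if y.1 = y.2 then 0 else 1) = 0 :=
        fun y => by rw [← hinr c y, hc]; rfl
      refine h (fun k l => c (k, l)) (fun k l => ?_) (fun k => ?_) (fun P Q r s => ?_) x.1 x.2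
      · by_cases hkl : k = l
        · rw [hkl]
        · have := hc' (k, l)
          simp [hkl] at this
          linarith
      · simpa using hc' (k, k)
      · rw [← hinl, hc]; rfl
  have h4 := generically_linearIndependent V w₀ ((hV w₀).2 fun C hC hC0 hF =>
    ex_minors hk he C hC hC0 hF)
  exact (h1.and (h2.and (h3.and h4))).mono fun w hw =>
    ⟨hw.1, hw.2.1, (hV w).1 hw.2.2.2, hw.2.2.1⟩

end Components

open Matrix

/-! ### Combinations of rank-one matrices -/

section Dual

variable {κ ι : Type} [Fintype κ]

/-- The matrix `∑ k, d k • w_k v_kᵀ`. -/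
def diagComb (w v : κ → ι → ℝ) (d : κ → ℝ) : Matrix ι ι ℝ := ∑ k, d k • vecMulVec (w k) (v k)

theorem diagComb_apply (w v : κ → ι → ℝ) (d : κ → ℝ) (p q : ι) :
    diagComb w v d p q = ∑ k, d k * (w k p * v k q) := by
  simp [diagComb, Matrix.sum_apply, vecMulVec_apply]

theorem diagComb_transpose (w v : κ → ι → ℝ) (d : κ → ℝ) :
    (diagComb w v d)ᵀ = diagComb v w d := by
  ext p q
  simp only [transpose_apply, diagComb_apply]
  exact Finset.sum_congr rfl fun k _ => by ring

theorem sum_smul_diagComb {s : Type} [Fintype s] (w v : κ → ι → ℝ) (x : s → ℝ) (D : s → κ → ℝ) :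
    ∑ j, x j • diagComb w v (D j) = diagComb w v fun k => ∑ j, x j * D j k := by
  simp only [diagComb, Finset.smul_sum, smul_smul, Finset.sum_smul]
  exact Finset.sum_comm

theorem mem_span_diag_iff (w : κ → ι → ℝ) (X : Matrix ι ι ℝ) :
    X ∈ Submodule.span ℝ (Set.range fun k => vecMulVec (w k) (w k)) ↔
      ∃ d, X = diagComb w w d := by
  rw [Submodule.mem_span_range_iff_exists_fun]
  exact ⟨fun ⟨c, h⟩ => ⟨c, h.symm⟩, fun ⟨c, h⟩ => ⟨c, h.symm⟩⟩

variable [Fintype ι]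

theorem diagComb_mulVec (w v : κ → ι → ℝ) (d : κ → ℝ) (r : ι → ℝ) :
    diagComb w v d *ᵥ r = ∑ k, (d k * (v k ⬝ᵥ r)) • w k := by
  ext p
  simp only [diagComb, Matrix.sum_mulVec, Matrix.smul_mulVec, Finset.sum_apply, Pi.smul_apply,
    smul_eq_mul]
  refine Finset.sum_congr rfl fun k _ => ?_
  rw [vecMulVec_mulVec]
  simp
  ring

variable [DecidableEq κ]

/-- The vectors `g k` lie in the span of the vectors `w k` and are dual to them. The field `symm`
says that the projection `∑ k, w_k g_kᵀ` is symmetric; it follows from the other two but is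
convenient to carry along. -/
structure IsDual (w g : κ → ι → ℝ) : Prop where
  dual : ∀ k l, g k ⬝ᵥ w l = if k = l then 1 else 0
  mem : ∀ k, g k ∈ Submodule.span ℝ (Set.range w)
  symm : diagComb w g 1 = diagComb g w 1

theorem diagComb_mul {w v w' v' : κ → ι → ℝ} (d d' : κ → ℝ)
    (h : ∀ k l, v k ⬝ᵥ w' l = if k = l then 1 else 0) :
    diagComb w v d * diagComb w' v' d' = diagComb w v' (d * d') := by
  simp only [diagComb, Finset.sum_mul, Finset.mul_sum]
  refine Finset.sum_congr rfl fun k _ => ?_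
  rw [Finset.sum_eq_single k (fun l _ hl => by simp [vecMulVec_mul_vecMulVec, h, hl]) (by simp)]
  simp [vecMulVec_mul_vecMulVec, h, smul_smul, mul_comm]

theorem dual_mulVec {w g : κ → ι → ℝ} (h : ∀ k l, g k ⬝ᵥ w l = if k = l then 1 else 0)
    (v : κ → ι → ℝ) (d : κ → ℝ) (l : κ) : diagComb v g d *ᵥ w l = d l • v l := by
  rw [diagComb_mulVec]
  simp [h]

/-- Eigenvectors of `∑ k, μ_k w_k g_kᵀ` for nonzero eigenvalues. -/
theorem eigenvector_diagComb {w g : κ → ι → ℝ}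
    (h : ∀ k l, g k ⬝ᵥ w l = if k = l then 1 else 0) {μ : κ → ℝ}
    {c : ℝ} {r : ι → ℝ} (hc : c ≠ 0) (hr : r ≠ 0) (he : diagComb w g μ *ᵥ r = c • r) :
    (∃ l, c = μ l) ∧ (Function.Injective μ → ∀ l, c = μ l → r = (g l ⬝ᵥ r) • w l) := by
  have h1 : r = ∑ k, (c⁻¹ * (μ k * (g k ⬝ᵥ r))) • w k := by
    calc r = c⁻¹ • (c • r) := by rw [smul_smul, inv_mul_cancel₀ hc, one_smul]
      _ = _ := by rw [← he, diagComb_mulVec, Finset.smul_sum]; simp only [smul_smul]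
  have h2 : ∀ l, c * (g l ⬝ᵥ r) = μ l * (g l ⬝ᵥ r) := by
    intro l
    have := congrArg (fun z => g l ⬝ᵥ z) he
    simp only [diagComb_mulVec, dotProduct_sum, dotProduct_smul, h, smul_eq_mul] at this
    simpa using this.symm
  have h3 : ∀ l, g l ⬝ᵥ r ≠ 0 → c = μ l := fun l hl => mul_right_cancel₀ hl (h2 l)
  have h4 : ∃ l, g l ⬝ᵥ r ≠ 0 := by
    by_contra hn
    push Not at hn
    exact hr (by rw [h1]; simp [hn])
  refine ⟨h4.imp h3, fun hμ l hl => ?_⟩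
  have h5 : ∀ k, k ≠ l → g k ⬝ᵥ r = 0 := fun k hk => by
    by_contra h0
    exact hk (hμ ((h3 k h0).symm.trans hl))
  nth_rewrite 1 [h1]
  rw [Finset.sum_eq_single l (fun k _ hk => by simp [h5 k hk]) (by simp), ← hl, ← mul_assoc,
    inv_mul_cancel₀ hc, one_mul]

theorem IsDual.dual' {w g : κ → ι → ℝ} (h : IsDual w g) (k l : κ) :
    w k ⬝ᵥ g l = if k = l then 1 else 0 := by
  rw [dotProduct_comm, h.dual]
  simp [eq_comm]

theorem exists_isDual {w : κ → ι → ℝ} (hw : LinearIndependent ℝ w) : ∃ g, IsDual w g := by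
  rw [linearIndependent_iff_gram] at hw
  set W : Matrix κ ι ℝ := Matrix.of w with hW
  have hu : IsUnit (W * Wᵀ).det := isUnit_iff_ne_zero.2 hw
  have h1 : ∀ k l, (fun k => ((W * Wᵀ)⁻¹ * W) k) k ⬝ᵥ w l = if k = l then 1 else 0 := by
    intro k l
    have : ((W * Wᵀ)⁻¹ * W * Wᵀ) k l = (1 : Matrix κ κ ℝ) k l := by
      rw [Matrix.mul_assoc, nonsing_inv_mul _ hu]
    rw [one_apply] at this
    rw [← this]
    rfl
  have h2 : ∀ g : κ → ι → ℝ, diagComb w g 1 = Wᵀ * (Matrix.of g) := by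
    intro g
    ext p q
    simp [diagComb_apply, mul_apply, hW]
  have h3 : ∀ g : κ → ι → ℝ, diagComb g w 1 = (Matrix.of g)ᵀ * W := by
    intro g
    ext p q
    simp [diagComb_apply, mul_apply, hW]
  refine ⟨fun k => ((W * Wᵀ)⁻¹ * W) k, h1, fun k => ?_, ?_⟩
  · rw [Submodule.mem_span_range_iff_exists_fun]
    refine ⟨(W * Wᵀ)⁻¹ k, ?_⟩
    ext p
    simp [mul_apply, hW]
  · rw [h2, h3]
    show Wᵀ * ((W * Wᵀ)⁻¹ * W) = ((W * Wᵀ)⁻¹ * W)ᵀ * W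
    rw [transpose_mul, transpose_nonsing_inv, transpose_mul, transpose_transpose, Matrix.mul_assoc]

theorem linearIndependent_diag {w : κ → ι → ℝ} (hw : LinearIndependent ℝ w) :
    LinearIndependent ℝ fun k => vecMulVec (w k) (w k) := by
  obtain ⟨g, hg⟩ := exists_isDual hw
  rw [Fintype.linearIndependent_iff]
  intro c hc l
  have h1 : diagComb w w c *ᵥ g l = 0 := by
    rw [diagComb, hc, zero_mulVec]
  rw [dual_mulVec hg.dual'] at h1
  exact (smul_eq_zero.1 h1).resolve_right (hw.ne_zero l)

end Dual

/-! ### Simultaneous diagonalization -/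

namespace JLV

section PseudoInverse

variable {ι : Type} [Fintype ι]

theorem IsPseudoInverse.unique {A X Y : Matrix ι ι ℝ} (hX : IsPseudoInverse A X)
    (hY : IsPseudoInverse A Y) : X = Y := by
  have h1 : A * X = A * Y := by
    calc A * X = (A * Y * A) * X := by rw [hY.left]
      _ = (A * Y)ᵀ * (A * X)ᵀ := by rw [hX.symm_left, hY.symm_left]; simp only [Matrix.mul_assoc]
      _ = (A * X * A * Y)ᵀ := by rw [← transpose_mul]; simp only [Matrix.mul_assoc]
      _ = A * Y := by rw [hX.left, hY.symm_left]
  have h2 : X * A = Y * A := by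
    calc X * A = X * (A * Y * A) := by rw [hY.left]
      _ = (X * A)ᵀ * (Y * A)ᵀ := by rw [hX.symm_right, hY.symm_right]; simp only [Matrix.mul_assoc]
      _ = (Y * (A * X * A))ᵀ := by rw [← transpose_mul]; simp only [Matrix.mul_assoc]
      _ = Y * A := by rw [hX.left, hY.symm_right]
  calc X = X * A * X := hX.right.symm
    _ = Y * A * X := by rw [h2]
    _ = Y * (A * Y) := by rw [Matrix.mul_assoc, h1]
    _ = Y := by rw [← Matrix.mul_assoc, hY.right]

theorem isPseudoInverse_diagComb {κ : Type} [Fintype κ] [DecidableEq κ] {w g : κ → ι → ℝ}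
    (h : IsDual w g) {d : κ → ℝ} (hd : ∀ k, d k ≠ 0) :
    IsPseudoInverse (diagComb w w d) (diagComb g g d⁻¹) := by
  have h1 : d * d⁻¹ = 1 := funext fun k => mul_inv_cancel₀ (hd k)
  have h2 : d⁻¹ * d = 1 := funext fun k => inv_mul_cancel₀ (hd k)
  have h3 : diagComb w w d * diagComb g g d⁻¹ = diagComb w g 1 := by
    rw [diagComb_mul _ _ h.dual', h1]
  have h4 : diagComb g g d⁻¹ * diagComb w w d = diagComb g w 1 := by
    rw [diagComb_mul _ _ h.dual, h2]
  constructor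
  · rw [h3, diagComb_mul _ _ h.dual, one_mul]
  · rw [h4, diagComb_mul _ _ h.dual', one_mul]
  · rw [h3, diagComb_transpose, h.symm]
  · rw [h4, diagComb_transpose, h.symm]

end PseudoInverse

variable {ι κ : Type} [Fintype ι] [Fintype κ] [DecidableEq κ] {s t : ℕ}

/-- Simultaneous diagonalization succeeds on `∑ k, P k ⊗ e_k`, where `P k = ∑ ℓ, ζ_{kℓ} w_ℓ w_ℓᵀ`,
if the functionals take nonzero values with distinct ratios on the columns of `ζ`. -/
theorem simDiagRun_of_diag {w g : κ → ι → ℝ} (hw : LinearIndependent ℝ w) (hg : IsDual w g)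
    {P : Fin s → Matrix ι ι ℝ} {ζ : Fin s → κ → ℝ} (hP : ∀ k, P k = diagComb w w (ζ k))
    {x y : Fin s → ℝ} (hx : ∀ l, ∑ k, x k * ζ k l ≠ 0) (hy : ∀ l, ∑ k, y k * ζ k l ≠ 0)
    (hxy : Function.Injective fun l => (∑ k, x k * ζ k l) * (∑ k, y k * ζ k l)⁻¹)
    (e : Fin t ≃ κ) {σ : Fin t → ℝ} (hσ : ∀ i, σ i ≠ 0) :
    ∃ A' B' lam z, SimDiagRun P x y A' B' lam (fun i => σ i • w (e i)) (fun i => σ i • w (e i))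
      z := by
  set dx : κ → ℝ := fun l => ∑ k, x k * ζ k l with hdx
  set dy : κ → ℝ := fun l => ∑ k, y k * ζ k l with hdy
  have hA : ∑ k, x k • P k = diagComb w w dx := by simp only [hP, sum_smul_diagComb, hdx]
  have hB : ∑ k, y k • P k = diagComb w w dy := by simp only [hP, sum_smul_diagComb, hdy]
  have hAB : diagComb w w dx * diagComb g g dy⁻¹ = diagComb w g (dx * dy⁻¹) :=
    diagComb_mul _ _ hg.dual'
  have hBA : (diagComb g g dx⁻¹ * diagComb w w dy)ᵀ = diagComb w g (dx⁻¹ * dy) := by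
    rw [diagComb_mul _ _ hg.dual, diagComb_transpose]
  refine ⟨diagComb g g dx⁻¹, diagComb g g dy⁻¹, fun i => (dx * dy⁻¹) (e i),
    fun i k => ζ k (e i) * (σ i)⁻¹ ^ 2, ?_⟩
  have hne : ∀ i, σ i • w (e i) ≠ 0 := fun i => smul_ne_zero (hσ i) (hw.ne_zero _)
  refine ⟨?_, ?_, ?_, ?_, hne, hne, ?_, ?_, ?_, ?_⟩
  · rw [hA]; exact isPseudoInverse_diagComb hg hx
  · rw [hB]; exact isPseudoInverse_diagComb hg hy
  · exact fun i j hij => e.injective (hxy hij)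
  · exact fun i => mul_ne_zero (hx _) (inv_ne_zero (hy _))
  · intro i
    rw [hA, hAB, mulVec_smul, dual_mulVec hg.dual, smul_comm]
  · intro μ r hμ hr he
    rw [hA, hAB] at he
    obtain ⟨⟨l, hl⟩, h2⟩ := eigenvector_diagComb hg.dual hμ hr he
    refine ⟨e.symm l, by simpa using hl, (g l ⬝ᵥ r) * (σ (e.symm l))⁻¹, ?_⟩
    rw [smul_smul, mul_assoc, inv_mul_cancel₀ (hσ _), mul_one, Equiv.apply_symm_apply]
    exact h2 hxy l hl
  · intro i
    rw [hA, hB] at *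
    rw [hBA, mulVec_smul, dual_mulVec hg.dual, smul_comm]
    simp [mul_comm]
  · intro k
    rw [hP, diagComb, ← e.sum_comp]
    refine Finset.sum_congr rfl fun i _ => ?_
    rw [smul_vecMulVec, vecMulVec_smul, smul_smul, smul_smul]
    congr 1
    have := hσ i
    field_simp

/-- Every successful run of simultaneous diagonalization on a basis of the span of the matrices
`w_ℓ w_ℓᵀ` finds exactly the vectors `w_ℓ`, up to order and scaling. -/
theorem simDiagRun_unique {w g : κ → ι → ℝ} (hw : LinearIndependent ℝ w) (hg : IsDual w g)
    {P : Fin s → Matrix ι ι ℝ} (hspan : Submodule.span ℝ (Set.range P) =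
      Submodule.span ℝ (Set.range fun l => vecMulVec (w l) (w l)))
    {x y : Fin s → ℝ} {A' B' : Matrix ι ι ℝ} {lam : Fin t → ℝ} {u v : Fin t → ι → ℝ}
    {z : Fin t → Fin s → ℝ} (h : SimDiagRun P x y A' B' lam u v z) :
    ∃ (e : Fin t ≃ κ) (σ : Fin t → ℝ), ∀ i, σ i ≠ 0 ∧ u i = σ i • w (e i) := by
  have hcomb : ∀ x : Fin s → ℝ, ∃ d, ∑ k, x k • P k = diagComb w w d := fun x => by
    rw [← mem_span_diag_iff, ← hspan]
    exact Submodule.sum_mem _ fun k _ => Submodule.smul_mem _ _ (Submodule.subset_span ⟨k, rfl⟩)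
  obtain ⟨dx, hA⟩ := hcomb x
  obtain ⟨dy, hB⟩ := hcomb y
  have hpA := h.pinv_A
  have hpB := h.pinv_B
  have heig := h.eig_u
  have hall := h.eig_all
  rw [hA] at hpA heig hall
  rw [hB] at hpB
  have hu : LinearIndependent ℝ u := by
    classical
    refine Module.End.eigenvectors_linearIndependent'
      (Matrix.toLin' (diagComb w w dx * B')) lam h.lam_inj u fun i => ?_
    rw [Module.End.hasEigenvector_iff, Module.End.mem_eigenspace_iff]
    exact ⟨by simpa using heig i, h.u_ne i⟩
  -- The vectors `w_ℓ` lie in the span of the vectors `u_i`.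
  have hwu : ∀ l, w l ∈ Submodule.span ℝ (Set.range u) := by
    intro l
    have h1 : ∀ M ∈ Submodule.span ℝ (Set.range P), ∀ r : ι → ℝ,
        M *ᵥ r ∈ Submodule.span ℝ (Set.range u) := by
      intro M hM r
      induction hM using Submodule.span_induction with
      | mem M hM =>
        obtain ⟨k, rfl⟩ := hM
        rw [h.solve k, Matrix.sum_mulVec]
        refine Submodule.sum_mem _ fun i _ => ?_
        rw [smul_mulVec, vecMulVec_mulVec]
        refine Submodule.smul_mem _ _ ?_
        rw [op_smul_eq_smul]
        exact Submodule.smul_mem _ _ (Submodule.subset_span ⟨i, rfl⟩)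
      | zero => rw [zero_mulVec]; exact Submodule.zero_mem _
      | add M N _ _ ih ih' => rw [add_mulVec]; exact Submodule.add_mem _ ih ih'
      | smul c M _ ih => rw [smul_mulVec]; exact Submodule.smul_mem _ _ ih
    have h2 := h1 (vecMulVec (w l) (w l)) (by
      rw [hspan]; exact Submodule.subset_span ⟨l, rfl⟩) (g l)
    rw [vecMulVec_mulVec, hg.dual', if_pos rfl] at h2
    simpa using h2
  have huA : ∀ i, u i = ∑ l, ((lam i)⁻¹ * (dx l * (w l ⬝ᵥ (B' *ᵥ u i)))) • w l := by
    intro i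
    have h1 := heig i
    rw [← mulVec_mulVec, diagComb_mulVec] at h1
    calc u i = (lam i)⁻¹ • (lam i • u i) := by
          rw [smul_smul, inv_mul_cancel₀ (h.lam_ne i), one_smul]
      _ = _ := by rw [← h1, Finset.smul_sum]; simp only [smul_smul]
  have hspan_eq : Submodule.span ℝ (Set.range w) ≤ Submodule.span ℝ (Set.range u) :=
    Submodule.span_le.2 (by rintro _ ⟨l, rfl⟩; exact hwu l)
  have hdx : ∀ l, dx l ≠ 0 := by
    intro l hl
    have h1 : ∀ r ∈ Submodule.span ℝ (Set.range u), g l ⬝ᵥ r = 0 := by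
      intro r hr
      induction hr using Submodule.span_induction with
      | mem r hr =>
        obtain ⟨i, rfl⟩ := hr
        rw [huA i, dotProduct_sum]
        refine Finset.sum_eq_zero fun k _ => ?_
        rw [dotProduct_smul, hg.dual]
        by_cases hk : l = k
        · subst hk; simp [hl]
        · simp [hk]
      | zero => simp
      | add r r' _ _ ih ih' => rw [dotProduct_add, ih, ih', add_zero]
      | smul c r _ ih => rw [dotProduct_smul, ih, smul_zero]
    have := h1 _ (hwu l)
    rw [hg.dual, if_pos rfl] at this
    exact one_ne_zero this
  -- `B⁺` is injective on the span of the `u_i`, and it vanishes on the kernel of `B`.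
  have hdy : ∀ l, dy l ≠ 0 := by
    intro l hl
    have h1 : diagComb w w dy *ᵥ g l = 0 := by
      rw [dual_mulVec hg.dual', hl, zero_smul]
    have h2 : B' *ᵥ g l = 0 := by
      have h3 : B' = B' * (B'ᵀ * diagComb w w dy) := by
        have h4 := hpB.symm_left
        rw [transpose_mul, diagComb_transpose] at h4
        rw [h4, ← Matrix.mul_assoc, hpB.right]
      rw [h3, ← mulVec_mulVec, ← mulVec_mulVec, h1, mulVec_zero, mulVec_zero]
    obtain ⟨c, hc⟩ := (Submodule.mem_span_range_iff_exists_fun ℝ).1 (hspan_eq (hg.mem l))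
    have h5 : ∑ i, (c i * lam i) • u i = 0 := by
      have h6 : (diagComb w w dx * B') *ᵥ g l = 0 := by
        rw [← mulVec_mulVec, h2, mulVec_zero]
      rw [← hc, mulVec_sum] at h6
      rw [← h6]
      exact Finset.sum_congr rfl fun i _ => by rw [mulVec_smul, heig i, smul_smul]
    have h7 := Fintype.linearIndependent_iff.1 hu _ h5
    have h8 : g l = 0 := by
      rw [← hc]
      refine Finset.sum_eq_zero fun i _ => ?_
      rw [(mul_eq_zero.1 (h7 i)).resolve_right (h.lam_ne i), zero_smul]
    have := hg.dual l l
    rw [h8, zero_dotProduct, if_pos rfl] at this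
    exact zero_ne_one this
  have hB' : B' = diagComb g g dy⁻¹ := hpB.unique (isPseudoInverse_diagComb hg hdy)
  have hwf : ∀ l, ∃ i, ∃ c : ℝ, w l = c • u i := by
    intro l
    obtain ⟨i, -, c, hc⟩ := hall ((dx * dy⁻¹) l) (w l)
      (mul_ne_zero (hdx l) (inv_ne_zero (hdy l))) (hw.ne_zero l)
      (by rw [hB', diagComb_mul _ _ hg.dual', dual_mulVec hg.dual])
    exact ⟨i, c, hc⟩
  choose f c hf using hwf
  have hc : ∀ l, c l ≠ 0 := fun l h0 => hw.ne_zero l (by rw [hf l, h0, zero_smul])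
  have hinj : Function.Injective f := by
    intro k l hkl
    by_contra hne
    have h1 : g k ⬝ᵥ w k = (c k * (c l)⁻¹) * (g k ⬝ᵥ w l) := by
      rw [hf k, hf l, hkl, dotProduct_smul, dotProduct_smul, smul_eq_mul, smul_eq_mul]
      have := hc l
      field_simp
    rw [hg.dual, hg.dual, if_pos rfl, if_neg hne, mul_zero] at h1
    exact one_ne_zero h1
  have hsurj : Function.Surjective f := by
    intro i
    by_contra hn
    push Not at hn
    have h1 : u i ∈ Submodule.span ℝ (u '' {i}ᶜ) := by
      rw [huA i]
      refine Submodule.sum_mem _ fun l _ => Submodule.smul_mem _ _ ?_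
      rw [hf l]
      exact Submodule.smul_mem _ _ (Submodule.subset_span ⟨f l, hn l, rfl⟩)
    exact hu.notMem_span_image (s := {i}ᶜ) (x := i) (by simp) h1
  let e := (Equiv.ofBijective f ⟨hinj, hsurj⟩).symm
  have he : ∀ i, f (e i) = i := fun i => (Equiv.ofBijective f ⟨hinj, hsurj⟩).apply_symm_apply i
  refine ⟨e, fun i => (c (e i))⁻¹, fun i => ⟨inv_ne_zero (hc _), ?_⟩⟩
  rw [hf (e i), smul_smul, inv_mul_cancel₀ (hc _), one_smul, he]

end JLV

/-! ### The space `S²(U) ∩ span{minors}^⊥` -/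

namespace JLV

variable {m n : ℕ}

theorem symProd_apply (u u' : V m n) (p q : Fin m × Fin n) :
    symProd u u' p q = 1 / 2 * (u p * u' q) + 1 / 2 * (u' p * u q) := by
  simp [symProd, vecMulVec_apply]

theorem pairing_symProd_unitMat (X : VV m n) (a c : Fin m) (b d : Fin n) :
    pairing X (symProd (unitMat a b) (unitMat c d)) =
      1 / 2 * X (a, b) (c, d) + 1 / 2 * X (c, d) (a, b) := by
  simp only [pairing, symProd_apply, unitMat, mul_add, Finset.sum_add_distrib, Pi.single_apply,
    mul_ite, mul_one, mul_zero, Finset.sum_ite_eq', Finset.mem_univ,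
    if_true]
  simp [mul_comm]

theorem pairing_minorTensor {X : VV m n} (hX : ∀ p q, X p q = X q p) (a c : Fin m)
    (b d : Fin n) : pairing X (minorTensor a b c d) = X (a, b) (c, d) - X (a, d) (c, b) := by
  have h : pairing X (minorTensor a b c d) = pairing X (symProd (unitMat a b) (unitMat c d)) -
      pairing X (symProd (unitMat a d) (unitMat c b)) := by
    simp [pairing, minorTensor, mul_sub]
  rw [h, pairing_symProd_unitMat, pairing_symProd_unitMat, hX (c, d), hX (c, b)]
  ring

/-- For symmetric matrices, orthogonality to the minors is invariance under the exchange of the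
second indices of the two index pairs. -/
theorem mem_perp_minorSpan_iff {X : VV m n} (hX : ∀ p q, X p q = X q p) :
    X ∈ perp (minorSpan m n) ↔ ∀ a c b d, X (a, b) (c, d) = X (a, d) (c, b) := by
  constructor
  · intro h
    have h1 : ∀ a c b d, a < c → b < d → X (a, b) (c, d) = X (a, d) (c, b) := by
      intro a c b d hac hbd
      have := h _ (Submodule.subset_span ⟨a, b, c, d, hac, hbd, rfl⟩)
      rw [pairing_minorTensor hX] at this
      linarith
    have h2 : ∀ a c b d, a < c → X (a, b) (c, d) = X (a, d) (c, b) := by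
      intro a c b d hac
      rcases lt_trichotomy b d with hbd | rfl | hbd
      · exact h1 a c b d hac hbd
      · rfl
      · exact (h1 a c d b hac hbd).symm
    intro a c b d
    rcases lt_trichotomy a c with hac | rfl | hac
    · exact h2 a c b d hac
    · exact hX _ _
    · rw [hX, h2 c a d b hac, hX]
  · intro h N hN
    induction hN using Submodule.span_induction with
    | mem N hN =>
      obtain ⟨a, b, c, d, -, -, rfl⟩ := hN
      rw [pairing_minorTensor hX, h a c b d, sub_self]
    | zero => simp [pairing]
    | add N N' _ _ ih ih' =>
      have : pairing X (N + N') = pairing X N + pairing X N' := by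
        simp [pairing, mul_add, Finset.sum_add_distrib]
      rw [this, ih, ih', add_zero]
    | smul c N _ ih =>
      have : pairing X (c • N) = c * pairing X N := by
        simp only [pairing, Finset.mul_sum, Matrix.smul_apply, smul_eq_mul]
        exact Finset.sum_congr rfl fun p _ => Finset.sum_congr rfl fun q _ => by ring
      rw [this, ih, mul_zero]

theorem exists_symm_of_mem_symSquare {κ : Type} [Fintype κ] {w : κ → V m n} {X : VV m n}
    (hX : X ∈ symSquare (Submodule.span ℝ (Set.range w))) :
    ∃ C : κ → κ → ℝ, (∀ k l, C k l = C l k) ∧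
      ∀ p q, X p q = ∑ k, ∑ l, C k l * (w k p * w l q) := by
  unfold symSquare at hX
  induction hX using Submodule.span_induction with
  | mem X hX =>
    obtain ⟨u, hu, u', hu', rfl⟩ := hX
    obtain ⟨c, rfl⟩ := (Submodule.mem_span_range_iff_exists_fun ℝ).1 hu
    obtain ⟨c', rfl⟩ := (Submodule.mem_span_range_iff_exists_fun ℝ).1 hu'
    refine ⟨fun k l => 1 / 2 * (c k * c' l) + 1 / 2 * (c' k * c l), fun k l => by ring,
      fun p q => ?_⟩
    rw [symProd_apply]
    simp only [Finset.sum_apply, Pi.smul_apply, smul_eq_mul]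
    rw [Finset.sum_mul_sum, Finset.sum_mul_sum]
    simp only [Finset.mul_sum, ← Finset.sum_add_distrib]
    exact Finset.sum_congr rfl fun k _ => Finset.sum_congr rfl fun l _ => by ring
  | zero => exact ⟨0, fun _ _ => rfl, fun p q => by simp⟩
  | add X Y _ _ ih ih' =>
    obtain ⟨C, hC, h⟩ := ih
    obtain ⟨D, hD, h'⟩ := ih'
    exact ⟨C + D, fun k l => by simp [hC k l, hD k l], fun p q => by
      simp [h, h', add_mul, Finset.sum_add_distrib]⟩
  | smul c X _ ih =>
    obtain ⟨C, hC, h⟩ := ih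
    exact ⟨c • C, fun k l => by simp [hC k l], fun p q => by
      simp [h, Finset.mul_sum, mul_assoc]⟩

theorem outer_eq_smul {x a : Fin m → ℝ} {y b : Fin n → ℝ} {s : ℝ} (hs : s ≠ 0) (hm : 0 < m)
    (hn : 0 < n) (ha : ∀ i, a i ≠ 0) (hb : ∀ j, b j ≠ 0) (h : outer x y = s • outer a b) :
    ∃ α β, α * β = s ∧ x = α • a ∧ y = β • b := by
  have h' : ∀ i j, x i * y j = s * (a i * b j) := fun i j => congrFun h (i, j)
  let i₀ : Fin m := ⟨0, hm⟩
  let j₀ : Fin n := ⟨0, hn⟩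
  have ha₀ := ha i₀
  have hb₀ := hb j₀
  have h0 := h' i₀ j₀
  have hne : x i₀ * y j₀ ≠ 0 := by
    rw [h0]; exact mul_ne_zero hs (mul_ne_zero ha₀ hb₀)
  have hx := left_ne_zero_of_mul hne
  have hy := right_ne_zero_of_mul hne
  refine ⟨x i₀ / a i₀, y j₀ / b j₀, ?_, funext fun i => ?_, funext fun j => ?_⟩
  · field_simp
    linarith
  · have h1 := h' i j₀
    simp only [Pi.smul_apply, smul_eq_mul]
    rw [div_mul_eq_mul_div, eq_div_iff ha₀]
    apply mul_right_cancel₀ hy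
    linear_combination a i₀ * h1 - a i * h0
  · have h1 := h' i₀ j
    simp only [Pi.smul_apply, smul_eq_mul]
    rw [div_mul_eq_mul_div, eq_div_iff hb₀]
    apply mul_left_cancel₀ hx
    linear_combination b j₀ * h1 - b j * h0

end JLV

/-! ### Correctness of the algorithm for components in general position -/

namespace Components

variable {n₁ n₂ n₃ n₄ R t : ℕ} {w : Components n₁ n₂ n₃ n₄ R}

theorem tensor_apply (w : Components n₁ n₂ n₃ n₄ R) (i : Fin n₁) (j : Fin n₂) (k : Fin n₃)
    (l : Fin n₄) : w.tensor i j k l = ∑ ℓ, w.ab ℓ (i, j) * w.cd ℓ (k, l) :=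
  Finset.sum_congr rfl fun ℓ _ => by simp only [ab, cd, JLV.outer]; ring

/-- The same relation as `SameUpToPermScale`, expressed by the matrices `a bᵀ` and `c dᵀ`. -/
def Matches (out : Components n₁ n₂ n₃ n₄ t) (w : Components n₁ n₂ n₃ n₄ R) : Prop :=
  ∃ (e : Fin t ≃ Fin R) (s : Fin t → ℝ), ∀ i, s i ≠ 0 ∧ out.ab i = s i • w.ab (e i) ∧
    out.cd i = (s i)⁻¹ • w.cd (e i)

theorem Matches.refl (w : Components n₁ n₂ n₃ n₄ R) : Matches w w :=
  ⟨Equiv.refl _, fun _ => 1, fun _ => by simp⟩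

theorem General.sameUpToPermScale (hw : w.General) (h₁ : 0 < n₁) (h₂ : 0 < n₂) (h₃ : 0 < n₃)
    (h₄ : 0 < n₄) {out : Components n₁ n₂ n₃ n₄ t} (h : out.Matches w) :
    out.SameUpToPermScale w := by
  obtain ⟨e, s, h⟩ := h
  refine ⟨e, fun i => ?_⟩
  obtain ⟨hs, hab, hcd⟩ := h i
  obtain ⟨α, β, h1, ha, hb⟩ := JLV.outer_eq_smul hs h₁ h₂ (fun _ => hw.ne_zero _)
    (fun _ => hw.ne_zero _) hab
  obtain ⟨γ, δ, h2, hc, hd⟩ := JLV.outer_eq_smul (inv_ne_zero hs) h₃ h₄ (fun _ => hw.ne_zero _)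
    (fun _ => hw.ne_zero _) hcd
  exact ⟨α, β, γ, δ, by rw [mul_assoc, h1, h2, mul_inv_cancel₀ hs], ha, hb, hc, hd⟩

theorem colSpace_tensor_le (w : Components n₁ n₂ n₃ n₄ R) :
    JLV.colSpace w.tensor ≤ Submodule.span ℝ (Set.range w.ab) := by
  refine Submodule.span_le.2 ?_
  rintro _ ⟨q, rfl⟩
  refine (Submodule.mem_span_range_iff_exists_fun ℝ).2 ⟨fun ℓ => w.cd ℓ q, ?_⟩
  ext p
  simp only [Finset.sum_apply, Pi.smul_apply, smul_eq_mul, tensor_apply]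
  exact Finset.sum_congr rfl fun ℓ _ => mul_comm _ _

theorem General.colSpace_tensor (hw : w.General) :
    JLV.colSpace w.tensor = Submodule.span ℝ (Set.range w.ab) := by
  refine le_antisymm (colSpace_tensor_le w) (Submodule.span_le.2 ?_)
  rintro _ ⟨ℓ, rfl⟩
  obtain ⟨g, hg⟩ := exists_isDual hw.indep_cd
  have : w.ab ℓ = ∑ q : Fin n₃ × Fin n₄, g ℓ q • fun p : Fin n₁ × Fin n₂ =>
      w.tensor p.1 p.2 q.1 q.2 := by
    ext p
    simp only [Finset.sum_apply, Pi.smul_apply, smul_eq_mul, tensor_apply, Finset.mul_sum]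
    rw [Finset.sum_comm]
    have h1 : ∀ k, ∑ q, g ℓ q * (w.ab k p * w.cd k q) = w.ab k p * (g ℓ ⬝ᵥ w.cd k) := by
      intro k
      rw [dotProduct, Finset.mul_sum]
      exact Finset.sum_congr rfl fun q _ => by ring
    simp [h1, hg.dual]
  rw [this]
  exact Submodule.sum_mem _ fun q _ => Submodule.smul_mem _ _ (Submodule.subset_span ⟨q, rfl⟩)

/-- A symmetric combination of the products `ab k ⊗ ab l` that is annihilated by the minors is
diagonal. -/
theorem General.diag_of_minors (hw : w.General) {C : Fin R → Fin R → ℝ}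
    (hC : ∀ k l, C k l = C l k) {X : JLV.VV n₁ n₂}
    (hX : ∀ p q, X p q = ∑ k, ∑ l, C k l * (w.ab k p * w.ab l q))
    (hm : ∀ a c b d, X (a, b) (c, d) = X (a, d) (c, b)) :
    ∃ d, X = diagComb w.ab w.ab d := by
  have h0 := hw.minors (fun k l => if k = l then 0 else C k l)
    (fun k l => by simp only [hC k l, eq_comm]) (fun k => by simp) (fun P Q r s => by
      have h1 := hm P Q r s
      rw [hX, hX, ← sub_eq_zero, ← Finset.sum_sub_distrib] at h1
      rw [← h1]
      refine Finset.sum_congr rfl fun k _ => ?_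
      rw [← Finset.sum_sub_distrib]
      refine Finset.sum_congr rfl fun l _ => ?_
      by_cases hkl : k = l
      · subst hkl
        simp only [if_true, ab, JLV.outer]
        ring
      · simp only [hkl, if_false, ab, JLV.outer]
        ring)
  refine ⟨fun k => C k k, ?_⟩
  ext p q
  rw [hX, diagComb_apply]
  refine Finset.sum_congr rfl fun k _ => ?_
  refine Finset.sum_eq_single k (fun l _ hl => ?_) (by simp)
  have := h0 k l
  rw [if_neg (Ne.symm hl)] at this
  rw [this, zero_mul]

theorem diagComb_ab_exchange (w : Components n₁ n₂ n₃ n₄ R) (d : Fin R → ℝ) (a c : Fin n₁)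
    (b b' : Fin n₂) :
    diagComb w.ab w.ab d (a, b) (c, b') = diagComb w.ab w.ab d (a, b') (c, b) := by
  rw [diagComb_apply, diagComb_apply]
  refine Finset.sum_congr rfl fun k _ => ?_
  simp only [ab, JLV.outer]
  ring

theorem diagComb_self_symm {κ ι : Type} [Fintype κ] (w : κ → ι → ℝ) (d : κ → ℝ) (p q : ι) :
    diagComb w w d p q = diagComb w w d q p := by
  rw [diagComb_apply, diagComb_apply]
  exact Finset.sum_congr rfl fun k _ => by ring

/-- The space from which the algorithm takes the matrices `P` is spanned by the squares of the
matrices `a^ℓ (b^ℓ)ᵀ`. -/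
theorem General.liftSpace (hw : w.General) :
    JLV.symSquare (JLV.colSpace w.tensor) ⊓ JLV.perp (JLV.minorSpan n₁ n₂) =
      Submodule.span ℝ (Set.range fun ℓ => vecMulVec (w.ab ℓ) (w.ab ℓ)) := by
  rw [hw.colSpace_tensor]
  apply le_antisymm
  · rintro X ⟨hX, hX'⟩
    obtain ⟨C, hC, h⟩ := JLV.exists_symm_of_mem_symSquare hX
    have hs : ∀ p q, X p q = X q p := by
      intro p q
      rw [h, h, Finset.sum_comm]
      exact Finset.sum_congr rfl fun k _ => Finset.sum_congr rfl fun l _ => by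
        rw [hC k l]; ring
    rw [mem_span_diag_iff]
    exact hw.diag_of_minors hC h ((JLV.mem_perp_minorSpan_iff hs).1 hX')
  · refine Submodule.span_le.2 ?_
    rintro _ ⟨ℓ, rfl⟩
    refine ⟨Submodule.subset_span ⟨w.ab ℓ, Submodule.subset_span ⟨ℓ, rfl⟩, w.ab ℓ,
      Submodule.subset_span ⟨ℓ, rfl⟩, ?_⟩, ?_⟩
    · ext p q
      rw [JLV.symProd_apply]
      simp only [vecMulVec_apply]
      ring
    · refine (JLV.mem_perp_minorSpan_iff fun p q => ?_).2 fun a c b d => ?_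
      · simp only [vecMulVec_apply]; ring
      · simp only [vecMulVec_apply, ab, JLV.outer]; ring

theorem General.rank (hw : w.General) {w' : Components n₁ n₂ n₃ n₄ t}
    (h : w'.tensor = w.tensor) : R ≤ t := by
  have h1 : Submodule.span ℝ (Set.range w.ab) ≤ Submodule.span ℝ (Set.range w'.ab) := by
    rw [← hw.colSpace_tensor, ← h]
    exact colSpace_tensor_le w'
  have h2 := Submodule.finrank_mono h1
  rw [finrank_span_eq_card hw.indep_ab, Fintype.card_fin] at h2
  exact h2.trans ((finrank_range_le_card _).trans_eq (Fintype.card_fin t))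

/-- Every decomposition that matches `w` is found by a run, for generic functionals. -/
theorem General.generically_isRun (hw : w.General) {out : Components n₁ n₂ n₃ n₄ t}
    (hout : out.Matches w) {s : ℕ} {P : Fin s → JLV.VV n₁ n₂}
    (hP : JLV.IsLiftBasis w.tensor P) :
    Generically fun xy : Fin s ⊕ Fin s → ℝ =>
      JLV.IsRun w.tensor P (fun k => xy (Sum.inl k)) (fun k => xy (Sum.inr k)) out := by
  classical
  obtain ⟨g, hg⟩ := exists_isDual hw.indep_ab
  obtain ⟨-, hspan⟩ := hP
  rw [hw.liftSpace] at hspan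
  have hζ : ∀ k, ∃ d, P k = diagComb w.ab w.ab d := fun k => by
    rw [← mem_span_diag_iff, ← hspan]
    exact Submodule.subset_span ⟨k, rfl⟩
  choose ζ hζ using hζ
  -- Functionals dual to the components show that the polynomials below are nonzero.
  have hx : ∀ l, ∃ x : Fin s → ℝ, ∀ l', ∑ k, x k * ζ k l' = if l = l' then 1 else 0 := by
    intro l
    have h1 : vecMulVec (w.ab l) (w.ab l) ∈ Submodule.span ℝ (Set.range P) := by
      rw [hspan]; exact Submodule.subset_span ⟨l, rfl⟩
    obtain ⟨x, hx⟩ := (Submodule.mem_span_range_iff_exists_fun ℝ).1 h1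
    refine ⟨x, fun l' => ?_⟩
    simp only [hζ, sum_smul_diagComb] at hx
    have h2 := congrArg (fun M => M *ᵥ g l') hx
    simp only [dual_mulVec hg.dual', vecMulVec_mulVec, hg.dual'] at h2
    by_cases hl : l = l'
    · subst hl
      simp only [if_true] at h2 ⊢
      have h3 : ((∑ k, x k * ζ k l) - 1) • w.ab l = 0 := by
        rw [sub_smul, h2]; simp
      exact sub_eq_zero.1 ((smul_eq_zero.1 h3).resolve_right (hw.indep_ab.ne_zero l))
    · simp only [hl, if_false] at h2 ⊢
      exact (smul_eq_zero.1 (h2.trans (by simp))).resolve_right (hw.indep_ab.ne_zero l')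
  choose x hx using hx
  let p : (Fin s → Fin s ⊕ Fin s) → Fin R → MvPolynomial (Fin s ⊕ Fin s) ℝ := fun f l =>
    ∑ k, MvPolynomial.X (f k) * MvPolynomial.C (ζ k l)
  have hp : ∀ f l xy, MvPolynomial.eval xy (p f l) = ∑ k, xy (f k) * ζ k l := by
    intro f l xy
    simp [p]
  have h1 : ∀ l, p Sum.inl l ≠ 0 := fun l h0 => by
    have := hp Sum.inl l (Sum.elim (x l) (x l))
    rw [h0, map_zero] at this
    simp [hx] at this
  have h2 : ∀ l, p Sum.inr l ≠ 0 := fun l h0 => by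
    have := hp Sum.inr l (Sum.elim (x l) (x l))
    rw [h0, map_zero] at this
    simp [hx] at this
  have h3 : ∀ l l', l ≠ l' → p Sum.inl l * p Sum.inr l' - p Sum.inl l' * p Sum.inr l ≠ 0 :=
    fun l l' hl h0 => by
      have := congrArg (MvPolynomial.eval (Sum.elim (x l) (x l'))) h0
      rw [map_sub, map_mul, map_mul, hp, hp, hp, hp, map_zero] at this
      simp [hx, hl] at this
  have hgen := ((Generically.forall fun l => generically_eval_ne_zero (h1 l)).and
    (Generically.forall fun l => generically_eval_ne_zero (h2 l))).and
    (Generically.forall fun q : {q : Fin R × Fin R // q.1 ≠ q.2} =>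
      generically_eval_ne_zero (h3 q.1.1 q.1.2 q.2))
  refine hgen.mono fun xy ⟨⟨hx, hy⟩, hxy⟩ => ?_
  simp only [map_sub, map_mul, hp] at hx hy hxy
  obtain ⟨e, σ, hσ⟩ := hout
  obtain ⟨A', B', lam, z, hrun⟩ := JLV.simDiagRun_of_diag hw.indep_ab hg hζ hx hy (by
    intro l l' hl
    by_contra hne
    refine hxy ⟨(l, l'), hne⟩ ?_
    have h1 := hy l
    have h2 := hy l'
    simp only at hl
    field_simp at hl
    linarith) e (fun i => (hσ i).1)
  refine ⟨A', B', lam, _, _, z, hrun, fun i => (hσ i).2.1.symm, fun i j k l => ?_⟩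
  rw [tensor_apply, ← e.sum_comp]
  refine Finset.sum_congr rfl fun ℓ _ => ?_
  have h1 : out.c ℓ k * out.d ℓ l = out.cd ℓ (k, l) := rfl
  have := (hσ ℓ).1
  rw [h1, (hσ ℓ).2.2]
  simp only [Pi.smul_apply, smul_eq_mul]
  field_simp

/-- Every successful run finds the given components. -/
theorem General.matches_of_isOutput (hw : w.General) {out : Components n₁ n₂ n₃ n₄ t}
    (h : JLV.IsOutput w.tensor out) : out.Matches w := by
  obtain ⟨s, P, x, y, ⟨-, hspan⟩, A', B', lam, u, v, z, hrun, hu, hT⟩ := h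
  rw [hw.liftSpace] at hspan
  obtain ⟨g, hg⟩ := exists_isDual hw.indep_ab
  obtain ⟨e, σ, hσ⟩ := JLV.simDiagRun_unique hw.indep_ab hg hspan hrun
  refine ⟨e, σ, fun i => ⟨(hσ i).1, ?_, ?_⟩⟩
  · rw [← (hσ i).2, hu]; rfl
  -- Pairing `T` with the vector dual to `a bᵀ` isolates the matrix `c dᵀ`.
  · have h1 : ∀ (q : Fin n₃ × Fin n₄) l, w.cd l q = σ (e.symm l) * out.cd (e.symm l) q := by
      intro q l
      have h2 : ∑ k, w.cd k q • w.ab k = ∑ i, (σ i * out.cd i q) • w.ab (e i) := by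
        ext p
        simp only [Finset.sum_apply, Pi.smul_apply, smul_eq_mul]
        have h3 := hT p.1 p.2 q.1 q.2
        rw [tensor_apply] at h3
        refine (Finset.sum_congr rfl fun k _ => mul_comm _ _).trans (h3.trans ?_)
        refine Finset.sum_congr rfl fun k _ => ?_
        rw [(hσ k).2]
        simp only [Pi.smul_apply, smul_eq_mul, cd, JLV.outer]
        ring
      have h3 := congrArg (fun r => g l ⬝ᵥ r) h2
      rw [← e.symm.sum_comp] at h3
      simpa [dotProduct_sum, dotProduct_smul, hg.dual] using h3
    ext q
    have h2 := h1 q (e i)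
    rw [Equiv.symm_apply_apply] at h2
    have h3 := (hσ i).1
    rw [Pi.smul_apply, h2, smul_eq_mul, ← mul_assoc, inv_mul_cancel₀ h3, one_mul]

/-- Everything that matches `w` is an output of the algorithm. -/
theorem General.isOutput (hw : w.General) {out : Components n₁ n₂ n₃ n₄ t}
    (hout : out.Matches w) : JLV.IsOutput w.tensor out := by
  have hP : JLV.IsLiftBasis w.tensor fun ℓ => vecMulVec (w.ab ℓ) (w.ab ℓ) :=
    ⟨linearIndependent_diag hw.indep_ab, hw.liftSpace.symm⟩
  obtain ⟨xy, h⟩ := (hw.generically_isRun hout hP).exists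
  exact ⟨R, _, _, _, hP, h⟩

end Components

/-! ### Semantics of the list operations -/

namespace RealMachine

/-- The list `e` enumerates the type `ι` without repetition. By means of `e`, a vector `v : ι → ℝ` is
represented by the list `e.map v`, and a matrix by the list `(e ×ˢ e).map v` of its entries. -/
structure IsEnum {ι : Type} (e : List ι) : Prop where
  nodup : e.Nodup
  complete : ∀ i, i ∈ e

theorem isEnum_finRange (n : ℕ) : IsEnum (List.finRange n) :=
  ⟨List.nodup_finRange n, List.mem_finRange⟩

theorem IsEnum.prod {ι κ : Type} {e : List ι} {f : List κ} (he : IsEnum e) (hf : IsEnum f) :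
    IsEnum (e ×ˢ f) :=
  ⟨he.nodup.product hf.nodup, fun p => List.mem_product.2 ⟨he.complete p.1, hf.complete p.2⟩⟩

theorem product_eq_flatMap {ι κ : Type} (e : List ι) (f : List κ) :
    e ×ˢ f = e.flatMap fun i => f.map fun j => (i, j) := rfl

/-- The standard basis vectors, as lists. -/
def basisList {ι : Type} [DecidableEq ι] (e : List ι) : List (List ℝ) :=
  e.map fun i => e.map (Pi.single i (1 : ℝ))

section Vectors

variable {ι κ : Type} {e : List ι} {f : List κ}

theorem IsEnum.sum_map [Fintype ι] (he : IsEnum e) (v : ι → ℝ) : (e.map v).sum = ∑ i, v i := by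
  classical
  rw [← List.sum_toFinset v he.nodup]
  congr 1
  ext i
  simp [he.complete i]

theorem IsEnum.length [Fintype ι] (he : IsEnum e) : e.length = Fintype.card ι := by
  classical
  rw [← List.toFinset_card_of_nodup he.nodup, ← Finset.card_univ]
  congr 1
  ext i
  simp [he.complete i]

theorem IsEnum.dot [Fintype ι] (he : IsEnum e) (v w : ι → ℝ) :
    dot (e.map v) (e.map w) = v ⬝ᵥ w := by
  rw [RealMachine.dot, List.zipWith_map, List.zipWith_self, he.sum_map]
  rfl

theorem kron_map (v : ι → ℝ) (w : κ → ℝ) :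
    kron (e.map v) (f.map w) = (e ×ˢ f).map fun p => v p.1 * w p.2 := by
  rw [product_eq_flatMap]
  simp [kron, List.flatMap_map, List.map_flatMap, Function.comp_def]

theorem subMul_map (c : ℝ) (v w : ι → ℝ) :
    subMul c (e.map v) (e.map w) = e.map (v - c • w) := by
  rw [subMul, List.zipWith_map, List.zipWith_self]
  rfl

variable [DecidableEq ι] [DecidableEq κ]

theorem kron_single (i : ι) (j : κ) :
    kron (e.map (Pi.single i 1)) (f.map (Pi.single j 1)) = (e ×ˢ f).map (Pi.single (i, j) 1) := by
  rw [kron_map]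
  congr 1
  funext p
  simp only [Pi.single_apply, Prod.ext_iff]
  by_cases h : p.1 = i <;> simp [h]

theorem tensorBasis_basisList : tensorBasis (basisList e) = basisList (e ×ˢ e) := by
  simp only [tensorBasis, basisList, List.flatMap_map, List.map_map, Function.comp_def,
    kron_single]
  conv_rhs => rw [product_eq_flatMap, List.map_flatMap]
  simp [Function.comp_def, product_eq_flatMap]

theorem stdBasis_eq {α : Type} {l : List α} (he : e.Nodup) (hl : l.length = e.length) :
    stdBasis l = basisList e := by
  have h1 : ∀ i j : ℕ, (if 0 < ((i : ℝ) - j) * (i - j) then (0 : ℝ) else 1) =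
      if i = j then 1 else 0 := by
    intro i j
    by_cases h : i = j
    · simp [h]
    · have : (i : ℝ) - j ≠ 0 := sub_ne_zero.2 (by exact_mod_cast h)
      simp [h, mul_self_pos, this]
  simp only [stdBasis, basisList, idx, List.map_map, Function.comp_def, h1, hl]
  apply List.ext_getElem
  · simp
  · intro i hi hi'
    apply List.ext_getElem
    · simp
    · intro j hj hj'
      simp only [List.getElem_map, List.getElem_range, Pi.single_apply]
      simp only [he.getElem_inj_iff, eq_comm]

end Vectors

/-! ### Elimination -/

section Elimination

variable {ι : Type}

/-- The span of a list of vectors. -/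
def spanL (l : List (ι → ℝ)) : Submodule ℝ (ι → ℝ) := Submodule.span ℝ {v | v ∈ l}

theorem spanL_nil : spanL ([] : List (ι → ℝ)) = ⊥ := by simp [spanL]

theorem spanL_cons (v : ι → ℝ) (l : List (ι → ℝ)) :
    spanL (v :: l) = Submodule.span ℝ {v} ⊔ spanL l := by
  rw [spanL, spanL, ← Submodule.span_union]
  congr 1
  ext u
  simp

theorem span_sup_span_sub (p v : ι → ℝ) (c : ℝ) :
    Submodule.span ℝ {p} ⊔ Submodule.span ℝ {v - c • p} =
      Submodule.span ℝ {p} ⊔ Submodule.span ℝ {v} := by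
  have hp : ∀ S : Submodule ℝ (ι → ℝ), c • p ∈ Submodule.span ℝ {p} ⊔ S := fun S =>
    Submodule.smul_mem _ _ (Submodule.mem_sup_left (Submodule.mem_span_singleton_self p))
  refine le_antisymm (sup_le le_sup_left ?_) (sup_le le_sup_left ?_)
  · rw [Submodule.span_singleton_le_iff_mem]
    exact Submodule.sub_mem _ (Submodule.mem_sup_right (Submodule.mem_span_singleton_self v))
      (hp _)
  · rw [Submodule.span_singleton_le_iff_mem]
    have := Submodule.add_mem _ (Submodule.mem_sup_right (S := Submodule.span ℝ {p})
      (Submodule.mem_span_singleton_self (R := ℝ) (v - c • p))) (hp (Submodule.span ℝ {v - c • p}))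
    simpa using this

variable [Fintype ι] {e : List ι}

theorem dotProduct_eq_zero_of_mem_spanL {r v : ι → ℝ} {l : List (ι → ℝ)}
    (h : ∀ u ∈ l, r ⬝ᵥ u = 0) (hv : v ∈ spanL l) : r ⬝ᵥ v = 0 := by
  unfold spanL at hv
  induction hv using Submodule.span_induction with
  | mem u hu => exact h u hu
  | zero => simp
  | add u u' _ _ ih ih' => rw [dotProduct_add, ih, ih', add_zero]
  | smul c u _ ih => rw [dotProduct_smul, ih, smul_zero]

/-- An elimination step intersects the span with a hyperplane. -/
theorem cut_map (he : IsEnum e) (r : ι → ℝ) (L : List (ι → ℝ)) :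
    ∃ L' : List (ι → ℝ), cut (L.map fun v => e.map v) (e.map r) = L'.map (fun v => e.map v) ∧
      L'.length ≤ L.length ∧ ∀ v, v ∈ spanL L' ↔ v ∈ spanL L ∧ r ⬝ᵥ v = 0 := by
  let step : List ℝ × List (List ℝ) → List ℝ → List ℝ × List (List ℝ) := fun c v =>
    if 0 < dot (e.map r) v * dot (e.map r) v then
      if c.1.isEmpty then (v, c.2)
      else (c.1, subMul (dot (e.map r) v / dot (e.map r) c.1) v c.1 :: c.2)
    else (c.1, v :: c.2)
  -- Behaviour of the remaining steps once the pivot `p` has been found.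
  have hpiv : ∀ (L : List (ι → ℝ)) (p : ι → ℝ) (out : List (ι → ℝ)), r ⬝ᵥ p ≠ 0 →
      (∀ v ∈ out, r ⬝ᵥ v = 0) → ∃ L' : List (ι → ℝ),
      ((L.map fun v => e.map v).foldl step (e.map p, out.map fun v => e.map v)).2 =
        L'.map (fun v => e.map v) ∧ L'.length ≤ out.length + L.length ∧
      ∀ v, v ∈ spanL L' ↔
        v ∈ Submodule.span ℝ {p} ⊔ spanL out ⊔ spanL L ∧ r ⬝ᵥ v = 0 := by
    intro L
    induction L with
    | nil =>
      intro p out hp hout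
      refine ⟨out, rfl, by simp, fun v => ?_⟩
      rw [spanL_nil, sup_bot_eq]
      constructor
      · exact fun hv => ⟨Submodule.mem_sup_right hv, dotProduct_eq_zero_of_mem_spanL hout hv⟩
      · rintro ⟨hv, h0⟩
        obtain ⟨y, hy, z, hz, rfl⟩ := Submodule.mem_sup.1 hv
        obtain ⟨a, rfl⟩ := Submodule.mem_span_singleton.1 hy
        rw [dotProduct_add, dotProduct_eq_zero_of_mem_spanL hout hz, add_zero, dotProduct_smul,
          smul_eq_mul] at h0
        rw [(mul_eq_zero.1 h0).resolve_right hp, zero_smul, zero_add]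
        exact hz
    | cons u L ih =>
      intro p out hp hout
      have hpe : (e.map p).isEmpty = false := by
        cases e with
        | nil =>
          refine absurd (Finset.sum_eq_zero fun i _ => ?_) hp
          simpa using he.complete i
        | cons i e => rfl
      by_cases hu : r ⬝ᵥ u = 0
      · obtain ⟨L', h1, h2, h3⟩ := ih p (u :: out) hp (by
          intro v hv
          rcases List.mem_cons.1 hv with rfl | hv
          · exact hu
          · exact hout v hv)
        refine ⟨L', ?_, ?_, fun v => ?_⟩
        · rw [← h1]
          simp [step, he.dot, hu]
        · simp at h2 ⊢; omega
        · rw [h3, spanL_cons, spanL_cons]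
          simp only [sup_assoc, sup_left_comm]
      · obtain ⟨L', h1, h2, h3⟩ := ih p ((u - (r ⬝ᵥ u / r ⬝ᵥ p) • p) :: out) hp (by
          intro v hv
          rcases List.mem_cons.1 hv with rfl | hv
          · rw [dotProduct_sub, dotProduct_smul, smul_eq_mul, div_mul_cancel₀ _ hp, sub_self]
          · exact hout v hv)
        refine ⟨L', ?_, ?_, fun v => ?_⟩
        · rw [← h1]
          simp only [List.map_cons, List.foldl_cons]
          congr 2
          simp only [step, he.dot, hpe, mul_self_pos, ne_eq, hu, not_false_eq_true, if_true,
            Bool.false_eq_true, if_false, subMul_map]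
        · simp at h2 ⊢; omega
        · rw [h3, spanL_cons, spanL_cons, ← sup_assoc, span_sup_span_sub]
          simp only [sup_assoc, sup_left_comm]
  have hstart : ∀ (L out : List (ι → ℝ)), (∀ v ∈ out, r ⬝ᵥ v = 0) → ∃ L' : List (ι → ℝ),
      ((L.map fun v => e.map v).foldl step ([], out.map fun v => e.map v)).2 =
        L'.map (fun v => e.map v) ∧ L'.length ≤ out.length + L.length ∧
      ∀ v, v ∈ spanL L' ↔ v ∈ spanL out ⊔ spanL L ∧ r ⬝ᵥ v = 0 := by
    intro L
    induction L with
    | nil =>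
      intro out hout
      refine ⟨out, rfl, by simp, fun v => ?_⟩
      rw [spanL_nil, sup_bot_eq]
      exact ⟨fun hv => ⟨hv, dotProduct_eq_zero_of_mem_spanL hout hv⟩, fun hv => hv.1⟩
    | cons u L ih =>
      intro out hout
      by_cases hu : r ⬝ᵥ u = 0
      · obtain ⟨L', h1, h2, h3⟩ := ih (u :: out) (by
          intro v hv
          rcases List.mem_cons.1 hv with rfl | hv
          · exact hu
          · exact hout v hv)
        refine ⟨L', ?_, ?_, fun v => ?_⟩
        · rw [← h1]
          simp [step, he.dot, hu]
        · simp at h2 ⊢; omega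
        · rw [h3, spanL_cons, spanL_cons]
          simp only [sup_assoc, sup_left_comm]
      · obtain ⟨L', h1, h2, h3⟩ := hpiv L u out hu hout
        refine ⟨L', ?_, ?_, fun v => ?_⟩
        · rw [← h1]
          simp only [List.map_cons, List.foldl_cons]
          congr 2
          simp only [step, he.dot, mul_self_pos, ne_eq, hu, not_false_eq_true, if_true,
            List.isEmpty_nil]
        · simp at h2 ⊢; omega
        · rw [h3, spanL_cons]
          simp only [sup_assoc, sup_left_comm]
  obtain ⟨L', h1, h2, h3⟩ := hstart L [] (by simp)
  refine ⟨L', h1, by simpa using h2, fun v => ?_⟩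
  rw [h3, spanL_nil, bot_sup_eq]

theorem ker_map (he : IsEnum e) (cons L : List (ι → ℝ)) :
    ∃ L' : List (ι → ℝ), ker (L.map fun v => e.map v) (cons.map fun v => e.map v) =
        L'.map (fun v => e.map v) ∧ L'.length ≤ L.length ∧
      ∀ v, v ∈ spanL L' ↔ v ∈ spanL L ∧ ∀ r ∈ cons, r ⬝ᵥ v = 0 := by
  induction cons generalizing L with
  | nil => exact ⟨L, rfl, le_rfl, fun v => by simp⟩
  | cons r cons ih =>
    obtain ⟨L₁, h1, h2, h3⟩ := cut_map he r L
    obtain ⟨L₂, h4, h5, h6⟩ := ih L₁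
    refine ⟨L₂, ?_, h5.trans h2, fun v => ?_⟩
    · rw [← h4, ← h1]; rfl
    · rw [h6, h3]
      simp [and_assoc]

/-- The list `l` of constraints, read as vectors indexed by `ι`, defines the set `S`. -/
def IsConstraints (e : List ι) (l : List (List ℝ)) (S : (ι → ℝ) → Prop) : Prop :=
  ∃ cons : List (ι → ℝ), l = cons.map (fun v => e.map v) ∧
    ∀ v, (∀ r ∈ cons, r ⬝ᵥ v = 0) ↔ S v

theorem IsConstraints.append {l l' : List (List ℝ)} {S S' : (ι → ℝ) → Prop}
    (h : IsConstraints e l S) (h' : IsConstraints e l' S') :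
    IsConstraints e (l ++ l') fun v => S v ∧ S' v := by
  obtain ⟨c, rfl, h⟩ := h
  obtain ⟨c', rfl, h'⟩ := h'
  refine ⟨c ++ c', by simp, fun v => ?_⟩
  simp only [← h, ← h', List.forall_mem_append]

theorem IsConstraints.map {α : Type} {l : List α} {f : α → List ℝ} {r : α → ι → ℝ}
    (h : ∀ a, f a = e.map (r a)) : IsConstraints e (l.map f) fun v => ∀ a ∈ l, r a ⬝ᵥ v = 0 :=
  ⟨l.map r, by simp [Function.comp_def, h], fun v => by simp⟩

theorem IsConstraints.flatMap {α : Type} {l : List α} {f : α → List (List ℝ)}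
    {S : α → (ι → ℝ) → Prop} (h : ∀ a ∈ l, IsConstraints e (f a) (S a)) :
    IsConstraints e (l.flatMap f) fun v => ∀ a ∈ l, S a v := by
  induction l with
  | nil => exact ⟨[], rfl, by simp⟩
  | cons a l ih =>
    obtain ⟨c, h1, h2⟩ := (h a (by simp)).append (ih fun b hb => h b (by simp [hb]))
    refine ⟨c, by rw [← h1]; rfl, fun v => ?_⟩
    refine (h2 v).trans ?_
    simp

theorem IsConstraints.congr {l : List (List ℝ)} {S S' : (ι → ℝ) → Prop}
    (h : IsConstraints e l S) (hS : ∀ v, S v ↔ S' v) : IsConstraints e l S' := by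
  obtain ⟨c, h1, h2⟩ := h
  exact ⟨c, h1, fun v => (h2 v).trans (hS v)⟩

variable [DecidableEq ι]

theorem ker_basisList (he : IsEnum e) {l : List (List ℝ)} {S : (ι → ℝ) → Prop}
    (h : IsConstraints e l S) :
    ∃ L : List (ι → ℝ), ker (basisList e) l = L.map (fun v => e.map v) ∧
      L.length ≤ e.length ∧ ∀ v, v ∈ spanL L ↔ S v := by
  obtain ⟨cons, rfl, h⟩ := h
  obtain ⟨L, h1, h2, h3⟩ := ker_map he cons (e.map fun i => Pi.single i 1)
  refine ⟨L, ?_, by simpa using h2, fun v => ?_⟩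
  · rw [← h1, List.map_map]; rfl
  · rw [h3, h]
    refine and_iff_right ?_
    have hv : v = ∑ i, v i • (Pi.single i (1 : ℝ) : ι → ℝ) := by
      ext j
      simp [Pi.single_apply]
    rw [hv]
    exact Submodule.sum_mem _ fun i _ => Submodule.smul_mem _ _ (Submodule.subset_span
      (List.mem_map.2 ⟨i, he.complete i, rfl⟩))

omit [DecidableEq ι] in
theorem pick_map (he : IsEnum e) (L : List (ι → ℝ)) :
    (∃ v ∈ L, v ≠ 0 ∧ pick (L.map fun v => e.map v) = e.map v) ∨
      ((∀ v ∈ L, v = 0) ∧ dot (pick (L.map fun v => e.map v)) (pick (L.map fun v => e.map v)) = 0)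
      := by
  have hpos : ∀ v : ι → ℝ, 0 < dot (e.map v) (e.map v) ↔ v ≠ 0 := by
    intro v
    rw [he.dot]
    exact ⟨fun h h0 => by simp [h0] at h, fun h => lt_of_le_of_ne
      (Finset.sum_nonneg fun i _ => mul_self_nonneg _) fun h0 =>
        h (dotProduct_self_eq_zero.1 h0.symm)⟩
  induction L using List.reverseRecOn with
  | nil => exact Or.inr ⟨by simp, by simp [pick, dot]⟩
  | append_singleton L u ih =>
    have hstep : pick ((L ++ [u]).map fun v => e.map v) =
        if 0 < dot (pick (L.map fun v => e.map v)) (pick (L.map fun v => e.map v)) then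
          pick (L.map fun v => e.map v) else e.map u := by
      rw [pick, List.map_append, List.foldl_append]
      rfl
    rw [hstep]
    rcases ih with ⟨v, hv, hv0, h⟩ | ⟨h0, h⟩
    · left
      refine ⟨v, by simp [hv], hv0, ?_⟩
      rw [h, if_pos ((hpos v).2 hv0)]
    · rw [h, if_neg (lt_irrefl 0)]
      by_cases hu : u = 0
      · right
        refine ⟨fun v hv => ?_, ?_⟩
        · rcases List.mem_append.1 hv with hv | hv
          · exact h0 v hv
          · rw [List.mem_singleton.1 hv, hu]
        · rw [he.dot, hu, zero_dotProduct]
      · exact Or.inl ⟨u, by simp, hu, rfl⟩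

/-- Solving a system of linear equations and picking a nonzero solution. -/
theorem pick_ker (he : IsEnum e) {l : List (List ℝ)} {S : (ι → ℝ) → Prop}
    (h : IsConstraints e l S) :
    (∃ v, S v ∧ v ≠ 0 ∧ pick (ker (basisList e) l) = e.map v) ∨
      ((∀ v, S v → v = 0) ∧ dot (pick (ker (basisList e) l)) (pick (ker (basisList e) l)) = 0) := by
  obtain ⟨L, h1, -, h2⟩ := ker_basisList he h
  rw [h1]
  rcases pick_map he L with ⟨v, hv, hv0, h3⟩ | ⟨h0, h3⟩
  · exact Or.inl ⟨v, (h2 v).1 (Submodule.subset_span hv), hv0, h3⟩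
  · refine Or.inr ⟨fun v hv => ?_, h3⟩
    have hbot : spanL L = ⊥ := Submodule.span_eq_bot.2 h0
    rw [← h2, hbot, Submodule.mem_bot] at hv
    exact hv

end Elimination

end RealMachine

/-! ### Matrices as lists, eigenvalues and eigenvectors -/

namespace RealMachine

section PolyOfList

theorem polyOfList_coeff (l : List ℝ) (k : ℕ) : (polyOfList l).coeff k = l.getD k 0 := by
  induction l generalizing k with
  | nil => simp [polyOfList]
  | cons c l ih =>
    cases k with
    | zero => simp [polyOfList]
    | succ k => simp [polyOfList, ih]

theorem polyOfList_finRange {n : ℕ} (c : Fin n → ℝ) :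
    polyOfList ((List.finRange n).map c) = ∑ k, Polynomial.C (c k) * Polynomial.X ^ (k : ℕ) := by
  induction n with
  | zero => simp [polyOfList]
  | succ n ih =>
    rw [List.finRange_succ, List.map_cons, List.map_map, polyOfList, Fin.sum_univ_succ]
    have := ih (c ∘ Fin.succ)
    rw [this, Finset.mul_sum]
    simp only [Function.comp_apply, Fin.val_zero, pow_zero, mul_one, Fin.val_succ, pow_succ]
    congr 1
    exact Finset.sum_congr rfl fun k _ => by ring

theorem mem_realRoots {p : Polynomial ℝ} (hp : p ≠ 0) (x : ℝ) :
    x ∈ realRoots p ↔ p.eval x = 0 := by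
  simp [realRoots, hp]

theorem nodup_realRoots (p : Polynomial ℝ) : (realRoots p).Nodup := Finset.sort_nodup _ _

/-- Horner's scheme. -/
theorem eval_polyOfList_reverse (l : List ℝ) (θ : ℝ) :
    (polyOfList l.reverse).eval θ = l.foldl (fun c x => θ * c + x) 0 := by
  induction l using List.reverseRecOn with
  | nil => simp [polyOfList]
  | append_singleton l x ih =>
    simp [polyOfList, ih]
    ring

end PolyOfList

variable {ι : Type} {e : List ι}

/-- A square matrix as the list of its entries. -/
def mlist (e : List ι) (X : Matrix ι ι ℝ) : List ℝ := (e ×ˢ e).map fun p => X p.1 p.2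

theorem mlist_eq (X : Matrix ι ι ℝ) : mlist e X = e.flatMap fun i => e.map (X i) := by
  rw [mlist, product_eq_flatMap, List.map_flatMap]
  simp [Function.comp_def]

variable [DecidableEq ι]

theorem flatten_basisList : (basisList e).flatten = mlist e 1 := by
  have h : ∀ i, (Pi.single i 1 : ι → ℝ) = (1 : Matrix ι ι ℝ) i := fun i => by
    ext j
    simp [Matrix.one_apply, Pi.single_apply, eq_comm]
  simp only [mlist_eq, ← h, List.flatMap_def, basisList]

theorem horner_map (L : List (ι × ι → ℝ)) (θ : ℝ) :
    horner (basisList e) θ (L.map fun v => (e ×ˢ e).map v) =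
      (e ×ˢ e).map (L.foldl (fun c v => θ • c + v) 0) := by
  have h0 : ((basisList e).flatMap fun _ => (basisList e).map fun _ => (0 : ℝ)) =
      (e ×ˢ e).map (0 : ι × ι → ℝ) := by
    rw [product_eq_flatMap, List.map_flatMap]
    simp [basisList, List.flatMap_map, Function.comp_def]
  rw [horner, h0]
  generalize (0 : ι × ι → ℝ) = z
  induction L generalizing z with
  | nil => rfl
  | cons v L ih =>
    rw [List.map_cons, List.foldl_cons, List.foldl_cons, ← ih, List.zipWith_map, List.zipWith_self]
    rfl

variable [Fintype ι]

omit [DecidableEq ι] in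
theorem dot_mlist_kron (he : IsEnum e) (X : Matrix ι ι ℝ) (u v : ι → ℝ) :
    dot (mlist e X) (kron (e.map u) (e.map v)) = u ⬝ᵥ (X *ᵥ v) := by
  rw [kron_map, mlist, (he.prod he).dot, dotProduct, Fintype.sum_prod_type]
  refine Finset.sum_congr rfl fun p _ => ?_
  rw [mulVec, dotProduct, Finset.mul_sum]
  exact Finset.sum_congr rfl fun q _ => by ring

theorem dot_mlist_single (he : IsEnum e) (X : Matrix ι ι ℝ) (p q : ι) :
    dot (mlist e X) (kron (e.map (Pi.single p 1)) (e.map (Pi.single q 1))) = X p q := by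
  rw [dot_mlist_kron he]
  simp

theorem mulM_mlist (he : IsEnum e) (X Y : Matrix ι ι ℝ) :
    mulM (basisList e) (mlist e X) (mlist e Y) = mlist e (X * Y) := by
  rw [mulM]
  simp only [basisList, List.flatMap_map, List.map_map, Function.comp_def]
  simp only [dot_mlist_kron he]
  rw [mlist_eq]
  simp only [single_one_dotProduct, mulVec_single_one]
  rfl

theorem transp_mlist (he : IsEnum e) (X : Matrix ι ι ℝ) :
    transp (basisList e) (mlist e X) = mlist e Xᵀ := by
  rw [transp]
  simp only [basisList, List.flatMap_map, List.map_map, Function.comp_def, dot_mlist_single he]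
  rw [mlist_eq]
  rfl

theorem powers_mlist (he : IsEnum e) (X : Matrix ι ι ℝ) :
    (powers (basisList e) (mlist e X)).reverse =
      (List.finRange (e.length + 1)).map fun k : Fin _ => mlist e (X ^ (k : ℕ)) := by
  have h : ∀ l : List (List ℝ), l.foldl
      (fun c _ => mulM (basisList e) (mlist e X) (c.headD []) :: c) [(basisList e).flatten] =
        ((List.range (l.length + 1)).map fun k => mlist e (X ^ k)).reverse := by
    intro l
    induction l using List.reverseRecOn with
    | nil => simp [flatten_basisList]
    | append_singleton l x ih =>
      rw [List.foldl_append, ih, List.length_append, List.length_singleton,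
        List.range_succ (n := l.length + 1), List.range_succ]
      simp [mulM_mlist he, pow_succ']
  rw [powers, h, List.reverse_reverse]
  have : (basisList e).length = e.length := by simp [basisList]
  rw [this]
  apply List.ext_getElem <;> simp

/-- The list `annih` consists of the coefficients of a nonzero polynomial annihilating the
matrix; the Cayley-Hamilton theorem shows that there is one of degree at most the size of the
matrix. -/
theorem annih_mlist (he : IsEnum e) (X : Matrix ι ι ℝ) :
    polyOfList (annih (basisList e) (mlist e X)) ≠ 0 ∧
      Polynomial.aeval X (polyOfList (annih (basisList e) (mlist e X))) = 0 := by
  set n := e.length + 1 with hn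
  have hstd : stdBasis (powers (basisList e) (mlist e X)) = basisList (List.finRange n) := by
    refine stdBasis_eq (List.nodup_finRange n) ?_
    rw [← List.length_reverse, powers_mlist he]
    simp [hn]
  have hcons : IsConstraints (List.finRange n) ((tensorBasis (basisList e)).map fun z =>
      (powers (basisList e) (mlist e X)).reverse.map fun y => dot y z)
      fun c => ∑ k, c k • X ^ (k : ℕ) = 0 := by
    rw [tensorBasis_basisList, powers_mlist he]
    simp only [basisList, List.map_map, Function.comp_def]
    refine (IsConstraints.map (r := fun (p : ι × ι) (k : Fin n) => (X ^ (k : ℕ)) p.1 p.2) fun p => ?_).congr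
      fun c => ?_
    · refine List.map_congr_left fun k _ => ?_
      rw [mlist, (he.prod he).dot]
      simp
    · constructor
      · intro h
        ext p q
        have := h (p, q) ((he.prod he).complete _)
        simp only [dotProduct] at this
        simp only [Matrix.sum_apply, Matrix.smul_apply, smul_eq_mul, Matrix.zero_apply]
        rw [← this]
        exact Finset.sum_congr rfl fun k _ => mul_comm _ _
      · intro h p _
        have := congrFun (congrFun h p.1) p.2
        simp only [Matrix.sum_apply, Matrix.smul_apply, smul_eq_mul, Matrix.zero_apply] at this
        rw [← this, dotProduct]
        exact Finset.sum_congr rfl fun k _ => mul_comm _ _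
  have hsum : ∀ c : Fin n → ℝ, Polynomial.aeval X (polyOfList ((List.finRange n).map c)) =
      ∑ k, c k • X ^ (k : ℕ) := by
    intro c
    rw [polyOfList_finRange]
    simp [map_sum, Algebra.smul_def]
  rw [annih, hstd]
  rcases pick_ker (isEnum_finRange n) hcons with ⟨c, hc, hc0, h⟩ | ⟨h, -⟩
  · rw [h, hsum]
    refine ⟨fun h0 => hc0 (funext fun k => ?_), hc⟩
    have := polyOfList_coeff ((List.finRange n).map c) k
    rw [h0, Polynomial.coeff_zero] at this
    rw [Pi.zero_apply, this]
    simp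
  · exfalso
    have hdeg : X.charpoly.natDegree = e.length := by
      rw [Matrix.charpoly_natDegree_eq_dim, he.length]
    have h1 := h (fun k => X.charpoly.coeff k) (by
      have := Matrix.aeval_self_charpoly X
      rw [Polynomial.aeval_eq_sum_range, hdeg] at this
      rw [← this, Finset.sum_range])
    have h2 := congrFun h1 (Fin.last _)
    simp only [Fin.val_last, Pi.zero_apply] at h2
    have h3 := Matrix.charpoly_monic X
    rw [Polynomial.Monic, Polynomial.leadingCoeff, hdeg, h2] at h3
    exact zero_ne_one h3

theorem eigvec_mlist (he : IsEnum e) (X : Matrix ι ι ℝ) (μ : ℝ) :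
    (∃ u, X *ᵥ u = μ • u ∧ u ≠ 0 ∧ eigvec (basisList e) (mlist e X) μ = e.map u) ∨
      ((∀ u, X *ᵥ u = μ • u → u = 0) ∧
        dot (eigvec (basisList e) (mlist e X) μ) (eigvec (basisList e) (mlist e X) μ) = 0) := by
  refine pick_ker he (l := (basisList e).map fun x => (basisList e).map fun y =>
    dot (mlist e X) (kron x y) - μ * dot x y) (S := fun u => X *ᵥ u = μ • u) ?_
  simp only [basisList, List.map_map, Function.comp_def, dot_mlist_single he, he.dot]
  refine (IsConstraints.map (e := e) (r := fun p q => X p q - μ * (Pi.single p 1 ⬝ᵥ Pi.single q 1))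
    fun p => rfl).congr fun u => ?_
  have h : ∀ p, (fun q => X p q - μ * (Pi.single p 1 ⬝ᵥ Pi.single q 1)) ⬝ᵥ u =
      (X *ᵥ u) p - μ * u p := by
    intro p
    simp [dotProduct, mulVec, sub_mul, Finset.sum_sub_distrib, Pi.single_apply]
  simp only [h, sub_eq_zero]
  exact ⟨fun h => funext fun p => h p (he.complete p), fun h p _ => congrFun h p⟩

/-- For a matrix `∑ k, μ_k w_k g_kᵀ` the list `eigenpairs` runs over the distinct nonzero values
`μ_k`. -/
theorem eigenpairs_diagComb {κ : Type} [Fintype κ] [DecidableEq κ] (he : IsEnum e)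
    {w g : κ → ι → ℝ} (h : ∀ k l, g k ⬝ᵥ w l = if k = l then 1 else 0) (hw : ∀ k, w k ≠ 0)
    (μ : κ → ℝ) : ∃ S : List ℝ, S.Nodup ∧ (∀ c, c ∈ S ↔ c ≠ 0 ∧ ∃ k, c = μ k) ∧
      eigenpairs (basisList e) (mlist e (diagComb w g μ)) = S.map fun c =>
        (eigvec (basisList e) (mlist e (diagComb w g μ)) c,
          eigvec (basisList e) (mlist e (diagComb g w μ)) c) := by
  set X := diagComb w g μ with hX
  obtain ⟨hp, hpX⟩ := annih_mlist he X
  have ht : transp (basisList e) (mlist e X) = mlist e (diagComb g w μ) := by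
    rw [transp_mlist he, hX, diagComb_transpose]
  refine ⟨(realRoots (polyOfList (annih (basisList e) (mlist e X)))).filter fun c =>
    0 < c * c * dot (eigvec (basisList e) (mlist e X) c) (eigvec (basisList e) (mlist e X) c),
    (nodup_realRoots _).filter _, fun c => ?_, ?_⟩
  rotate_left
  · rw [eigenpairs, ht]
  have hpos : 0 < c * c * dot (eigvec (basisList e) (mlist e X) c)
      (eigvec (basisList e) (mlist e X) c) ↔ c ≠ 0 ∧ ∃ u, X *ᵥ u = c • u ∧ u ≠ 0 := by
    rcases eigvec_mlist he X c with ⟨u, h1, h2, h3⟩ | ⟨h1, h2⟩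
    · have h4 : 0 < u ⬝ᵥ u := lt_of_le_of_ne (Finset.sum_nonneg fun i _ => mul_self_nonneg _)
        fun h0 => h2 (dotProduct_self_eq_zero.1 h0.symm)
      rw [h3, he.dot]
      refine ⟨fun h0 => ⟨fun hc => by simp [hc] at h0, u, h1, h2⟩, fun h0 => ?_⟩
      exact mul_pos (mul_self_pos.2 h0.1) h4
    · rw [h2, mul_zero]
      exact ⟨fun h0 => absurd h0 (lt_irrefl _), fun ⟨_, u, h3, h4⟩ => absurd (h1 u h3) h4⟩
  rw [List.mem_filter, decide_eq_true_eq, hpos, mem_realRoots hp]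
  constructor
  · rintro ⟨-, hc, u, h1, h2⟩
    exact ⟨hc, (eigenvector_diagComb h hc h2 h1).1⟩
  · rintro ⟨hc, k, rfl⟩
    have h1 : X *ᵥ w k = μ k • w k := dual_mulVec h w μ k
    refine ⟨?_, hc, w k, h1, hw k⟩
    have h2 := Module.End.aeval_apply_of_hasEigenvector (f := Matrix.toLin' X) (μ := μ k)
      (x := w k) (p := polyOfList (annih (basisList e) (mlist e X)))
      (Module.End.hasEigenvector_iff.2
        ⟨Module.End.mem_eigenspace_iff.2 (by simpa using h1), hw k⟩)
    have h3 : Polynomial.aeval (Matrix.toLin' X) (polyOfList (annih (basisList e) (mlist e X))) =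
        0 := by
      have := Polynomial.aeval_algHom_apply (Matrix.toLinAlgEquiv' (R := ℝ) (n := ι)) X
        (polyOfList (annih (basisList e) (mlist e X)))
      rw [hpX, map_zero] at this
      exact this
    rw [h3, LinearMap.zero_apply] at h2
    exact (smul_eq_zero.1 h2.symm).resolve_right (hw k)

end RealMachine

/-! ### The linear systems solved by the program -/

namespace RealMachine

section Systems

variable {ι κ : Type} [Fintype ι] [Fintype κ] [DecidableEq κ]

/-- The matrix with entries `v (p, q)`. -/
def toMat (v : ι × ι → ℝ) : Matrix ι ι ℝ := Matrix.of fun p q => v (p, q)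

omit [Fintype ι] in
theorem map_eq_mlist (e : List ι) (v : ι × ι → ℝ) : (e ×ˢ e).map v = mlist e (toMat v) := rfl

/-- A matrix that vanishes on the orthogonal complement of the span of the `w_ℓ` factors through
the orthogonal projection onto this span. -/
theorem mulVec_eq_of_null {w g : κ → ι → ℝ} (hg : IsDual w g) {X : Matrix ι ι ℝ}
    (h0 : ∀ η, (∀ l, w l ⬝ᵥ η = 0) → X *ᵥ η = 0) (r : ι → ℝ) :
    X *ᵥ r = X *ᵥ (diagComb g w 1 *ᵥ r) := by
  rw [← sub_eq_zero, ← mulVec_sub]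
  refine h0 _ fun l => ?_
  rw [dotProduct_sub, diagComb_mulVec, dotProduct_sum]
  simp [dotProduct_smul, hg.dual']

theorem mulVec_dual_expansion {w g : κ → ι → ℝ} (hg : IsDual w g) {X : Matrix ι ι ℝ}
    (hX : ∀ p q, X p q = X q p) (h0 : ∀ η, (∀ l, w l ⬝ᵥ η = 0) → X *ᵥ η = 0) (p q : ι) :
    X p q = ∑ k, ∑ l, (g k ⬝ᵥ (X *ᵥ g l)) * (w k p * w l q) := by
  classical
  have h1 : X = X * diagComb g w 1 := by
    refine Matrix.ext_of_mulVec_single fun i => ?_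
    rw [← mulVec_mulVec]
    exact mulVec_eq_of_null hg h0 _
  have hXt : Xᵀ = X := by ext i j; exact hX j i
  have h2 : X = diagComb w g 1 * X := by
    have := congrArg Matrix.transpose h1
    rwa [transpose_mul, hXt, diagComb_transpose] at this
  have h3 : X p q = ∑ l, (X *ᵥ g l) p * w l q := by
    conv_lhs => rw [h1]
    simp only [mul_apply, diagComb_apply, Pi.one_apply, one_mul, Finset.mul_sum, mulVec,
      dotProduct, Finset.sum_mul]
    rw [Finset.sum_comm]
    exact Finset.sum_congr rfl fun l _ => Finset.sum_congr rfl fun i _ => by ring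
  rw [h3, Finset.sum_comm]
  refine Finset.sum_congr rfl fun l _ => ?_
  have h4 : X *ᵥ g l = diagComb w g 1 *ᵥ (X *ᵥ g l) := by
    conv_lhs => rw [h2, ← mulVec_mulVec]
  have h5 : (X *ᵥ g l) p = ∑ k, (g k ⬝ᵥ (X *ᵥ g l)) * w k p :=
    (congrFun h4 p).trans (by rw [diagComb_mulVec]; simp)
  rw [h5, Finset.sum_mul]
  exact Finset.sum_congr rfl fun k _ => by ring

variable [DecidableEq ι] {e : List ι}

theorem isConstraints_nullCons (he : IsEnum e) (N : List (ι → ℝ)) :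
    IsConstraints (e ×ˢ e) (nullCons (basisList e) (N.map fun v => e.map v))
      fun v => ∀ η ∈ spanL N, toMat v *ᵥ η = 0 := by
  unfold nullCons
  simp only [basisList, List.flatMap_map, List.map_map, Function.comp_def]
  refine (IsConstraints.flatMap fun p _ => IsConstraints.map
    (r := fun (η : ι → ℝ) (x : ι × ι) => (Pi.single p (1 : ℝ) : ι → ℝ) x.1 * η x.2) fun η => kron_map _ _).congr
    fun v => ?_
  have h : ∀ (p : ι) (η : ι → ℝ), (fun x : ι × ι => (Pi.single p (1 : ℝ) : ι → ℝ) x.1 * η x.2) ⬝ᵥ v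
      = (toMat v *ᵥ η) p := by
    intro p η
    simp [dotProduct, Fintype.sum_prod_type, Pi.single_apply, mulVec, toMat, mul_comm]
  simp only [h]
  constructor
  · intro hv η hη
    unfold spanL at hη
    induction hη using Submodule.span_induction with
    | mem η hη => exact funext fun p => hv p (he.complete p) η hη
    | zero => exact mulVec_zero _
    | add u u' _ _ ih ih' => rw [mulVec_add, ih, ih', add_zero]
    | smul c u _ ih => rw [mulVec_smul, ih, smul_zero]
  · intro hv p _ η hη
    exact congrFun (hv η (Submodule.subset_span hη)) p

theorem isConstraints_symCons (he : IsEnum e) :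
    IsConstraints (e ×ˢ e) (symCons (basisList e)) fun v => ∀ p q, toMat v p q = toMat v q p := by
  unfold symCons
  simp only [basisList, List.flatMap_map, List.map_map, Function.comp_def, kron_single]
  refine (IsConstraints.flatMap fun p _ => IsConstraints.map
    (r := fun q => (Pi.single (p, q) (1 : ℝ) : ι × ι → ℝ) - (1 : ℝ) • Pi.single (q, p) (1 : ℝ))
    fun q => subMul_map _ _ _).congr fun v => ?_
  simp only [one_smul, sub_dotProduct, single_one_dotProduct, sub_eq_zero]
  exact ⟨fun h p q => h p (he.complete p) q (he.complete q), fun h p _ q _ => h p q⟩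

theorem isConstraints_minorCons {m n : Type} [Fintype m] [Fintype n] [DecidableEq m]
    [DecidableEq n] {e₁ : List m} {e₂ : List n} (h₁ : IsEnum e₁) (h₂ : IsEnum e₂) :
    IsConstraints ((e₁ ×ˢ e₂) ×ˢ (e₁ ×ˢ e₂)) (minorCons (basisList e₁) (basisList e₂))
      fun v => ∀ i i' j j', toMat v (i, j) (i', j') = toMat v (i', j) (i, j') := by
  unfold minorCons
  simp only [basisList, List.flatMap_map, List.map_map, Function.comp_def, kron_single]
  refine (IsConstraints.flatMap fun i _ => IsConstraints.flatMap fun i' _ =>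
    IsConstraints.flatMap fun j _ => IsConstraints.map
    (r := fun j' => (Pi.single ((i, j), (i', j')) (1 : ℝ) : (m × n) × (m × n) → ℝ) -
      (1 : ℝ) • Pi.single ((i', j), (i, j')) (1 : ℝ))
    fun q => subMul_map _ _ _).congr fun v => ?_
  simp only [one_smul, sub_dotProduct, single_one_dotProduct, sub_eq_zero]
  exact ⟨fun h i i' j j' => h i (h₁.complete i) i' (h₁.complete i') j (h₂.complete j) j'
    (h₂.complete j'), fun h i _ i' _ j _ j' _ => h i i' j j'⟩

/-- The matrices `X` with `X P` in the span of the `w_ℓ w_ℓᵀ` for all `P` in this span, and with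
`X = 0` on the orthogonal complement, are those diagonalized by the `w_ℓ`. -/
theorem isConstraints_algCons {w g : κ → ι → ℝ} (hg : IsDual w g) (he : IsEnum e)
    {N : List (ι → ℝ)} (hN : ∀ η, η ∈ spanL N ↔ ∀ l, w l ⬝ᵥ η = 0) {cons : List (List ℝ)}
    (hcons : IsConstraints (e ×ˢ e) cons fun v => ∃ d, toMat v = diagComb w w d)
    {L : List (ι × ι → ℝ)} (hL : ∀ v, v ∈ spanL L ↔ ∃ d, toMat v = diagComb w w d) :
    IsConstraints (e ×ˢ e) (algCons (basisList e) (N.map fun v => e.map v) cons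
      (L.map fun v => (e ×ˢ e).map v)) fun v => ∃ ξ, toMat v = diagComb w g ξ := by
  obtain ⟨C, rfl, hC⟩ := hcons
  unfold algCons
  simp only [List.flatMap_map, List.map_map, Function.comp_def, map_eq_mlist, mulM_mlist he]
  refine ((isConstraints_nullCons he N).append (IsConstraints.flatMap fun P _ =>
    IsConstraints.map (r := fun (c : ι × ι → ℝ) (x : ι × ι) => (toMat c * toMat P) x.1 x.2) fun c => rfl)).congr
    fun v => ?_
  -- As `P` is symmetric, `⟨c, X P⟩ = ⟨c P, X⟩`, so `mulM c P` is the constraint imposed on `X`.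
  have hswap : ∀ P ∈ L, ∀ c : ι × ι → ℝ, (fun x : ι × ι => (toMat c * toMat P) x.1 x.2) ⬝ᵥ v =
      c ⬝ᵥ fun x => (toMat v * toMat P) x.1 x.2 := by
    intro P hP c
    obtain ⟨d, hd⟩ := (hL P).1 (Submodule.subset_span hP)
    have hs : ∀ p q, toMat P p q = toMat P q p := by
      rw [hd]; exact Components.diagComb_self_symm w d
    simp only [dotProduct, Fintype.sum_prod_type, mul_apply, Finset.sum_mul, Finset.mul_sum]
    refine Finset.sum_congr rfl fun p _ => ?_
    rw [Finset.sum_comm]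
    refine Finset.sum_congr rfl fun q _ => Finset.sum_congr rfl fun r _ => ?_
    rw [hs r q]
    simp only [toMat, of_apply]
    ring
  have hcond : (∀ P ∈ L, ∀ c ∈ C, (fun x : ι × ι => (toMat c * toMat P) x.1 x.2) ⬝ᵥ v = 0) ↔
      ∀ P ∈ L, ∃ d, toMat v * toMat P = diagComb w w d := by
    refine forall₂_congr fun P hP => ?_
    simp only [hswap P hP]
    exact hC _
  rw [hcond]
  constructor
  · rintro ⟨h0, h1⟩
    have h2 : ∀ P ∈ spanL L, ∃ d, toMat v * toMat P = diagComb w w d := by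
      intro P hP
      unfold spanL at hP
      simp only [← mem_span_diag_iff] at h1 ⊢
      induction hP using Submodule.span_induction with
      | mem P hP => exact h1 P hP
      | zero =>
        have : toMat (0 : ι × ι → ℝ) = 0 := rfl
        rw [this, mul_zero]
        exact Submodule.zero_mem _
      | add P Q _ _ ih ih' =>
        have : toMat (P + Q) = toMat P + toMat Q := rfl
        rw [this, mul_add]
        exact Submodule.add_mem _ ih ih'
      | smul c P _ ih =>
        have : toMat (c • P) = c • toMat P := rfl
        rw [this, Matrix.mul_smul]
        exact Submodule.smul_mem _ _ ih
    have h3 : ∀ l, ∃ c : ℝ, toMat v *ᵥ w l = c • w l := by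
      intro l
      obtain ⟨d, hd⟩ := h2 (fun x => diagComb w w (Pi.single l 1) x.1 x.2)
        ((hL _).2 ⟨Pi.single l 1, rfl⟩)
      have h4 := congrArg (fun M => M *ᵥ g l) hd
      have h5 : toMat (fun x : ι × ι => diagComb w w (Pi.single l 1) x.1 x.2) =
        diagComb w w (Pi.single l 1) := rfl
      simp only [h5, ← mulVec_mulVec, dual_mulVec hg.dual', Pi.single_eq_same, one_smul] at h4
      exact ⟨_, h4⟩
    choose ξ hξ using h3
    refine ⟨ξ, Matrix.ext_of_mulVec_single fun i => ?_⟩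
    rw [mulVec_eq_of_null hg fun η hη => h0 η ((hN η).2 hη), ← hg.symm, diagComb_mulVec,
      diagComb_mulVec, mulVec_sum]
    refine Finset.sum_congr rfl fun k _ => ?_
    rw [mulVec_smul, hξ, smul_smul]
    congr 1
    simp [mul_comm]
  · rintro ⟨ξ, hξ⟩
    refine ⟨fun η hη => ?_, fun P hP => ?_⟩
    · have h1 : ∀ k, g k ⬝ᵥ η = 0 := by
        intro k
        obtain ⟨c, hc⟩ := (Submodule.mem_span_range_iff_exists_fun ℝ).1 (hg.mem k)
        rw [← hc, sum_dotProduct]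
        exact Finset.sum_eq_zero fun l _ => by
          rw [smul_dotProduct, (hN η).1 hη l, smul_zero]
      rw [hξ, diagComb_mulVec]
      simp [h1]
    · obtain ⟨d, hd⟩ := (hL P).1 (Submodule.subset_span hP)
      exact ⟨ξ * d, by rw [hξ, hd, diagComb_mul _ _ hg.dual]⟩

end Systems

/-! ### The search for a separating combination -/

section Search

theorem foldl_longest {β γ : Type} (f : β → List γ) (l : List β) :
    let c := l.foldl (fun c x => if 0 < ((f x).length : ℝ) - (c.length : ℝ) then f x else c) []
    (c = [] ∨ ∃ x ∈ l, c = f x) ∧ ∀ x ∈ l, (f x).length ≤ c.length := by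
  induction l using List.reverseRecOn with
  | nil => simp
  | append_singleton l x ih =>
    simp only [List.foldl_append, List.foldl_cons, List.foldl_nil]
    generalize l.foldl (fun c x => if 0 < ((f x).length : ℝ) - (c.length : ℝ) then f x else c) [] =
      c at ih
    obtain ⟨h1, h2⟩ := ih
    by_cases h : 0 < ((f x).length : ℝ) - (c.length : ℝ)
    · rw [if_pos h]
      have h' : c.length < (f x).length := by
        rw [sub_pos] at h
        exact_mod_cast h
      refine ⟨Or.inr ⟨x, by simp, rfl⟩, fun y hy => ?_⟩
      rcases List.mem_append.1 hy with hy | hy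
      · exact (h2 y hy).trans h'.le
      · rw [List.mem_singleton.1 hy]
    · rw [if_neg h]
      have h' : (f x).length ≤ c.length := by
        rw [sub_pos, not_lt] at h
        exact_mod_cast h
      refine ⟨h1.imp_right fun ⟨y, hy, hc⟩ => ⟨y, by simp [hy], hc⟩, fun y hy => ?_⟩
      rcases List.mem_append.1 hy with hy | hy
      · exact h2 y hy
      · rw [List.mem_singleton.1 hy]
        exact h'

/-- Finitely many linear functionals, none of which vanishes on all vectors of the list `L`, are
simultaneously nonzero on one of the first combinations `∑ k^(s-1-i) v_i`, `k = 0, 1, 2, …`: each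
functional gives a nonzero polynomial in `k`. -/
theorem exists_horner_ne_zero {ι J : Type} [Fintype ι] [Fintype J] (L : List (ι → ℝ))
    (r : J → ι → ℝ) (h : ∀ j, ∃ v ∈ L, r j ⬝ᵥ v ≠ 0) {M : ℕ}
    (hM : Fintype.card J * L.length < M) :
    ∃ k < M, ∀ j, r j ⬝ᵥ (L.foldl (fun c v => (k : ℝ) • c + v) 0) ≠ 0 := by
  let q : J → Polynomial ℝ := fun j => polyOfList (L.map fun v => r j ⬝ᵥ v).reverse
  have hq : ∀ j, q j ≠ 0 := by
    intro j h0
    obtain ⟨v, hv, hne⟩ := h j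
    have hmem : r j ⬝ᵥ v ∈ (L.map fun v => r j ⬝ᵥ v).reverse :=
      List.mem_reverse.2 (List.mem_map.2 ⟨v, hv, rfl⟩)
    obtain ⟨i, hi, hiv⟩ := List.getElem_of_mem hmem
    have := polyOfList_coeff (L.map fun v => r j ⬝ᵥ v).reverse i
    rw [List.getD_eq_getElem _ _ hi, hiv] at this
    rw [show polyOfList _ = 0 from h0, Polynomial.coeff_zero] at this
    exact hne this.symm
  have heval : ∀ j (θ : ℝ), (q j).eval θ = r j ⬝ᵥ (L.foldl (fun c v => θ • c + v) 0) := by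
    intro j θ
    have : ∀ (L : List (ι → ℝ)) (z : ι → ℝ),
        (L.map fun v => r j ⬝ᵥ v).foldl (fun c x => θ * c + x) (r j ⬝ᵥ z) =
        r j ⬝ᵥ (L.foldl (fun c v => θ • c + v) z) := by
      intro L
      induction L with
      | nil => intro z; rfl
      | cons v L ih =>
        intro z
        rw [List.map_cons, List.foldl_cons, List.foldl_cons, ← ih, dotProduct_add,
          dotProduct_smul, smul_eq_mul]
    rw [← this L 0, dotProduct_zero]
    exact eval_polyOfList_reverse _ θ
  have hdeg : (∏ j, q j).natDegree ≤ Fintype.card J * L.length := by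
    refine (Polynomial.natDegree_prod_le _ _).trans ?_
    refine (Finset.sum_le_card_nsmul _ _ L.length fun j _ => ?_).trans_eq (by simp)
    refine Polynomial.natDegree_le_iff_coeff_eq_zero.2 fun i hi => ?_
    rw [polyOfList_coeff]
    exact List.getD_eq_default _ _ (by simpa using hi.le)
  by_contra hn
  push Not at hn
  refine Finset.prod_ne_zero_iff.2 (fun j _ => hq j) (Polynomial.eq_zero_of_natDegree_lt_card_of_eval_eq_zero'
    (∏ j, q j) ((Finset.range M).image fun k : ℕ => (k : ℝ)) (fun x hx => ?_) ?_)
  · obtain ⟨k, hk, rfl⟩ := Finset.mem_image.1 hx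
    obtain ⟨j, hj⟩ := hn k (Finset.mem_range.1 hk)
    rw [Polynomial.eval_prod]
    exact Finset.prod_eq_zero (Finset.mem_univ j) (by rw [heval, hj])
  · rw [Finset.card_image_of_injective _ Nat.cast_injective, Finset.card_range]
    omega

theorem foldl_mem_spanL {ι : Type} (L : List (ι → ℝ)) (θ : ℝ) :
    L.foldl (fun c v => θ • c + v) 0 ∈ spanL L := by
  have : ∀ (L' : List (ι → ℝ)) (S : Submodule ℝ (ι → ℝ)), (∀ v ∈ L', v ∈ S) → ∀ z ∈ S,
      L'.foldl (fun c v => θ • c + v) z ∈ S := by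
    intro L' S
    induction L' with
    | nil => exact fun _ z hz => hz
    | cons v L' ih =>
      intro h z hz
      exact ih (fun u hu => h u (by simp [hu])) _
        (S.add_mem (S.smul_mem _ hz) (h v (by simp)))
  exact this L _ (fun v hv => Submodule.subset_span hv) 0 (Submodule.zero_mem _)

/-- The search returns the eigenvectors of a matrix with distinct nonzero eigenvalues on the
`w_ℓ`. -/
theorem search_spec {ι κ : Type} [Fintype ι] [DecidableEq ι] [Fintype κ] [DecidableEq κ]
    {e : List ι} (he : IsEnum e) {w g : κ → ι → ℝ} (hw : LinearIndependent ℝ w)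
    (hg : IsDual w g) {L : List (ι × ι → ℝ)} (hlen : L.length ≤ (e ×ˢ e).length)
    (hL : ∀ v, v ∈ spanL L ↔ ∃ ξ, toMat v = diagComb w g ξ) :
    ∃ (ξ : κ → ℝ) (S : List ℝ) (i : Fin S.length ≃ κ), (∀ k, ξ k ≠ 0) ∧ Function.Injective ξ ∧
      (∀ a : Fin S.length, S[a] = ξ (i a)) ∧
      search (basisList e) (L.map fun v => (e ×ˢ e).map v) = S.map fun c =>
        (eigvec (basisList e) (mlist e (diagComb w g ξ)) c,
          eigvec (basisList e) (mlist e (diagComb g w ξ)) c) := by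
  have hne := hw.ne_zero
  -- The coefficient of `w_k g_kᵀ` in a matrix.
  let ρ : κ → ι × ι → ℝ := fun k x => g k x.1 * w k x.2
  have hρ : ∀ k v ξ, toMat v = diagComb w g ξ → ρ k ⬝ᵥ v = ξ k := by
    intro k v ξ h
    have h1 : ρ k ⬝ᵥ v = g k ⬝ᵥ (toMat v *ᵥ w k) := by
      simp only [ρ, dotProduct, Fintype.sum_prod_type, mulVec, Finset.mul_sum, toMat, of_apply]
      exact Finset.sum_congr rfl fun p _ => Finset.sum_congr rfl fun q _ => by ring
    rw [h1, h, dual_mulVec hg.dual, dotProduct_smul, hg.dual]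
    simp
  have hmatch : ∀ ξ : κ → ℝ, ∃ S : List ℝ, S.Nodup ∧ (∀ c, c ∈ S ↔ c ≠ 0 ∧ ∃ k, c = ξ k) ∧
      eigenpairs (basisList e) (mlist e (diagComb w g ξ)) = S.map fun c =>
        (eigvec (basisList e) (mlist e (diagComb w g ξ)) c,
          eigvec (basisList e) (mlist e (diagComb g w ξ)) c) :=
    eigenpairs_diagComb he hg.dual hne
  have hcard : ∀ (ξ : κ → ℝ), (eigenpairs (basisList e) (mlist e (diagComb w g ξ))).length =
      ((Finset.univ.image ξ).filter fun c => c ≠ 0).card := by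
    intro ξ
    obtain ⟨S, h1, h2, h3⟩ := hmatch ξ
    rw [h3, List.length_map, ← List.toFinset_card_of_nodup h1]
    congr 1
    ext c
    simp [h2, and_comm, eq_comm]
  have hle : ∀ ξ : κ → ℝ, ((Finset.univ.image ξ).filter fun c => c ≠ 0).card ≤ Fintype.card κ :=
    fun ξ => (Finset.card_filter_le _ _).trans Finset.card_image_le
  have hhorner : ∀ θ : ℝ, ∃ ξ : κ → ℝ,
      horner (basisList e) θ (L.map fun v => (e ×ˢ e).map v) = mlist e (diagComb w g ξ) ∧
      ∀ k, ξ k = ρ k ⬝ᵥ (L.foldl (fun c v => θ • c + v) 0) := by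
    intro θ
    obtain ⟨ξ, hξ⟩ := (hL _).1 (foldl_mem_spanL L θ)
    refine ⟨ξ, ?_, fun k => (hρ k _ ξ hξ).symm⟩
    rw [horner_map, map_eq_mlist, hξ]
  -- Some candidate has distinct nonzero eigenvalues, so the longest list has `card κ` entries.
  let r : κ × κ → ι × ι → ℝ := fun x => if x.1 = x.2 then ρ x.1 else ρ x.1 - ρ x.2
  have hr : ∀ x, ∃ v ∈ L, r x ⬝ᵥ v ≠ 0 := by
    intro x
    by_contra hn
    push Not at hn
    have h1 := dotProduct_eq_zero_of_mem_spanL hn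
      ((hL (fun y => diagComb w g (Pi.single x.1 1) y.1 y.2)).2 ⟨_, rfl⟩)
    have h2 : ∀ k, ρ k ⬝ᵥ (fun y : ι × ι => diagComb w g (Pi.single x.1 1) y.1 y.2) =
        (Pi.single x.1 1 : κ → ℝ) k := fun k => hρ k _ _ rfl
    by_cases hx : x.1 = x.2
    · simp [r, hx] at h1 h2
      rw [h2] at h1
      simp at h1
    · have hx' : x.2 ≠ x.1 := Ne.symm hx
      simp only [r, hx, if_false, sub_dotProduct, h2] at h1
      simp [hx'] at h1
  obtain ⟨k₀, hk₀, hk₀'⟩ := exists_horner_ne_zero L r hr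
    (M := (0 :: (tensorBasis (basisList e)).flatten).length) (by
      -- With `N = card ι` there are at most `N²` functionals and `N²` matrices, and `N⁴ + 1`
      -- candidates are tried.
      have hκ : Fintype.card κ ≤ Fintype.card ι := by
        have := hw.fintype_card_le_finrank
        rwa [Module.finrank_fintype_fun_eq_card] at this
      rw [tensorBasis_basisList]
      have h1 : (basisList (e ×ˢ e)).flatten.length = (e ×ˢ e).length * (e ×ˢ e).length := by
        simp [basisList, List.length_flatten, Function.comp_def]
      rw [List.length_cons, h1, Fintype.card_prod, Nat.lt_succ_iff]
      refine Nat.mul_le_mul ?_ hlen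
      rw [product_eq_flatMap]
      simp only [List.length_flatMap, List.length_map, List.map_const', List.sum_replicate,
        smul_eq_mul, he.length]
      exact Nat.mul_le_mul hκ hκ)
  have hfold := foldl_longest
    (fun θ => eigenpairs (basisList e) (horner (basisList e) θ (L.map fun v => (e ×ˢ e).map v)))
    (idx (0 :: (tensorBasis (basisList e)).flatten))
  change (search (basisList e) (L.map fun v => (e ×ˢ e).map v) = [] ∨ ∃ x ∈ _,
    search (basisList e) (L.map fun v => (e ×ˢ e).map v) = _) ∧ ∀ x ∈ _, _ ≤
    (search (basisList e) (L.map fun v => (e ×ˢ e).map v)).length at hfold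
  obtain ⟨hres, hmax⟩ := hfold
  have hlen₀ : Fintype.card κ ≤
      (search (basisList e) (L.map fun v => (e ×ˢ e).map v)).length := by
    refine le_trans ?_ (hmax (k₀ : ℝ) (List.mem_map.2 ⟨k₀, List.mem_range.2 hk₀, rfl⟩))
    obtain ⟨ξ, hξ, hξ'⟩ := hhorner k₀
    rw [hξ, hcard]
    have h0 : ∀ k, ξ k ≠ 0 := fun k => by
      have := hk₀' (k, k)
      simp only [r, if_true] at this
      rwa [hξ']
    have hinj : Function.Injective ξ := by
      intro k l hkl
      by_contra hne
      have := hk₀' (k, l)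
      simp only [r, hne, if_false, sub_dotProduct, ← hξ', hkl, sub_self] at this
      exact this rfl
    rw [Finset.filter_true_of_mem (by
      intro c hc
      obtain ⟨k, -, rfl⟩ := Finset.mem_image.1 hc
      exact h0 k), Finset.card_image_of_injective _ hinj, Finset.card_univ]
  obtain ⟨ξ, hξ⟩ : ∃ ξ : κ → ℝ, search (basisList e) (L.map fun v => (e ×ˢ e).map v) =
      eigenpairs (basisList e) (mlist e (diagComb w g ξ)) := by
    rcases hres with h | ⟨θ, -, h⟩
    · refine ⟨0, ?_⟩
      rw [h, List.length_nil] at hlen₀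
      have h1 := (hcard 0).trans_le ((hle 0).trans hlen₀)
      rw [h, List.length_eq_zero_iff.1 (Nat.le_zero.1 h1)]
    · obtain ⟨ξ, hξ, -⟩ := hhorner θ
      exact ⟨ξ, by rw [h, hξ]⟩
  rw [hξ, hcard] at hlen₀
  have himage : Fintype.card κ ≤ (Finset.univ.image ξ).card :=
    hlen₀.trans (Finset.card_filter_le _ _)
  have hinj : Function.Injective ξ := by
    have := Finset.card_image_iff.1 (le_antisymm Finset.card_image_le himage)
    exact fun a b h => this (by simp) (by simp) h
  have h0 : ∀ k, ξ k ≠ 0 := by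
    have h1 := Finset.eq_of_subset_of_card_le (Finset.filter_subset (fun c => c ≠ 0) _)
      (Finset.card_image_le.trans hlen₀)
    intro k
    have h2 : ξ k ∈ Finset.univ.image ξ := Finset.mem_image_of_mem _ (Finset.mem_univ k)
    rw [← h1] at h2
    exact (Finset.mem_filter.1 h2).2
  obtain ⟨S, h1, h2, h3⟩ := hmatch ξ
  have hS : ∀ a : Fin S.length, ∃ k, S[a] = ξ k := fun a => ((h2 _).1 (List.getElem_mem _)).2
  choose f hf using hS
  have hbij : Function.Bijective f := by
    refine ⟨fun a b hab => ?_, fun k => ?_⟩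
    · have h4 : S[a] = S[b] := by rw [hf, hf, hab]
      exact Fin.ext (h1.getElem_inj_iff.1 h4)
    · obtain ⟨a, ha, hak⟩ := List.getElem_of_mem ((h2 (ξ k)).2 ⟨h0 k, k, rfl⟩)
      exact ⟨⟨a, ha⟩, hinj ((hf ⟨a, ha⟩).symm.trans hak)⟩
  exact ⟨ξ, S, Equiv.ofBijective f hbij, h0, hinj, hf, by rw [hξ, h3]⟩

end Search

end RealMachine

/-! ### Correctness of the program -/

namespace RealMachine

open Enc (enc)

theorem headD_map_finRange {α : Type} {n : ℕ} (hn : 0 < n) (f : Fin n → α) (x : α) :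
    ((List.finRange n).map f).headD x = f ⟨0, hn⟩ := by
  obtain ⟨m, rfl⟩ := Nat.exists_eq_succ_of_ne_zero hn.ne'
  simp [List.finRange_succ]

theorem enc_map_finRange {α : Type} [Enc α] {n : ℕ} (f : Fin n → α) :
    enc ((List.finRange n).map f) = encSeq fun i => enc (f i) := by
  rw [encSeq, List.ofFn_eq_map]
  exact congrArg Val.ofList (List.map_map ..)

theorem enc_map_getElem {α β : Type} [Enc β] (S : List α) (f : α → β) :
    enc (S.map f) = encSeq fun a : Fin S.length => enc (f S[a]) := by
  rw [← enc_map_finRange]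
  congr 1
  apply List.ext_getElem <;> simp

theorem columns_map {ι κ : Type} [DecidableEq κ] [Fintype κ] {e : List ι} {f : List κ}
    (he : e ≠ []) (hf : IsEnum f) (X : ι → κ → ℝ) :
    columns (e.map fun p => f.map (X p)) = f.map fun q => e.map fun p => X p q := by
  have h : stdBasis ((e.map fun p => f.map (X p)).headD []) = basisList f := by
    refine stdBasis_eq hf.nodup ?_
    cases e with
    | nil => exact absurd rfl he
    | cons p e => simp
  rw [columns, h, basisList]
  simp only [List.map_map, Function.comp_def, hf.dot, dotProduct_single_one]

/-! ### The input -/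

section Input

variable {n₁ n₂ n₃ n₄ : ℕ}

/-- A tensor as a nested list of its entries, the input of `decompose`. -/
def tensorList (T : Tensor4 n₁ n₂ n₃ n₄) : List (List (List (List ℝ))) :=
  (List.finRange n₁).map fun i => (List.finRange n₂).map fun j => (List.finRange n₃).map fun k =>
    (List.finRange n₄).map (T i j k)

theorem enc_tensorList (T : Tensor4 n₁ n₂ n₃ n₄) : enc (tensorList T) = encTensor T := by
  simp only [tensorList, enc_map_finRange]
  rfl

/-- Each level of nesting raises the number of nodes per entry by at most `2`. -/
theorem sz_map_finRange_le {α : Type} [Enc α] {n c B : ℕ} (hn : 0 < n) (hB : 0 < B)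
    (f : Fin n → α) (h : ∀ i, sz (f i) ≤ c * B) :
    sz ((List.finRange n).map f) ≤ (c + 2) * (n * B) := by
  have h1 : ∀ l : List (Fin n), sz (l.map f) ≤ l.length * (c * B + 1) + 1 := by
    intro l
    induction l with
    | nil => simp
    | cons i l ih =>
      have := h i
      simp only [List.map_cons, sz_cons, List.length_cons, Nat.add_mul, Nat.one_mul]
      omega
  refine (h1 _).trans ?_
  rw [List.length_finRange]
  nlinarith [Nat.mul_pos hn hB, Nat.mul_le_mul_left n hB]

theorem sz_tensorList_le (h₁ : 0 < n₁) (h₂ : 0 < n₂) (h₃ : 0 < n₃) (h₄ : 0 < n₄)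
    (T : Tensor4 n₁ n₂ n₃ n₄) : sz (tensorList T) ≤ 9 * (n₁ * n₂ * n₃ * n₄) := by
  refine (sz_map_finRange_le (c := 7) (B := n₂ * (n₃ * (n₄ * 1))) h₁ (by positivity) _ fun i =>
    sz_map_finRange_le (c := 5) h₂ (by positivity) _ fun j =>
    sz_map_finRange_le (c := 3) h₃ (by positivity) _ fun k =>
    sz_map_finRange_le (c := 1) h₄ one_pos _ fun l => le_rfl).trans_eq (by ring)

theorem flatRows_tensorList (T : Tensor4 n₁ n₂ n₃ n₄) :
    flatRows (tensorList T) = (List.finRange n₁ ×ˢ List.finRange n₂).map fun p =>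
      (List.finRange n₃ ×ˢ List.finRange n₄).map fun q => T p.1 p.2 q.1 q.2 := by
  simp [flatRows, tensorList, product_eq_flatMap, Function.comp_def, List.flatMap_def]

end Input

/-! ### Factoring rank-one matrices -/

section Factor

variable {m n : ℕ}

theorem factor_map (hm : 0 < m) (hn : 0 < n) (v : JLV.V m n) :
    factor (basisList (List.finRange m)) (basisList (List.finRange n))
        ((List.finRange m ×ˢ List.finRange n).map v) =
      ((List.finRange m).map fun i => v (i, ⟨0, hn⟩),
        (List.finRange n).map fun j => v (⟨0, hm⟩, j) / v (⟨0, hm⟩, ⟨0, hn⟩)) := by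
  have h := ((isEnum_finRange m).prod (isEnum_finRange n)).dot
  simp only [factor, basisList, headD_map_finRange hm, headD_map_finRange hn, List.map_map,
    Function.comp_def, kron_single, h, dotProduct_single_one]

theorem exists_factor_eq (hm : 0 < m) (hn : 0 < n) {a : Fin m → ℝ} {b : Fin n → ℝ}
    (ha : ∀ i, a i ≠ 0) (hb : ∀ j, b j ≠ 0) {s : ℝ} (hs : s ≠ 0) :
    ∃ (x : Fin m → ℝ) (y : Fin n → ℝ),
      factor (basisList (List.finRange m)) (basisList (List.finRange n))
        ((List.finRange m ×ˢ List.finRange n).map (s • JLV.outer a b)) =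
          ((List.finRange m).map x, (List.finRange n).map y) ∧
      JLV.outer x y = s • JLV.outer a b := by
  refine ⟨_, _, factor_map hm hn _, ?_⟩
  ext p
  have h1 := ha ⟨0, hm⟩
  have h2 := hb ⟨0, hn⟩
  simp only [JLV.outer, Pi.smul_apply, smul_eq_mul]
  field_simp

end Factor

/-! ### The output -/

section Output

variable {n₁ n₂ n₃ n₄ R : ℕ} {w : Components n₁ n₂ n₃ n₄ R}

/-- The columns of the flattening define the orthogonal complement of the matrices `a bᵀ`. -/
theorem isConstraints_columns (h : 0 < n₁) (h' : 0 < n₂) (hw : w.General) :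
    IsConstraints (List.finRange n₁ ×ˢ List.finRange n₂) (columns (flatRows (tensorList w.tensor)))
      fun η => ∀ ℓ, w.ab ℓ ⬝ᵥ η = 0 := by
  have hne : List.finRange n₁ ×ˢ List.finRange n₂ ≠ [] :=
    List.ne_nil_of_mem (a := (⟨0, h⟩, ⟨0, h'⟩)) (List.mem_product.2 ⟨by simp, by simp⟩)
  rw [flatRows_tensorList, columns_map hne ((isEnum_finRange n₃).prod (isEnum_finRange n₄))]
  refine (IsConstraints.map (r := fun (q : Fin n₃ × Fin n₄) (p : Fin n₁ × Fin n₂) =>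
    w.tensor p.1 p.2 q.1 q.2) fun q => rfl).congr fun η => ?_
  have hmem : ∀ S : Set (JLV.V n₁ n₂), (∀ u ∈ S, u ⬝ᵥ η = 0) ↔
      ∀ u ∈ Submodule.span ℝ S, u ⬝ᵥ η = 0 := by
    refine fun S => ⟨fun hS u hu => ?_, fun hS u hu => hS u (Submodule.subset_span hu)⟩
    induction hu using Submodule.span_induction with
    | mem u hu => exact hS u hu
    | zero => exact zero_dotProduct _
    | add u v _ _ ih ih' => rw [add_dotProduct, ih, ih', add_zero]
    | smul c u _ ih => rw [smul_dotProduct, ih, smul_zero]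
  have h1 := hmem (Set.range w.ab)
  rw [← hw.colSpace_tensor, JLV.colSpace, ← hmem] at h1
  simp only [Set.forall_mem_range] at h1
  rw [h1]
  exact ⟨fun hq q => hq q (((isEnum_finRange n₃).prod (isEnum_finRange n₄)).complete q),
    fun hq q _ => hq q⟩

theorem isConstraints_liftCons (hw : w.General) {N : List (JLV.V n₁ n₂)}
    (hN : ∀ η, η ∈ spanL N ↔ ∀ ℓ, w.ab ℓ ⬝ᵥ η = 0) :
    IsConstraints ((List.finRange n₁ ×ˢ List.finRange n₂) ×ˢ (List.finRange n₁ ×ˢ List.finRange n₂))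
      (liftCons (basisList (List.finRange n₁ ×ˢ List.finRange n₂)) (basisList (List.finRange n₁))
        (basisList (List.finRange n₂))
        (N.map fun v => (List.finRange n₁ ×ˢ List.finRange n₂).map v))
      fun v => ∃ d, toMat v = diagComb w.ab w.ab d := by
  have h₁ := isEnum_finRange n₁
  have h₂ := isEnum_finRange n₂
  obtain ⟨g, hg⟩ := exists_isDual hw.indep_ab
  refine (((isConstraints_nullCons (h₁.prod h₂) N).append
    (isConstraints_symCons (h₁.prod h₂))).append (isConstraints_minorCons h₁ h₂)).congr
    fun v => ⟨?_, ?_⟩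
  · rintro ⟨⟨h0, hs⟩, hm⟩
    refine hw.diag_of_minors (C := fun k l => g k ⬝ᵥ (toMat v *ᵥ g l)) (fun k l => ?_)
      (mulVec_dual_expansion hg hs fun η hη => h0 η ((hN η).2 hη)) fun a c b d => ?_
    · have hT : (toMat v)ᵀ = toMat v := by ext p q; exact hs q p
      rw [dotProduct_mulVec, ← mulVec_transpose, hT, dotProduct_comm]
    · rw [hm, hs]
  · rintro ⟨d, hd⟩
    have hs : ∀ p q, toMat v p q = toMat v q p := by
      rw [hd]; exact Components.diagComb_self_symm w.ab d
    refine ⟨⟨fun η hη => ?_, hs⟩, fun i i' j j' => ?_⟩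
    · rw [hd, diagComb_mulVec]
      simp [(hN η).1 hη]
    · rw [hs, hd, Components.diagComb_ab_exchange]

/-- The quadruple found from eigenvectors on the lines of `a bᵀ` and of its dual vector. -/
theorem exists_quad_eq (h₁ : 0 < n₁) (h₂ : 0 < n₂) (h₃ : 0 < n₃) (h₄ : 0 < n₄) (hw : w.General)
    {g : Fin R → JLV.V n₁ n₂} (hg : IsDual w.ab g) (ℓ : Fin R) {s r : ℝ} (hs : s ≠ 0)
    (hr : r ≠ 0) :
    ∃ (a : Fin n₁ → ℝ) (b : Fin n₂ → ℝ) (c : Fin n₃ → ℝ) (d : Fin n₄ → ℝ),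
      quad (basisList (List.finRange n₁)) (basisList (List.finRange n₂))
        (basisList (List.finRange n₃)) (basisList (List.finRange n₄))
        (columns (flatRows (tensorList w.tensor)))
        ((List.finRange n₁ ×ˢ List.finRange n₂).map (s • w.ab ℓ),
          (List.finRange n₁ ×ˢ List.finRange n₂).map (r • g ℓ)) =
        ((List.finRange n₁).map a, (List.finRange n₂).map b, (List.finRange n₃).map c,
          (List.finRange n₄).map d) ∧
      JLV.outer a b = s • w.ab ℓ ∧ JLV.outer c d = s⁻¹ • w.cd ℓ := by
  have hne : List.finRange n₁ ×ˢ List.finRange n₂ ≠ [] :=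
    List.ne_nil_of_mem (a := (⟨0, h₁⟩, ⟨0, h₂⟩)) (List.mem_product.2 ⟨by simp, by simp⟩)
  have he := (isEnum_finRange n₁).prod (isEnum_finRange n₂)
  obtain ⟨a, b, h1, h2⟩ := exists_factor_eq h₁ h₂ (a := w.a ℓ) (b := w.b ℓ)
    (fun _ => hw.ne_zero _) (fun _ => hw.ne_zero _) hs
  obtain ⟨c, d, h3, h4⟩ := exists_factor_eq h₃ h₄ (a := w.c ℓ) (b := w.d ℓ)
    (fun _ => hw.ne_zero _) (fun _ => hw.ne_zero _) (inv_ne_zero hs)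
  refine ⟨a, b, c, d, ?_, h2, h4⟩
  have h5 : ((columns (flatRows (tensorList w.tensor))).map fun col =>
      dot ((List.finRange n₁ ×ˢ List.finRange n₂).map (r • g ℓ)) col /
        dot ((List.finRange n₁ ×ˢ List.finRange n₂).map (r • g ℓ))
          ((List.finRange n₁ ×ˢ List.finRange n₂).map (s • w.ab ℓ))) =
      (List.finRange n₃ ×ˢ List.finRange n₄).map (s⁻¹ • JLV.outer (w.c ℓ) (w.d ℓ)) := by
    rw [flatRows_tensorList, columns_map hne ((isEnum_finRange n₃).prod (isEnum_finRange n₄)),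
      List.map_map]
    refine List.map_congr_left fun q _ => ?_
    have hT : (fun p : Fin n₁ × Fin n₂ => w.tensor p.1 p.2 q.1 q.2) =
        ∑ k, w.cd k q • w.ab k := by
      ext p
      simp only [Finset.sum_apply, Pi.smul_apply, smul_eq_mul, Components.tensor_apply]
      exact Finset.sum_congr rfl fun k _ => mul_comm _ _
    simp only [Function.comp_def, he.dot, hT, dotProduct_sum, smul_dotProduct, dotProduct_smul,
      hg.dual, smul_eq_mul, mul_ite, mul_one, mul_zero, Finset.sum_ite_eq, Finset.mem_univ,
      if_true, Pi.smul_apply]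
    change w.cd ℓ q * r / (s * r) = s⁻¹ * w.cd ℓ q
    field_simp
  change ((factor _ _ ((List.finRange n₁ ×ˢ List.finRange n₂).map (s • w.ab ℓ))).1,
    (factor _ _ ((List.finRange n₁ ×ˢ List.finRange n₂).map (s • w.ab ℓ))).2, factor _ _ _) = _
  dsimp only
  rw [h5, h3]
  change ((factor _ _ ((List.finRange n₁ ×ˢ List.finRange n₂).map
    (s • JLV.outer (w.a ℓ) (w.b ℓ)))).1, (factor _ _ ((List.finRange n₁ ×ˢ List.finRange n₂).map
    (s • JLV.outer (w.a ℓ) (w.b ℓ)))).2, _) = _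
  rw [h1]

/-- The eigenvector computed for the eigenvalue `ξ_k` of `∑ ξ_l w_l g_lᵀ` lies on the line of
`w_k`. -/
theorem exists_eigvec_eq {ι κ : Type} [Fintype ι] [DecidableEq ι] [Fintype κ] [DecidableEq κ]
    {e : List ι} (he : IsEnum e) {w g : κ → ι → ℝ}
    (h : ∀ k l, g k ⬝ᵥ w l = if k = l then 1 else 0) {ξ : κ → ℝ} (h0 : ∀ k, ξ k ≠ 0)
    (hinj : Function.Injective ξ) (hw : ∀ k, w k ≠ 0) (k : κ) :
    ∃ s : ℝ, s ≠ 0 ∧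
      eigvec (basisList e) (mlist e (diagComb w g ξ)) (ξ k) = e.map (s • w k) := by
  rcases eigvec_mlist he (diagComb w g ξ) (ξ k) with ⟨u, h1, h2, h3⟩ | ⟨h1, -⟩
  · have h4 := (eigenvector_diagComb h (h0 k) h2 h1).2 hinj k rfl
    refine ⟨g k ⬝ᵥ u, fun hs => h2 ?_, by rw [h3, ← h4]⟩
    rw [h4, hs, zero_smul]
  · exact absurd (h1 _ (dual_mulVec h w ξ k)) (hw k)

/-- In general position, the program recovers the components up to order and scaling. -/
theorem exists_enc_decompose_eq (h₁ : 0 < n₁) (h₂ : 0 < n₂) (h₃ : 0 < n₃) (h₄ : 0 < n₄)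
    (hw : w.General) :
    ∃ (t : ℕ) (out : Components n₁ n₂ n₃ n₄ t), out.Matches w ∧
      enc (decompose (tensorList w.tensor)) = encComponents out := by
  obtain ⟨g, hg⟩ := exists_isDual hw.indep_ab
  have hE₁ := isEnum_finRange n₁
  have hE₂ := isEnum_finRange n₂
  have he := hE₁.prod hE₂
  have hcols := isConstraints_columns h₁ h₂ hw
  have hstd : stdBasis (flatRows (tensorList w.tensor)) =
      basisList (List.finRange n₁ ×ˢ List.finRange n₂) :=
    stdBasis_eq he.nodup (by rw [flatRows_tensorList, List.length_map])
  have hstd₁ : stdBasis (tensorList w.tensor) = basisList (List.finRange n₁) :=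
    stdBasis_eq hE₁.nodup (by simp [tensorList])
  have hstd₂ : stdBasis ((tensorList w.tensor).headD []) = basisList (List.finRange n₂) :=
    stdBasis_eq hE₂.nodup (by simp only [tensorList, headD_map_finRange h₁, List.length_map])
  have hstd₃ : stdBasis (((tensorList w.tensor).headD []).headD []) =
      basisList (List.finRange n₃) :=
    stdBasis_eq (isEnum_finRange n₃).nodup
      (by simp only [tensorList, headD_map_finRange h₁, headD_map_finRange h₂, List.length_map])
  have hstd₄ : stdBasis ((((tensorList w.tensor).headD []).headD []).headD []) =
      basisList (List.finRange n₄) :=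
    stdBasis_eq (isEnum_finRange n₄).nodup
      (by simp only [tensorList, headD_map_finRange h₁, headD_map_finRange h₂,
        headD_map_finRange h₃, List.length_map])
  obtain ⟨N, hN, -, hN'⟩ := ker_basisList he hcols
  have hlift := isConstraints_liftCons hw hN'
  obtain ⟨P, hP, -, hP'⟩ := ker_basisList (he.prod he) hlift
  obtain ⟨L, hL, hlen, hL'⟩ := ker_basisList (he.prod he) (isConstraints_algCons hg he hN' hlift hP')
  obtain ⟨ξ, S, i, h0, hinj, hS, hsearch⟩ := search_spec he hw.indep_ab hg hlen hL'
  have hquad : ∀ a : Fin S.length, ∃ (x : Fin n₁ → ℝ) (y : Fin n₂ → ℝ) (z : Fin n₃ → ℝ)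
      (u : Fin n₄ → ℝ) (s : ℝ), s ≠ 0 ∧
      quad (basisList (List.finRange n₁)) (basisList (List.finRange n₂))
        (basisList (List.finRange n₃)) (basisList (List.finRange n₄))
        (columns (flatRows (tensorList w.tensor)))
        (eigvec (basisList (List.finRange n₁ ×ˢ List.finRange n₂))
            (mlist (List.finRange n₁ ×ˢ List.finRange n₂) (diagComb w.ab g ξ)) S[a],
          eigvec (basisList (List.finRange n₁ ×ˢ List.finRange n₂))
            (mlist (List.finRange n₁ ×ˢ List.finRange n₂) (diagComb g w.ab ξ)) S[a]) =
        ((List.finRange n₁).map x, (List.finRange n₂).map y, (List.finRange n₃).map z,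
          (List.finRange n₄).map u) ∧
      JLV.outer x y = s • w.ab (i a) ∧ JLV.outer z u = s⁻¹ • w.cd (i a) := by
    intro a
    have hg0 : ∀ k, g k ≠ 0 := fun k hk => by
      have := hg.dual k k
      simp [hk] at this
    obtain ⟨s, hs, hs'⟩ := exists_eigvec_eq he hg.dual h0 hinj hw.indep_ab.ne_zero (i a)
    obtain ⟨r, hr, hr'⟩ := exists_eigvec_eq he hg.dual' h0 hinj hg0 (i a)
    obtain ⟨x, y, z, u, h⟩ := exists_quad_eq h₁ h₂ h₃ h₄ hw hg (i a) hs hr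
    exact ⟨x, y, z, u, s, hs, by rw [hS a, hs', hr']; exact h.1, h.2⟩
  choose x y z u s hs hq hxy hzu using hquad
  refine ⟨S.length, Components.mk x y z u, ⟨i, s, fun a => ⟨hs a, hxy a, hzu a⟩⟩, ?_⟩
  have halg : algebraOf (basisList (List.finRange n₁ ×ˢ List.finRange n₂))
      (basisList (List.finRange n₁)) (basisList (List.finRange n₂))
      (N.map fun v => (List.finRange n₁ ×ˢ List.finRange n₂).map v) =
      L.map fun v => ((List.finRange n₁ ×ˢ List.finRange n₂) ×ˢ
        (List.finRange n₁ ×ˢ List.finRange n₂)).map v := by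
    rw [algebraOf, tensorBasis_basisList, hP, hL]
  rw [decompose, hstd, hstd₁, hstd₂, hstd₃, hstd₄, hN, halg, hsearch, List.map_map,
    enc_map_getElem, encComponents]
  congr 1
  funext a
  rw [Function.comp_apply, hq a]
  simp only [enc_pair, enc_map_finRange]
  rfl

end Output

end RealMachine

end

theorem corollary7p2 :
    ∃ (prog : RealMachine.Prog) (q : Polynomial ℕ),
      ∀ n₁ n₂ n₃ n₄ : ℕ, 2 ≤ n₁ → 2 ≤ n₂ → 1 ≤ n₃ → 1 ≤ n₄ →
        -- the program halts in polynomial time on every tensor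
        (∀ T : Tensor4 n₁ n₂ n₃ n₄, ∃ (r : RealMachine.Val) (time : ℕ),
          RealMachine.Runs prog (RealMachine.encTensor T) r time ∧
            time ≤ q.eval (n₁ * n₂ * n₃ * n₄)) ∧
        ∀ R : ℕ, (R : ℝ) ≤ min ((1 / 2) * ((n₁ : ℝ) - 1) * ((n₂ : ℝ) - 2)) ((n₃ : ℝ) * n₄) →
          Generically fun w : Components n₁ n₂ n₃ n₄ R =>
            -- the tensor has rank exactly `R`
            (∀ (t : ℕ) (w' : Components n₁ n₂ n₃ n₄ t), w'.tensor = w.tensor → R ≤ t) ∧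
            -- for every choice of the basis, generic functionals make the JLV algorithm succeed
            (∀ (s : ℕ) (P : Fin s → JLV.VV n₁ n₂), JLV.IsLiftBasis w.tensor P →
              Generically fun xy : Fin s ⊕ Fin s → ℝ =>
                ∃ (t : ℕ) (out : Components n₁ n₂ n₃ n₄ t),
                  JLV.IsRun w.tensor P (fun k => xy (Sum.inl k)) (fun k => xy (Sum.inr k)) out) ∧
            -- every successful run of the JLV algorithm recovers the components
            (∀ (t : ℕ) (out : Components n₁ n₂ n₃ n₄ t), JLV.IsOutput w.tensor out →
              out.SameUpToPermScale w) ∧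
            -- the program computes an output of the JLV algorithm
            ∃ (t : ℕ) (out : Components n₁ n₂ n₃ n₄ t) (time : ℕ),
              RealMachine.Runs prog (RealMachine.encTensor w.tensor)
                (RealMachine.encComponents out) time ∧
              time ≤ q.eval (n₁ * n₂ * n₃ * n₄) ∧ JLV.IsOutput w.tensor out := by
  obtain ⟨prog, q, hprog⟩ := RealMachine.polyTime_decompose
  refine ⟨prog, q.comp (9 * Polynomial.X), fun n₁ n₂ n₃ n₄ h₁ h₂ h₃ h₄ => ?_⟩
  have h₁' : 0 < n₁ := by omega
  have h₂' : 0 < n₂ := by omega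
  have hrun : ∀ T : Tensor4 n₁ n₂ n₃ n₄, ∃ time,
      RealMachine.Runs prog (RealMachine.encTensor T)
        (RealMachine.Enc.enc (RealMachine.decompose (RealMachine.tensorList T))) time ∧
      time ≤ (q.comp (9 * Polynomial.X)).eval (n₁ * n₂ * n₃ * n₄) := by
    intro T
    obtain ⟨⟨t, ht, h⟩, -⟩ := hprog (RealMachine.tensorList T)
    rw [RealMachine.enc_tensorList] at h
    refine ⟨t, h, ht.trans ?_⟩
    rw [Polynomial.eval_comp, Polynomial.eval_mul, Polynomial.eval_X, Polynomial.eval_ofNat]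
    exact RealMachine.eval_mono q (RealMachine.sz_tensorList_le h₁' h₂' h₃ h₄ T)
  refine ⟨fun T => ⟨_, hrun T⟩, fun R hR => ?_⟩
  obtain ⟨m, rfl⟩ : ∃ m, n₁ = m + 1 := ⟨n₁ - 1, by omega⟩
  -- `R ≤ (n₁ - 1) (n₂ - 2) / 2` and `(n₂ - 2) / 2 ≤ ⌊n₂ / 2⌋`.
  have hR₁ : R ≤ m * (n₂ / 2) := by
    have h := hR.trans (min_le_left _ _)
    have h' : n₂ ≤ 2 * (n₂ / 2) + 2 := by omega
    have h'' : (n₂ : ℝ) ≤ 2 * ((n₂ / 2 : ℕ) : ℝ) + 2 := by exact_mod_cast h'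
    push_cast at h
    have : (R : ℝ) ≤ m * ((n₂ / 2 : ℕ) : ℝ) := by
      nlinarith [mul_le_mul_of_nonneg_left h'' (Nat.cast_nonneg (α := ℝ) m)]
    exact_mod_cast this
  have hR₂ : R ≤ n₃ * n₄ := by exact_mod_cast hR.trans (min_le_right _ _)
  refine (Components.generically_general (Nat.mul_div_le n₂ 2) hR₁ hR₂).mono fun w hw => ?_
  refine ⟨fun t w' h => hw.rank h, fun s P hP => ?_, fun t out hout => ?_, ?_⟩
  · exact (hw.generically_isRun (Components.Matches.refl w) hP).mono fun xy h => ⟨R, w, h⟩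
  · exact hw.sameUpToPermScale h₁' h₂' h₃ h₄ (hw.matches_of_isOutput hout)
  · obtain ⟨t, out, hout, henc⟩ := RealMachine.exists_enc_decompose_eq h₁' h₂' h₃ h₄ hw
    obtain ⟨time, h, htime⟩ := hrun (Components.tensor w)
    rw [henc] at h
    exact ⟨t, out, time, h, htime, hw.isOutput hout⟩
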